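/- **Setting.** Identify $\mathbb R^7$ with the imaginary octonions $\mathrm{Im}\,\mathbb O$ (basis $i,j,k,l,il,jl,kl$, where octonions are $a+bl$ with $a,b\in\mathbb H$ and $a(bl)=(ba)l$, $(al)b=(a\bar b)l$, $(al)(bl)=-\bar b a$), with the cross product $x\times y=\tfrac12(\bar y x-\bar x y)$. Let $G_2$ be the group of linear isometries of $\mathbb R^7$ preserving $\times$. Let $J_uX=u\times X$ be Kirchhoff's almost complex structure on $\mathbb S^6\subset\mathbb R^7$. Let $T\subset\mathbb R$ be an interval of positive length with $0\in T$. All maps of $(t,s)\in T\times\mathbb R$ are $C^\infty$. A Schrödinger flow to $(\mathbb S^6,J)$ is a map $u:T\times\mathbb R\to\mathbb S^6$ with $u_t=J_u(u_{ss}+|u_s|^2u)$. A $G_2$-binormal motion is a map $\gamma:T\times\mathbb R\to\mathbb R^7$ with $|\gamma_s|=1$ and $\gamma_t=\gamma_s\times\gamma_{ss}$. For a unit speed curve with unit tangent $I_4=u=\gamma_s$ and $k_1=|u_s|\ne0$ put $I_1=k_1^{-1}I_{4s}$, $I_5=I_1\times I_4$, $\rho_1=\langle I_{1s},I_5\rangle$,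 and $$\kappa_2=\sqrt{|I_{1s}|^2-\langle I_{1s},I_4\rangle^2-\langle I_{1s},I_5\rangle^2}.$$ If $\kappa_2\neq0$, put also $I_2=\kappa_2^{-1}(I_{1s}-\langle I_{1s},I_4\rangle I_4-\langle I_{1s},I_5\rangle I_5)$, $I_3=I_1\times I_2$, $I_6=I_2\times I_4$, $I_7=I_3\times I_4$, $\rho_2=\langle I_{2s},I_6\rangle$, $\alpha=\langle I_{2s},I_3\rangle$, $\beta_1=\langle I_{2s},I_7\rangle$, $\beta_2=\langle I_{3s},I_6\rangle$. With $r=\tfrac1{\sqrt2}e^{-\sqrt{-1}\int_0^s\rho_1}$ and $q=\tfrac1{\sqrt2}e^{-\sqrt{-1}\int_0^s\rho_2}$, and for real functions $A(t),B(t)$, define $$\varphi_1=\tfrac1{\sqrt2}\,k_1\bar r\,e^{\sqrt{-1}A},\qquad \varphi_2=2\kappa_2 r\bar q\,e^{-\sqrt{-1}(A-B)},\qquad \varphi_3=-\sqrt2\,q^2r\,[2\alpha+\sqrt{-1}(\beta_1+\beta_2)]\,e^{-\sqrt{-1}(A+2B)}.$$ Consider, for $\varphi_1,\varphi_2$ nowhere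 zero, the system $$\begin{aligned} \sqrt{-1}\varphi_{1t}={}&\varphi_{1ss}+2\varphi_1|\varphi_1|^2-2\varphi_1|\varphi_2|^2-2\varphi_1\int_0^s|\varphi_2|^2(\ln|\varphi_1|^2)_s\,d\tilde s,\\ \sqrt{-1}\varphi_{2t}={}&\varphi_{2ss}+2\varphi_2|\varphi_2|^2+2(\varphi_2(\ln\varphi_1)_s)_s-2\varphi_2|\varphi_3|^2+2\sqrt{-1}\,\frac{\bar\varphi_1^2\bar\varphi_2\bar\varphi_3}{\varphi_1}\\ &+2\varphi_2\int_0^s\Big\{2|\varphi_2|^2(\ln|\varphi_1|^2)_s-|\varphi_3|^2(\ln(|\varphi_1|^2|\varphi_2|^2))_s+2\,\mathrm{Im}\Big[\frac{\varphi_3}{\bar\varphi_2}\Big(\frac{\varphi_1^2\varphi_2}{\bar\varphi_1}\Big)_s\Big]\Big\}d\tilde s,\\ \sqrt{-1}\varphi_{3t}={}&\varphi_{3ss}+2\varphi_3|\varphi_3|^2+2\Big[\varphi_3(\ln(\varphi_1\varphi_2))_s-\frac{\sqrt{-1}}{\varphi_2}\Big(\frac{\bar\varphi_1^2\bar\varphi_2}{\varphi_1}\Big)_s\Big]_s-2\sqrt{-1}\,\frac{\bar\varphi_1^2\bar\varphi_2^2}{\varphi_1}\\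 &+2\varphi_3\int_0^s\Big\{2|\varphi_3|^2(\ln(|\varphi_1|^2|\varphi_2|^2))_s-|\varphi_2|^2(\ln|\varphi_1|^2)_s-4\,\mathrm{Im}\Big[\frac{\varphi_3}{\bar\varphi_2}\Big(\frac{\varphi_1^2\varphi_2}{\bar\varphi_1}\Big)_s\Big]\Big\}d\tilde s, \end{aligned}\tag{NLSS}$$ where $(\ln f)_s=f_s/f$ for nowhere zero complex $f$. **Theorem.** 1. For $u:T\times\mathbb R\to\mathbb S^6$ the Schrödinger flow equation reads $u_t=u\times u_{ss}$. Moreover, $u$ is a Schrödinger flow if and only if $u=\gamma_s$ for some $G_2$-binormal motion $\gamma$. 2. Schrödinger flows with $k_1\ne0$ and $\kappa_2\neq0$ everywhere are equivalent to solutions of (NLSS): (a) for each such flow $u$ there are smooth real functions $A,B$ on $T$ with $A(0)=B(0)=0$ such that $(\varphi_1,\varphi_2,\varphi_3)$ is a solution of (NLSS) with $\varphi_1,\varphi_2$ nowhere zero; (b) conversely, every smooth solution $(\varphi_1,\varphi_2,\varphi_3)$ of (NLSS) on $T\times\mathbb R$ with $\varphi_1,\varphi_2$ nowhere zero arises in this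 way from some such flow $u$ and some smooth real functions $A,B$ on $T$, and two Schrödinger flows from which the same solution arises differ by a constant element of $G_2$. 3. When $\varphi_2=0$, the first equation of (NLSS) is the focusing nonlinear Schrödinger equation $\sqrt{-1}\varphi_t=\varphi_{ss}+2|\varphi|^2\varphi$ (NLS), and one recovers the Da Rios–NLS correspondence: (a) for each Schrödinger flow with $k_1\neq0$ and $\kappa_2=0$ everywhere there is a smooth real function $A$ on $T$ with $A(0)=0$ such that $\varphi_1$ is a nowhere zero solution of NLS; (b) each $G_2$-binormal motion in $\mathrm{Im}\,\mathbb H=\mathbb R^3\subset\mathrm{Im}\,\mathbb O$ with $k_1\neq0$ everywhere has $\kappa_2=0$; (c) every smooth nowhere zero solution of NLS on $T\times\mathbb R$ is the function $\varphi_1$, for some smooth real function $A$ on $T$, of a $G_2$-binormal motion in $\mathrm{Im}\,\mathbb H$ with $k_1\ne0$ everywhere. -/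

import Mathlib

open Set MeasureTheory
open scoped ContDiff Quaternion ComplexConjugate

noncomputable section

namespace G2Flow

/-! ### Octonions, the cross product on the imaginary octonions, and `G₂` -/

/-- Octonion multiplication on pairs of quaternions (Cayley-Dickson): the pair `(a, b)` stands for
`a + b l`, where `l = (0, 1)`, so that `a (b l) = (b a) l`, `(a l) b = (a b̄) l` and
`(a l) (b l) = - b̄ a`. -/
def octMul (x y : ℍ[ℝ] × ℍ[ℝ]) : ℍ[ℝ] × ℍ[ℝ] :=
  (x.1 * y.1 - star y.2 * x.2, y.2 * x.1 + x.2 * star y.1)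

/-- Octonion conjugation `a + b l ↦ ā - b l`. -/
def octConj (x : ℍ[ℝ] × ℍ[ℝ]) : ℍ[ℝ] × ℍ[ℝ] := (star x.1, -x.2)

/-- `ℝ⁷` with its Euclidean inner product. -/
abbrev E7 : Type := EuclideanSpace ℝ (Fin 7)

/-- The identification of `ℝ⁷` with the imaginary octonions given by the basis
`i, j, k, l, il, jl, kl`. -/
def toOct (x : E7) : ℍ[ℝ] × ℍ[ℝ] := (⟨0, x 0, x 1, x 2⟩, ⟨x 3, x 4, x 5, x 6⟩)

/-- The imaginary part of an octonion, as a vector of `ℝ⁷`. -/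
def ofOct (z : ℍ[ℝ] × ℍ[ℝ]) : E7 :=
  !₂[z.1.imI, z.1.imJ, z.1.imK, z.2.re, z.2.imI, z.2.imJ, z.2.imK]

/-- The cross product `x × y = (ȳ x - x̄ y) / 2` on `Im 𝕆 = ℝ⁷`. -/
def cross (x y : E7) : E7 :=
  ofOct ((1 / 2 : ℝ) • (octMul (octConj (toOct y)) (toOct x) -
    octMul (octConj (toOct x)) (toOct y)))

/-- Membership in `Im ℍ = span {i, j, k} ⊆ Im 𝕆`. -/
def InImH (x : E7) : Prop := x 3 = 0 ∧ x 4 = 0 ∧ x 5 = 0 ∧ x 6 = 0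

/-- The elements of `G₂`, acting on `Im 𝕆 = ℝ⁷`. As `x y = -⟨x, y⟩ + x × y` for imaginary `x, y`,
the automorphisms of `𝕆` restrict exactly to the isometries that preserve the cross product. -/
def IsG2 (g : E7 ≃ₗᵢ[ℝ] E7) : Prop := ∀ x y, g (cross x y) = cross (g x) (g y)

/-! ### The flows

Maps of time `t ∈ T` and of the space variable `s ∈ ℝ` are curried functions `ℝ → ℝ → _`, of which
only the values at times in the interval `T` matter. -/

/-- Joint smoothness on `T × ℝ`. -/
def SmoothOn {E : Type} [NormedAddCommGroup E] [NormedSpace ℝ E] (T : Set ℝ) (f : ℝ → ℝ → E) :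
    Prop :=
  ContDiffOn ℝ ∞ (fun p : ℝ × ℝ => f p.1 p.2) (T ×ˢ univ)

/-- The time derivative, on the time interval `T` (one-sided at an endpoint). -/
def timeDeriv {E : Type} [NormedAddCommGroup E] [NormedSpace ℝ E] (T : Set ℝ) (f : ℝ → ℝ → E)
    (t s : ℝ) : E :=
  derivWithin (fun τ => f τ s) T t

/-- Kirchhoff's almost complex structure of `𝕊⁶` at `u`: `J_u X = u × X` for `X ⊥ u`. -/
def kirchhoffJ (u X : E7) : E7 := cross u X

/-- The tension field `u_ss + |u_s|² u` of a map `ℝ → 𝕊⁶ ⊆ ℝ⁷`. -/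
def tension (u : ℝ → E7) (s : ℝ) : E7 := deriv (deriv u) s + ‖deriv u s‖ ^ 2 • u s

/-- `u` is a (smooth) Schrödinger flow `u_t = J_u τ(u)` of maps from `ℝ` to `(𝕊⁶, J)`. -/
structure IsSchrodingerFlow (T : Set ℝ) (u : ℝ → ℝ → E7) : Prop where
  smooth : SmoothOn T u
  sphere : ∀ t ∈ T, ∀ s, ‖u t s‖ = 1
  flow : ∀ t ∈ T, ∀ s, timeDeriv T u t s = kirchhoffJ (u t s) (tension (u t) s)

/-- `γ` is a (smooth) `G₂`-binormal motion `γ_t = γ_s × γ_ss` of curves with arclength `s`. -/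
structure IsBinormalMotion (T : Set ℝ) (γ : ℝ → ℝ → E7) : Prop where
  smooth : SmoothOn T γ
  unit_speed : ∀ t ∈ T, ∀ s, ‖deriv (γ t) s‖ = 1
  motion : ∀ t ∈ T, ∀ s, timeDeriv T γ t s = cross (deriv (γ t) s) (deriv (deriv (γ t)) s)

/-! ### The `G₂`-frame and the `G₂`-invariants

The frame is `I₄ = w`, `I₁`, `I₂`, `I₃`, `I₅`, `I₆`, `I₇`, where `w = γ_s : ℝ → ℝ⁷` is the unit
tangent field of a unit speed curve `γ`. -/

def k1 (w : ℝ → E7) (s : ℝ) : ℝ := ‖deriv w s‖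

def frame1 (w : ℝ → E7) (s : ℝ) : E7 := (k1 w s)⁻¹ • deriv w s

def frame5 (w : ℝ → E7) (s : ℝ) : E7 := cross (frame1 w s) (w s)

def kappa2 (w : ℝ → E7) (s : ℝ) : ℝ :=
  Real.sqrt (‖deriv (frame1 w) s‖ ^ 2 - inner ℝ (deriv (frame1 w) s) (w s) ^ 2 -
    inner ℝ (deriv (frame1 w) s) (frame5 w s) ^ 2)

def frame2 (w : ℝ → E7) (s : ℝ) : E7 :=
  (kappa2 w s)⁻¹ • (deriv (frame1 w) s - (inner ℝ (deriv (frame1 w) s) (w s)) • w s -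
    (inner ℝ (deriv (frame1 w) s) (frame5 w s)) • frame5 w s)

def frame3 (w : ℝ → E7) (s : ℝ) : E7 := cross (frame1 w s) (frame2 w s)

def frame6 (w : ℝ → E7) (s : ℝ) : E7 := cross (frame2 w s) (w s)

def frame7 (w : ℝ → E7) (s : ℝ) : E7 := cross (frame3 w s) (w s)

def rho1 (w : ℝ → E7) (s : ℝ) : ℝ := inner ℝ (deriv (frame1 w) s) (frame5 w s)

def rho2 (w : ℝ → E7) (s : ℝ) : ℝ := inner ℝ (deriv (frame2 w) s) (frame6 w s)

def alpha (w : ℝ → E7) (s : ℝ) : ℝ := inner ℝ (deriv (frame2 w) s) (frame3 w s)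

def beta1 (w : ℝ → E7) (s : ℝ) : ℝ := inner ℝ (deriv (frame2 w) s) (frame7 w s)

def beta2 (w : ℝ → E7) (s : ℝ) : ℝ := inner ℝ (deriv (frame3 w) s) (frame6 w s)

/-! ### The complex functions built from the invariants -/

/-- `r = exp (-√-1 ∫₀ˢ ρ₁) / √2`. -/
def rFun (w : ℝ → E7) (s : ℝ) : ℂ :=
  1 / (Real.sqrt 2 : ℂ) * Complex.exp (-Complex.I * ((∫ x in (0 : ℝ)..s, rho1 w x : ℝ) : ℂ))

/-- `q = exp (-√-1 ∫₀ˢ ρ₂) / √2`. -/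
def qFun (w : ℝ → E7) (s : ℝ) : ℂ :=
  1 / (Real.sqrt 2 : ℂ) * Complex.exp (-Complex.I * ((∫ x in (0 : ℝ)..s, rho2 w x : ℝ) : ℂ))

def phi1 (w : ℝ → E7) (s : ℝ) : ℂ := (k1 w s : ℂ) * conj (rFun w s)

def phi2 (w : ℝ → E7) (s : ℝ) : ℂ := 2 * (kappa2 w s : ℂ) * rFun w s * conj (qFun w s)

def phi3 (w : ℝ → E7) (s : ℝ) : ℂ :=
  -(Real.sqrt 2 : ℂ) * qFun w s ^ 2 * rFun w s *
    (2 * (alpha w s : ℂ) + Complex.I * ((beta1 w s : ℂ) + (beta2 w s : ℂ)))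

/-! The same functions for a family `u t` of unit tangent fields, after the time-dependent phase
changes and the rescaling of the first one by `1 / √2`. -/

def psi1 (u : ℝ → ℝ → E7) (A : ℝ → ℝ) (t s : ℝ) : ℂ :=
  1 / (Real.sqrt 2 : ℂ) * phi1 (u t) s * Complex.exp (Complex.I * (A t : ℂ))

def psi2 (u : ℝ → ℝ → E7) (A B : ℝ → ℝ) (t s : ℝ) : ℂ :=
  phi2 (u t) s * Complex.exp (-Complex.I * ((A t : ℂ) - (B t : ℂ)))

def psi3 (u : ℝ → ℝ → E7) (A B : ℝ → ℝ) (t s : ℝ) : ℂ :=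
  phi3 (u t) s * Complex.exp (-Complex.I * ((A t : ℂ) + 2 * (B t : ℂ)))

/-! ### The nonlinear Schrödinger-type system

`logDeriv f = f_s / f` is `(ln f)_s` for the nowhere vanishing complex function `f`. -/

/-- `(ln |f|²)_s`. -/
def logNormSqDeriv (f : ℝ → ℂ) (s : ℝ) : ℝ := deriv (fun x => Real.log (‖f x‖ ^ 2)) s

/-- `Im [ (φ₃ / φ̄₂) (φ₁² φ₂ / φ̄₁)_s ]`. -/
def imTerm (f₁ f₂ f₃ : ℝ → ℂ) (s : ℝ) : ℝ :=
  (f₃ s / conj (f₂ s) * deriv (fun x => f₁ x ^ 2 * f₂ x / conj (f₁ x)) s).im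

def rhs1 (f₁ f₂ : ℝ → ℂ) (s : ℝ) : ℂ :=
  deriv (deriv f₁) s + 2 * f₁ s * (‖f₁ s‖ : ℂ) ^ 2 - 2 * f₁ s * (‖f₂ s‖ : ℂ) ^ 2 -
    2 * f₁ s * ((∫ x in (0 : ℝ)..s, ‖f₂ x‖ ^ 2 * logNormSqDeriv f₁ x : ℝ) : ℂ)

def rhs2 (f₁ f₂ f₃ : ℝ → ℂ) (s : ℝ) : ℂ :=
  deriv (deriv f₂) s + 2 * f₂ s * (‖f₂ s‖ : ℂ) ^ 2 +
    2 * deriv (fun x => f₂ x * logDeriv f₁ x) s - 2 * f₂ s * (‖f₃ s‖ : ℂ) ^ 2 +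
    2 * Complex.I * (conj (f₁ s) ^ 2 * conj (f₂ s) * conj (f₃ s) / f₁ s) +
    2 * f₂ s * ((∫ x in (0 : ℝ)..s,
      (2 * ‖f₂ x‖ ^ 2 * logNormSqDeriv f₁ x -
        ‖f₃ x‖ ^ 2 * logNormSqDeriv (fun y => f₁ y * f₂ y) x +
        2 * imTerm f₁ f₂ f₃ x) : ℝ) : ℂ)

def rhs3 (f₁ f₂ f₃ : ℝ → ℂ) (s : ℝ) : ℂ :=
  deriv (deriv f₃) s + 2 * f₃ s * (‖f₃ s‖ : ℂ) ^ 2 +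
    2 * deriv (fun x => f₃ x * logDeriv (fun y => f₁ y * f₂ y) x -
      Complex.I / f₂ x * deriv (fun y => conj (f₁ y) ^ 2 * conj (f₂ y) / f₁ y) x) s -
    2 * Complex.I * (conj (f₁ s) ^ 2 * conj (f₂ s) ^ 2 / f₁ s) +
    2 * f₃ s * ((∫ x in (0 : ℝ)..s,
      (2 * ‖f₃ x‖ ^ 2 * logNormSqDeriv (fun y => f₁ y * f₂ y) x -
        ‖f₂ x‖ ^ 2 * logNormSqDeriv f₁ x -
        4 * imTerm f₁ f₂ f₃ x) : ℝ) : ℂ)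

/-- Smooth solutions on `T × ℝ` of the nonlinear Schrödinger-type system. The system divides by the
first two unknowns, which therefore must not vanish. -/
structure IsNLSTSolution (T : Set ℝ) (f₁ f₂ f₃ : ℝ → ℝ → ℂ) : Prop where
  smooth₁ : SmoothOn T f₁
  smooth₂ : SmoothOn T f₂
  smooth₃ : SmoothOn T f₃
  ne₁ : ∀ t ∈ T, ∀ s, f₁ t s ≠ 0
  ne₂ : ∀ t ∈ T, ∀ s, f₂ t s ≠ 0
  eq₁ : ∀ t ∈ T, ∀ s, Complex.I * timeDeriv T f₁ t s = rhs1 (f₁ t) (f₂ t) s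
  eq₂ : ∀ t ∈ T, ∀ s, Complex.I * timeDeriv T f₂ t s = rhs2 (f₁ t) (f₂ t) (f₃ t) s
  eq₃ : ∀ t ∈ T, ∀ s, Complex.I * timeDeriv T f₃ t s = rhs3 (f₁ t) (f₂ t) (f₃ t) s

/-- Smooth nowhere vanishing solutions on `T × ℝ` of the focusing nonlinear Schrödinger equation
`√-1 φ_t = φ_ss + 2 |φ|² φ`. -/
structure IsNLSSolution (T : Set ℝ) (f : ℝ → ℝ → ℂ) : Prop where
  smooth : SmoothOn T f
  ne : ∀ t ∈ T, ∀ s, f t s ≠ 0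
  eq : ∀ t ∈ T, ∀ s, Complex.I * timeDeriv T f t s =
    deriv (deriv (f t)) s + 2 * (‖f t s‖ : ℂ) ^ 2 * f t s

/-- The complex functions of the family `u` of unit tangent fields, for some smooth time-dependent
phase changes, are `f₁, f₂, f₃`. -/
def HasTransform (T : Set ℝ) (u : ℝ → ℝ → E7) (f₁ f₂ f₃ : ℝ → ℝ → ℂ) : Prop :=
  ∃ A B : ℝ → ℝ, ContDiffOn ℝ ∞ A T ∧ ContDiffOn ℝ ∞ B T ∧
    ∀ t ∈ T, ∀ s, f₁ t s = psi1 u A t s ∧ f₂ t s = psi2 u A B t s ∧ f₃ t s = psi3 u A B t s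

end G2Flow

end

noncomputable section

set_option linter.unusedSectionVars false
set_option linter.unusedSimpArgs false

namespace G2Flow

/-! ### Calculus on `T × ℝ` for an interval `T` -/

/-! The theorem is a gauge computation in `G₂`. A map `u` into the sphere is lifted to a frame field
`F : T × ℝ → G₂` with `F e₀ = u`. The logarithmic derivatives `κ = F⁻¹ F_s` and `η = F⁻¹ F_t` take
values in the Lie algebra and satisfy the structure equation `κ_t - η_s = [κ, η]`
(`IsFrame.zero_curvature`). Conversely, every smooth solution of that equation integrates to a frame
(`exists_isFrame_of_zero_curvature`), and the frame is unique up to a constant element of `G₂`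
(`IsFrame.exists_isG2Map`).

The frame is chosen as follows. The Frenet frame built on `u, I₁, I₂` has torus components `-ρ₁,
-ρ₂`. Rotating it inside the maximal torus by the angles `∫ρ₁ + A` and `∫ρ₂ + B` removes them, and
what remains of `κ` is exactly `φ₁, φ̄₂, -φ̄₃` (`flowCoord_psi`). This is the origin of the phases
`r, q`; the functions `A, B` of time are the gauge freedom that is left.

An element of the Lie algebra acts on `e₀` through its first three coordinates only, so `u_t = u ×
u_ss` says that those of `η` are `-√-1 φ₁ₛ, -√-1 φ₁φ₂, 0` (`IsFrame.isSchrodingerFlow_iff`). The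
structure equation has six complex and two real components. Three complex ones contain no time
derivative; after division by `φ₁` and `φ̄₂` they determine the other complex coordinates of `η`
(`IsFrame.eq_flowTime`). The remaining three complex ones are evolution equations for `φ₁, φ₂, φ₃`,
and the two real ones prescribe the space derivatives of the torus components `ν₁, ν₂` of `η`
(`zero_curvature_iff`). Integrating these in `s` produces the nonlocal terms of the system, and `A',
B'` adjust the constants of integration, which depend on time. In the other direction a solution of
the system defines `κ` and `η` with vanishing curvature. Uniqueness holds because the first two
evolution equations determine `ν₁, ν₂` where `φ₁φ₂ ≠ 0`.

Flows and binormal motions are related by differentiating and integrating in `s`. If `κ₂ = 0`, the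
plane of `I₁, I₅` has a parallel frame and the same computation gives the focusing equation. For its
converse the frame with `φ₂ = φ₃ = 0` is invariant, up to a constant, under the involution of `G₂`
whose fixed space is `Im ℍ`, which keeps the curve there. -/

/-- A nondegenerate time interval containing `0`. -/
structure TimeInterval (T : Set ℝ) : Prop where
  ordConnected : T.OrdConnected
  nontrivial : T.Nontrivial
  zero_mem : (0 : ℝ) ∈ T

section Calculus

variable {T : Set ℝ} {E E' : Type} [NormedAddCommGroup E] [NormedSpace ℝ E]
  [NormedAddCommGroup E'] [NormedSpace ℝ E']

theorem TimeInterval.convex (hT : TimeInterval T) : Convex ℝ T := hT.ordConnected.convex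

theorem TimeInterval.uIcc_subset (hT : TimeInterval T) {t : ℝ} (ht : t ∈ T) : uIcc 0 t ⊆ T :=
  hT.ordConnected.uIcc_subset hT.zero_mem ht

theorem TimeInterval.interior_nonempty (hT : TimeInterval T) : (interior T).Nonempty :=
  hT.convex.nontrivial_iff_nonempty_interior.1 hT.nontrivial

theorem TimeInterval.uniqueDiffOn (hT : TimeInterval T) : UniqueDiffOn ℝ T :=
  uniqueDiffOn_convex hT.convex hT.interior_nonempty

theorem TimeInterval.uniqueDiffOn_prod (hT : TimeInterval T) :
    UniqueDiffOn ℝ (T ×ˢ (univ : Set ℝ)) :=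
  hT.uniqueDiffOn.prod uniqueDiffOn_univ

theorem TimeInterval.univ : TimeInterval (univ : Set ℝ) :=
  ⟨ordConnected_univ, nontrivial_univ, mem_univ _⟩

/-- Reduces local assertions on `T` to compact intervals through `0`, where uniform bounds are
available. If `T` has a point beyond `t` on one side, that point or `0`, whichever is farther out,
serves as the end on that side. Otherwise `t` is an endpoint of `T`, and stopping at `t` still
leaves a relative neighbourhood. -/
theorem TimeInterval.exists_Icc (hT : TimeInterval T) {t : ℝ} (ht : t ∈ T) :
    ∃ a b : ℝ, a ≤ 0 ∧ 0 ≤ b ∧ Icc a b ⊆ T ∧ t ∈ Icc a b ∧ Icc a b ∈ nhdsWithin t T := by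
  obtain ⟨a, ha, hat, haT⟩ : ∃ a ∈ T, a ≤ min 0 t ∧ Ici a ∈ nhdsWithin t T := by
    by_cases h : ∃ a ∈ T, a < t
    · obtain ⟨a, ha, hat⟩ := h
      by_cases h0 : a ≤ 0
      · exact ⟨a, ha, le_min h0 hat.le, mem_nhdsWithin_of_mem_nhds (Ici_mem_nhds hat)⟩
      · refine ⟨0, hT.zero_mem, le_min le_rfl (by linarith), ?_⟩
        exact mem_nhdsWithin_of_mem_nhds (Ici_mem_nhds (by linarith))
    · push Not at h
      exact ⟨t, ht, le_min (h 0 hT.zero_mem) le_rfl,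
        Filter.mem_of_superset self_mem_nhdsWithin (fun x hx => h x hx)⟩
  obtain ⟨b, hb, hbt, hbT⟩ : ∃ b ∈ T, max 0 t ≤ b ∧ Iic b ∈ nhdsWithin t T := by
    by_cases h : ∃ b ∈ T, t < b
    · obtain ⟨b, hb, hbt⟩ := h
      by_cases h0 : 0 ≤ b
      · exact ⟨b, hb, max_le h0 hbt.le, mem_nhdsWithin_of_mem_nhds (Iic_mem_nhds hbt)⟩
      · refine ⟨0, hT.zero_mem, max_le le_rfl (by linarith), ?_⟩
        exact mem_nhdsWithin_of_mem_nhds (Iic_mem_nhds (by linarith))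
    · push Not at h
      exact ⟨t, ht, max_le (h 0 hT.zero_mem) le_rfl,
        Filter.mem_of_superset self_mem_nhdsWithin (fun x hx => h x hx)⟩
  rw [le_min_iff] at hat
  rw [max_le_iff] at hbt
  exact ⟨a, b, hat.1, hbt.1, hT.ordConnected.out ha hb, ⟨hat.2, hbt.2⟩,
    Filter.inter_mem haT hbT⟩

theorem TimeInterval.mem_closure_interior (hT : TimeInterval T) {t : ℝ} (ht : t ∈ T) (s : ℝ) :
    (t, s) ∈ closure (interior (T ×ˢ (Set.univ : Set ℝ))) := by
  rw [interior_prod_eq, closure_prod_eq, interior_univ, closure_univ,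
    hT.convex.closure_interior_eq_closure_of_nonempty_interior hT.interior_nonempty]
  exact ⟨subset_closure ht, mem_univ _⟩

section Partials

variable {f g h : ℝ → ℝ → E} {n : ℕ∞ω} {t s : ℝ}

theorem hasDerivAt_of_hasFDerivWithinAt (ht : t ∈ T) {f' : ℝ × ℝ →L[ℝ] E}
    (hf : HasFDerivWithinAt (fun p : ℝ × ℝ => f p.1 p.2) f' (T ×ˢ univ) (t, s)) :
    HasDerivAt (f t) (f' (0, 1)) s := by
  have h1 : HasDerivAt (fun x : ℝ => ((t, x) : ℝ × ℝ)) (0, 1) s :=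
    (hasDerivAt_const s t).prodMk (hasDerivAt_id s)
  rw [← hasDerivWithinAt_univ] at h1 ⊢
  exact hf.comp_hasDerivWithinAt (f := fun x : ℝ => ((t, x) : ℝ × ℝ)) s h1
    (fun x _ => ⟨ht, mem_univ _⟩)

theorem hasDerivWithinAt_of_hasFDerivWithinAt {f' : ℝ × ℝ →L[ℝ] E}
    (hf : HasFDerivWithinAt (fun p : ℝ × ℝ => f p.1 p.2) f' (T ×ˢ univ) (t, s)) :
    HasDerivWithinAt (fun τ => f τ s) (f' (1, 0)) T t := by
  have h1 : HasDerivWithinAt (fun x : ℝ => ((x, s) : ℝ × ℝ)) (1, 0) T t :=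
    (hasDerivWithinAt_id t T).prodMk (hasDerivWithinAt_const t T s)
  exact hf.comp_hasDerivWithinAt (f := fun x : ℝ => ((x, s) : ℝ × ℝ)) t h1
    (fun x hx => ⟨hx, mem_univ _⟩)

/-- Only the time partial has to be continuous. The increment is split at `(t, s')`: the mean value
inequality on a small piece of `T` controls the time step uniformly in `s'`, and differentiability
of `f t` at the single point `s` controls the space step. -/
theorem hasFDerivWithinAt_of_partials (hT : TimeInterval T)
    (hs : ∀ t ∈ T, ∀ s, HasDerivAt (f t) (g t s) s)
    (ht : ∀ t ∈ T, ∀ s, HasDerivWithinAt (fun τ => f τ s) (h t s) T t)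
    (hc : ContinuousOn (fun p : ℝ × ℝ => h p.1 p.2) (T ×ˢ univ)) (hmem : t ∈ T) :
    HasFDerivWithinAt (fun p : ℝ × ℝ => f p.1 p.2)
      ((ContinuousLinearMap.fst ℝ ℝ ℝ).smulRight (h t s) +
        (ContinuousLinearMap.snd ℝ ℝ ℝ).smulRight (g t s)) (T ×ˢ univ) (t, s) := by
  rw [hasFDerivWithinAt_iff_isLittleO, Asymptotics.isLittleO_iff]
  intro ε hε
  have h1 := (hs t hmem s).hasFDerivAt.isLittleO
  rw [Asymptotics.isLittleO_iff] at h1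
  have h1' := (h1 (half_pos hε))
  have h2 := (Metric.continuousWithinAt_iff.1 (hc (t, s) ⟨hmem, mem_univ _⟩)) (ε / 2) (half_pos hε)
  obtain ⟨δ, hδ, h2⟩ := h2
  rw [Metric.eventually_nhds_iff] at h1'
  obtain ⟨δ', hδ', h1'⟩ := h1'
  rw [eventually_nhdsWithin_iff, Metric.eventually_nhds_iff]
  refine ⟨min δ δ', lt_min hδ hδ', ?_⟩
  rintro ⟨t', s'⟩ hd ⟨ht', -⟩
  simp only [Prod.dist_eq, max_lt_iff, lt_min_iff] at hd
  have key : ‖f t' s' - f t s' - (t' - t) • h t s‖ ≤ ε / 2 * ‖t' - t‖ := by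
    have hconv : Convex ℝ (T ∩ Metric.ball t δ) := hT.convex.inter (convex_ball t δ)
    have := Convex.norm_image_sub_le_of_norm_hasDerivWithin_le (s := T ∩ Metric.ball t δ)
      (f := fun τ => f τ s' - τ • h t s) (f' := fun τ => h τ s' - h t s) (C := ε / 2) (x := t)
      (y := t') ?_ ?_ hconv ⟨hmem, Metric.mem_ball_self hδ⟩ ⟨ht', hd.1.1⟩
    · refine le_trans (le_of_eq ?_) this
      congr 1
      rw [sub_smul]
      abel
    · intro x hx
      have := ((ht x hx.1 s').mono (inter_subset_left (t := Metric.ball t δ))).sub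
        ((hasDerivWithinAt_id x (T ∩ Metric.ball t δ)).smul_const (h t s))
      rw [one_smul] at this
      exact this
    · intro x hx
      have := @h2 (x, s') ⟨hx.1, mem_univ _⟩ (by
        simp only [Prod.dist_eq, max_lt_iff]; exact ⟨hx.2, hd.1.2⟩)
      rw [dist_eq_norm] at this
      exact this.le
  have key2 := @h1' s' hd.2.2
  have e1 : f t' s' - f t s - ((t' - t) • h t s + (s' - s) • g t s) =
      (f t' s' - f t s' - (t' - t) • h t s) + (f t s' - f t s - (s' - s) • g t s) := by abel
  simp only [ContinuousLinearMap.toSpanSingleton_apply] at key2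
  simp only [add_apply, ContinuousLinearMap.smulRight_apply, Prod.mk_sub_mk,
    ContinuousLinearMap.coe_fst', ContinuousLinearMap.coe_snd']
  rw [e1]
  have n1 : ‖t' - t‖ ≤ ‖(t' - t, s' - s)‖ := norm_fst_le (t' - t, s' - s)
  have n2 : ‖s' - s‖ ≤ ‖(t' - t, s' - s)‖ := norm_snd_le (t' - t, s' - s)
  calc _ ≤ ε / 2 * ‖t' - t‖ + ε / 2 * ‖s' - s‖ := (norm_add_le _ _).trans (add_le_add key key2)
    _ ≤ ε / 2 * ‖(t' - t, s' - s)‖ + ε / 2 * ‖(t' - t, s' - s)‖ := by gcongr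
    _ = _ := by ring

/-- The bootstrapping tool for functions known only through their two partial derivatives, namely
integrals and solutions of linear systems. -/
theorem contDiffOn_succ_of_partials (hT : TimeInterval T) (n : ℕ)
    (hs : ∀ t ∈ T, ∀ s, HasDerivAt (f t) (g t s) s)
    (ht : ∀ t ∈ T, ∀ s, HasDerivWithinAt (fun τ => f τ s) (h t s) T t)
    (hg : ContDiffOn ℝ n (fun p : ℝ × ℝ => g p.1 p.2) (T ×ˢ univ))
    (hh : ContDiffOn ℝ n (fun p : ℝ × ℝ => h p.1 p.2) (T ×ˢ univ)) :
    ContDiffOn ℝ (n + 1) (fun p : ℝ × ℝ => f p.1 p.2) (T ×ˢ univ) := by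
  rw [contDiffOn_succ_iff_hasFDerivWithinAt_of_uniqueDiffOn hT.uniqueDiffOn_prod]
  refine ⟨by simp, fun p => (ContinuousLinearMap.fst ℝ ℝ ℝ).smulRight (h p.1 p.2) +
        (ContinuousLinearMap.snd ℝ ℝ ℝ).smulRight (g p.1 p.2), ?_, ?_⟩
  · exact (contDiffOn_const.smulRight hh).add (contDiffOn_const.smulRight hg)
  · rintro ⟨t, s⟩ ⟨hmem, -⟩
    exact hasFDerivWithinAt_of_partials hT hs ht hh.continuousOn hmem

theorem SmoothOn.hasFDerivWithinAt (hf : SmoothOn T f) (ht : t ∈ T) :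
    HasFDerivWithinAt (fun p : ℝ × ℝ => f p.1 p.2)
      (fderivWithin ℝ (fun p : ℝ × ℝ => f p.1 p.2) (T ×ˢ univ) (t, s)) (T ×ˢ univ) (t, s) :=
  ((hf.differentiableOn (by simp)) (t, s) ⟨ht, mem_univ _⟩).hasFDerivWithinAt

theorem SmoothOn.hasDerivAt (hf : SmoothOn T f) (ht : t ∈ T) (s : ℝ) :
    HasDerivAt (f t) (deriv (f t) s) s :=
  (hasDerivAt_of_hasFDerivWithinAt ht (hf.hasFDerivWithinAt ht)).differentiableAt.hasDerivAt

theorem SmoothOn.hasDerivWithinAt (hf : SmoothOn T f) (ht : t ∈ T) (s : ℝ) :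
    HasDerivWithinAt (fun τ => f τ s) (timeDeriv T f t s) T t :=
  (hasDerivWithinAt_of_hasFDerivWithinAt
    (hf.hasFDerivWithinAt ht)).differentiableWithinAt.hasDerivWithinAt

theorem SmoothOn.deriv_eq (hf : SmoothOn T f) (ht : t ∈ T) (s : ℝ) :
    deriv (f t) s = fderivWithin ℝ (fun p : ℝ × ℝ => f p.1 p.2) (T ×ˢ univ) (t, s) (0, 1) :=
  (hasDerivAt_of_hasFDerivWithinAt ht (hf.hasFDerivWithinAt ht)).deriv

theorem SmoothOn.timeDeriv_eq (hT : TimeInterval T) (hf : SmoothOn T f) (ht : t ∈ T) (s : ℝ) :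
    timeDeriv T f t s =
      fderivWithin ℝ (fun p : ℝ × ℝ => f p.1 p.2) (T ×ˢ univ) (t, s) (1, 0) :=
  (hasDerivWithinAt_of_hasFDerivWithinAt (hf.hasFDerivWithinAt ht)).derivWithin
    (hT.uniqueDiffOn t ht)

theorem timeDeriv_of_hasDerivWithinAt (hT : TimeInterval T) (ht : t ∈ T) {f' : E}
    (hf : HasDerivWithinAt (fun τ => f τ s) f' T t) : timeDeriv T f t s = f' :=
  hf.derivWithin (hT.uniqueDiffOn t ht)

theorem SmoothOn.fderivWithin_apply (hT : TimeInterval T) (hf : SmoothOn T f) (v : ℝ × ℝ) :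
    SmoothOn T (fun t s =>
      fderivWithin ℝ (fun p : ℝ × ℝ => f p.1 p.2) (T ×ˢ univ) (t, s) v) :=
  ((contDiffOn_infty_iff_fderivWithin hT.uniqueDiffOn_prod).1 hf).2.clm_apply contDiffOn_const

theorem SmoothOn.congr (hf : SmoothOn T f) (h : ∀ t ∈ T, ∀ s, g t s = f t s) : SmoothOn T g :=
  ContDiffOn.congr hf fun p hp => h p.1 hp.1 p.2

theorem SmoothOn.deriv (hT : TimeInterval T) (hf : SmoothOn T f) :
    SmoothOn T (fun t s => deriv (f t) s) :=
  (hf.fderivWithin_apply hT (0, 1)).congr fun _ ht s => hf.deriv_eq ht s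

theorem SmoothOn.timeDeriv (hT : TimeInterval T) (hf : SmoothOn T f) :
    SmoothOn T (timeDeriv T f) :=
  (hf.fderivWithin_apply hT (1, 0)).congr fun _ ht s => hf.timeDeriv_eq hT ht s

theorem timeDeriv_congr (h : ∀ t ∈ T, ∀ s, g t s = f t s) (ht : t ∈ T) (s : ℝ) :
    G2Flow.timeDeriv T g t s = G2Flow.timeDeriv T f t s :=
  derivWithin_congr (fun τ hτ => h τ hτ s) (h t ht s)

/-- Symmetry of the second derivative persists at an endpoint of `T`, because every point of `T × ℝ`
is a limit of interior points. -/
theorem SmoothOn.timeDeriv_deriv (hT : TimeInterval T) (hf : SmoothOn T f) (ht : t ∈ T) (s : ℝ) :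
    G2Flow.timeDeriv T (fun t s => _root_.deriv (f t) s) t s =
      _root_.deriv (G2Flow.timeDeriv T f t) s := by
  set D := fderivWithin ℝ (fun p : ℝ × ℝ => f p.1 p.2) (T ×ˢ univ) with hD
  have hDs : ContDiffOn ℝ ∞ D (T ×ˢ univ) :=
    ((contDiffOn_infty_iff_fderivWithin hT.uniqueDiffOn_prod).1 hf).2
  have hp : (t, s) ∈ T ×ˢ (univ : Set ℝ) := ⟨ht, mem_univ _⟩
  have hD' := ((hDs.differentiableOn (by simp)) (t, s) hp).hasFDerivWithinAt
  have hsymm : IsSymmSndFDerivWithinAt ℝ (fun p : ℝ × ℝ => f p.1 p.2) (T ×ˢ univ) (t, s) :=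
    (hf (t, s) hp).isSymmSndFDerivWithinAt (by
      rw [minSmoothness_of_isRCLikeNormedField]; exact WithTop.coe_le_coe.2 (le_top : (2 : ℕ∞) ≤ ⊤))
      hT.uniqueDiffOn_prod (hT.mem_closure_interior ht s) hp
  have e1 : ∀ v : ℝ × ℝ, HasFDerivWithinAt (fun p : ℝ × ℝ => D (p.1, p.2) v)
      ((ContinuousLinearMap.apply ℝ E v).comp (fderivWithin ℝ D (T ×ˢ univ) (t, s)))
      (T ×ˢ univ) (t, s) := fun v =>
    (ContinuousLinearMap.apply ℝ E v).hasFDerivAt.comp_hasFDerivWithinAt (t, s) hD'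
  have a1 : G2Flow.timeDeriv T (fun t s => _root_.deriv (f t) s) t s =
      G2Flow.timeDeriv T (fun t s => D (t, s) (0, 1)) t s :=
    timeDeriv_congr (fun t ht s => hf.deriv_eq ht s) ht s
  have a2 : G2Flow.timeDeriv T f t = fun s => D (t, s) (1, 0) :=
    funext fun s => hf.timeDeriv_eq hT ht s
  rw [a1, a2, timeDeriv_of_hasDerivWithinAt hT ht
    (hasDerivWithinAt_of_hasFDerivWithinAt (f := fun t s => D (t, s) (0, 1)) (e1 (0, 1))),
    (hasDerivAt_of_hasFDerivWithinAt (f := fun t s => D (t, s) (1, 0)) ht (e1 (1, 0))).deriv]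
  exact hsymm.eq (1, 0) (0, 1)

end Partials

end Calculus

end G2Flow

namespace G2Flow

/-! ### Integrals in space and in time of functions on `T × ℝ` -/

section Integrals

variable {T : Set ℝ} {E : Type} [NormedAddCommGroup E] [NormedSpace ℝ E]

/-- Freezing time at the ends of `[a, b]` makes a function on the slab globally continuous, so that
results on parametric integrals and linear equations over all of `ℝ` apply to it. -/
theorem continuous_clamp {f : ℝ → ℝ → E} {a b : ℝ} (hab : a ≤ b)
    (hf : ContinuousOn (fun p : ℝ × ℝ => f p.1 p.2) (Icc a b ×ˢ univ)) :
    Continuous (fun p : ℝ × ℝ => f (projIcc a b hab p.1) p.2) := by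
  have : Continuous (fun p : ℝ × ℝ => ((projIcc a b hab p.1 : ℝ), p.2)) := by fun_prop
  exact hf.comp_continuous this fun p => ⟨(projIcc a b hab p.1).2, mem_univ _⟩

theorem continuousOn_of_forall_Icc (hT : TimeInterval T) {X : Type} [TopologicalSpace X]
    {f : ℝ → ℝ → X} (h : ∀ a b : ℝ, a ≤ 0 → 0 ≤ b → Icc a b ⊆ T →
      ContinuousOn (fun p : ℝ × ℝ => f p.1 p.2) (Icc a b ×ˢ univ)) :
    ContinuousOn (fun p : ℝ × ℝ => f p.1 p.2) (T ×ˢ univ) := by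
  rintro ⟨t, s⟩ ⟨ht, -⟩
  obtain ⟨a, b, ha, hb, hab, htab, hn⟩ := hT.exists_Icc ht
  refine (h a b ha hb hab (t, s) ⟨htab, mem_univ _⟩).mono_of_mem_nhdsWithin ?_
  rw [nhdsWithin_prod_eq]
  exact Filter.prod_mem_prod hn Filter.univ_mem

theorem continuousOn_integral (hT : TimeInterval T) {f : ℝ → ℝ → E}
    (hf : ContinuousOn (fun p : ℝ × ℝ => f p.1 p.2) (T ×ˢ univ)) :
    ContinuousOn (fun p : ℝ × ℝ => ∫ x in (0 : ℝ)..p.2, f p.1 x) (T ×ˢ univ) := by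
  refine continuousOn_of_forall_Icc hT (f := fun t s => ∫ x in (0 : ℝ)..s, f t x) ?_
  intro a b ha hb hab
  have hc := continuous_clamp (ha.trans hb) (hf.mono (prod_mono hab subset_rfl))
  refine (intervalIntegral.continuous_parametric_primitive_of_continuous (μ := volume)
    (f := fun t x => f (projIcc a b (ha.trans hb) t) x) (a₀ := 0) hc).continuousOn.congr ?_
  rintro ⟨t, s⟩ ⟨ht, -⟩
  simp only [projIcc_of_mem _ ht]

theorem eqOn_of_hasDerivWithinAt_eq (hT : TimeInterval T) {f g f' : ℝ → E}
    (hf : ∀ t ∈ T, HasDerivWithinAt f (f' t) T t) (hg : ∀ t ∈ T, HasDerivWithinAt g (f' t) T t)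
    (h0 : f 0 = g 0) {t : ℝ} (ht : t ∈ T) : f t = g t := by
  have := hT.convex.norm_image_sub_le_of_norm_hasDerivWithin_le (f := f - g)
    (f' := fun t => f' t - f' t) (C := 0) (fun x hx => (hf x hx).sub (hg x hx))
    (fun x _ => by simp) hT.zero_mem ht
  simp only [Pi.sub_apply, h0, sub_self, sub_zero, zero_mul] at this
  exact sub_eq_zero.1 (norm_le_zero_iff.1 this)

variable [CompleteSpace E]

theorem hasDerivWithinAt_integral (hT : TimeInterval T) {g : ℝ → E} (hg : ContinuousOn g T)
    {t : ℝ} (ht : t ∈ T) : HasDerivWithinAt (fun t => ∫ x in (0 : ℝ)..t, g x) (g t) T t := by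
  obtain ⟨a, b, ha, hb, hab, htab, hn⟩ := hT.exists_Icc ht
  have hc : Continuous (fun x => g (projIcc a b (ha.trans hb) x)) :=
    (hg.mono hab).comp_continuous (by fun_prop) fun x => (projIcc a b (ha.trans hb) x).2
  have h1 := (intervalIntegral.integral_hasDerivAt_right (hc.intervalIntegrable 0 t)
    hc.aestronglyMeasurable.stronglyMeasurableAtFilter hc.continuousAt).hasDerivWithinAt (s := T)
  rw [projIcc_of_mem _ htab] at h1
  refine h1.congr_of_eventuallyEq ?_ ?_
  · filter_upwards [hn] with τ hτ
    refine intervalIntegral.integral_congr fun x hx => ?_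
    have : x ∈ Icc a b := (ordConnected_Icc.uIcc_subset ⟨ha, hb⟩ hτ) hx
    simp only [projIcc_of_mem _ this]
  · refine intervalIntegral.integral_congr fun x hx => ?_
    have : x ∈ Icc a b := (ordConnected_Icc.uIcc_subset ⟨ha, hb⟩ htab) hx
    simp only [projIcc_of_mem _ this]

theorem hasDerivAt_integral {g : ℝ → E} (hg : Continuous g) (s : ℝ) :
    HasDerivAt (fun s => ∫ x in (0 : ℝ)..s, g x) (g s) s :=
  intervalIntegral.integral_hasDerivAt_right (hg.intervalIntegrable 0 s)
    hg.aestronglyMeasurable.stronglyMeasurableAtFilter hg.continuousAt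

theorem continuous_slice {f : ℝ → ℝ → E}
    (hf : ContinuousOn (fun p : ℝ × ℝ => f p.1 p.2) (T ×ˢ univ)) {t : ℝ} (ht : t ∈ T) :
    Continuous (f t) :=
  hf.comp_continuous (f := fun s : ℝ => ((t, s) : ℝ × ℝ)) (by fun_prop)
    fun _ => ⟨ht, mem_univ _⟩

theorem continuousOn_slice {f : ℝ → ℝ → E}
    (hf : ContinuousOn (fun p : ℝ × ℝ => f p.1 p.2) (T ×ˢ univ)) (s : ℝ) :
    ContinuousOn (fun t => f t s) T :=
  hf.comp (f := fun t : ℝ => ((t, s) : ℝ × ℝ)) (by fun_prop) fun _ ht => ⟨ht, mem_univ _⟩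

theorem integral_swap (hT : TimeInterval T) {f : ℝ → ℝ → E}
    (hf : ContinuousOn (fun p : ℝ × ℝ => f p.1 p.2) (T ×ˢ univ)) {t : ℝ} (ht : t ∈ T) (s : ℝ) :
    ∫ x in (0 : ℝ)..s, ∫ τ in (0 : ℝ)..t, f τ x = ∫ τ in (0 : ℝ)..t, ∫ x in (0 : ℝ)..s, f τ x := by
  symm
  refine intervalIntegral_intervalIntegral_swap ?_
  have : IntegrableOn (fun p : ℝ × ℝ => f p.1 p.2) (uIcc 0 t ×ˢ uIcc 0 s) :=
    (hf.mono (prod_mono (hT.uIcc_subset ht) (subset_univ _))).integrableOn_compact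
      (isCompact_uIcc.prod isCompact_uIcc)
  exact this.mono_set (prod_mono uIoc_subset_uIcc uIoc_subset_uIcc)

/-- Differentiation under the integral sign by Fubini: `f τ x` is `f 0 x` plus the time integral of
`g`, the two integrals are exchanged, and the outer time integral is differentiated. -/
theorem hasDerivWithinAt_integral_param (hT : TimeInterval T) {f g : ℝ → ℝ → E}
    (hf : ContinuousOn (fun p : ℝ × ℝ => f p.1 p.2) (T ×ˢ univ))
    (hg : ContinuousOn (fun p : ℝ × ℝ => g p.1 p.2) (T ×ˢ univ))
    (hfg : ∀ t ∈ T, ∀ s, HasDerivWithinAt (fun τ => f τ s) (g t s) T t)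
    {t : ℝ} (ht : t ∈ T) (s : ℝ) :
    HasDerivWithinAt (fun τ => ∫ x in (0 : ℝ)..s, f τ x) (∫ x in (0 : ℝ)..s, g t x) T t := by
  have h1 : ∀ τ ∈ T, ∫ x in (0 : ℝ)..s, f τ x =
      (∫ x in (0 : ℝ)..s, f 0 x) + ∫ τ in (0 : ℝ)..τ, ∫ x in (0 : ℝ)..s, g τ x := by
    intro τ hτ
    have e : ∀ x, f τ x = f 0 x + ∫ τ in (0 : ℝ)..τ, g τ x := fun x =>
      eqOn_of_hasDerivWithinAt_eq hT (f := fun τ => f τ x)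
        (g := fun τ => f 0 x + ∫ τ in (0 : ℝ)..τ, g τ x) (f' := fun τ => g τ x)
        (fun t ht => hfg t ht x)
        (fun t ht => (hasDerivWithinAt_integral hT (continuousOn_slice hg x) ht).const_add _)
        (by simp) hτ
    have e2 : (fun x => ∫ τ in (0 : ℝ)..τ, g τ x) = fun x => f τ x - f 0 x :=
      funext fun x => by rw [e x]; abel
    rw [← integral_swap hT hg hτ, ← intervalIntegral.integral_add]
    · simp_rw [← e]
    · exact (continuous_slice hf hT.zero_mem).intervalIntegrable _ _
    · rw [e2]
      exact ((continuous_slice hf hτ).sub (continuous_slice hf hT.zero_mem)).intervalIntegrable _ _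
  have h2 := (hasDerivWithinAt_integral hT (continuousOn_slice (f := fun t s =>
    ∫ x in (0 : ℝ)..s, g t x) (continuousOn_integral hT hg) s) ht).const_add
      (∫ x in (0 : ℝ)..s, f 0 x)
  exact h2.congr h1 (h1 t ht)

/-- Induction on the order: the space partial is the integrand itself, and the time partial is again
an integral of the same kind, with `f` replaced by its time derivative. -/
theorem SmoothOn.integral (hT : TimeInterval T) {f : ℝ → ℝ → E} (hf : SmoothOn T f) :
    SmoothOn T (fun t s => ∫ x in (0 : ℝ)..s, f t x) := by
  have main : ∀ n : ℕ, ∀ f : ℝ → ℝ → E, SmoothOn T f →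
      ContDiffOn ℝ n (fun p : ℝ × ℝ => ∫ x in (0 : ℝ)..p.2, f p.1 x) (T ×ˢ univ) := by
    intro n
    induction n with
    | zero => exact fun f hf => contDiffOn_zero.2 (continuousOn_integral hT hf.continuousOn)
    | succ n ih =>
      intro f hf
      exact_mod_cast contDiffOn_succ_of_partials (f := fun t s => ∫ x in (0 : ℝ)..s, f t x) hT n
        (fun t ht s => hasDerivAt_integral (continuous_slice hf.continuousOn ht) s)
        (fun t ht s => hasDerivWithinAt_integral_param hT hf.continuousOn
          (hf.timeDeriv hT).continuousOn (fun t ht s => hf.hasDerivWithinAt ht s) ht s)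
        (hf.of_le (by exact_mod_cast le_top)) (ih _ (hf.timeDeriv hT))
  exact contDiffOn_infty.2 fun n => main n f hf

theorem SmoothOn.timeDeriv_integral (hT : TimeInterval T) {f : ℝ → ℝ → E} (hf : SmoothOn T f)
    {t : ℝ} (ht : t ∈ T) (s : ℝ) :
    G2Flow.timeDeriv T (fun t s => ∫ x in (0 : ℝ)..s, f t x) t s =
      ∫ x in (0 : ℝ)..s, G2Flow.timeDeriv T f t x :=
  timeDeriv_of_hasDerivWithinAt hT ht (hasDerivWithinAt_integral_param hT hf.continuousOn
    (hf.timeDeriv hT).continuousOn (fun _ ht s => hf.hasDerivWithinAt ht s) ht s)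

theorem SmoothOn.of_time {g : ℝ → E} (hg : ContDiffOn ℝ ∞ g T) : SmoothOn T (fun t _ => g t) :=
  hg.comp contDiffOn_fst fun _ hp => hp.1

theorem SmoothOn.slice {f : ℝ → ℝ → E} (hf : SmoothOn T f) (s : ℝ) :
    ContDiffOn ℝ ∞ (fun t => f t s) T :=
  ContDiffOn.comp (g := fun p : ℝ × ℝ => f p.1 p.2) hf
    (contDiffOn_id.prodMk contDiffOn_const) fun _ ht => ⟨ht, mem_univ _⟩

theorem SmoothOn.contDiff_slice {f : ℝ → ℝ → E} (hf : SmoothOn T f) {t : ℝ} (ht : t ∈ T) :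
    ContDiff ℝ ∞ (f t) :=
  contDiffOn_univ.1 <| ContDiffOn.comp (g := fun p : ℝ × ℝ => f p.1 p.2)
    (f := fun s : ℝ => ((t, s) : ℝ × ℝ)) hf
    (contDiffOn_const.prodMk contDiffOn_id) fun _ _ => ⟨ht, mem_univ _⟩

theorem contDiffOn_integral (hT : TimeInterval T) {g : ℝ → E} (hg : ContDiffOn ℝ ∞ g T) :
    ContDiffOn ℝ ∞ (fun t => ∫ x in (0 : ℝ)..t, g x) T := by
  have hd := fun t ht => hasDerivWithinAt_integral hT hg.continuousOn (t := t) ht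
  rw [contDiffOn_infty_iff_derivWithin hT.uniqueDiffOn]
  exact ⟨fun t ht => (hd t ht).differentiableWithinAt,
    hg.congr fun t ht => (hd t ht).derivWithin (hT.uniqueDiffOn t ht)⟩

end Integrals

end G2Flow

namespace G2Flow

/-! ### Linear differential equations with values in a Banach algebra -/

section LinearODE

variable {T : Set ℝ} {V : Type} [NormedAddCommGroup V] [NormedSpace ℝ V]

/-- Grönwall's inequality on the compact segment between `0` and `t`, where `k` is bounded. Negative
times are reduced to positive ones by the reflection `x ↦ -x`. -/
theorem ode_eq_zero (hT : TimeInterval T) {k : ℝ → V →L[ℝ] V} (hk : ContinuousOn k T)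
    {y : ℝ → V} (hy : ∀ t ∈ T, HasDerivWithinAt y (k t (y t)) T t) (h0 : y 0 = 0) {t : ℝ}
    (ht : t ∈ T) : y t = 0 := by
  obtain ⟨M, hM⟩ := isCompact_uIcc.exists_bound_of_continuousOn (hk.mono (hT.uIcc_subset ht))
  have hc : ContinuousOn y T := fun x hx => (hy x hx).continuousWithinAt
  rcases le_total 0 t with h | h
  · rw [uIcc_of_le h] at hM
    have hs : Icc 0 t ⊆ T := by rw [← uIcc_of_le h]; exact hT.uIcc_subset ht
    refine eq_zero_of_abs_deriv_le_mul_abs_self_of_eq_zero_right (f' := fun t => k t (y t))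
      (K := M) (a := 0) (b := t) (hc.mono hs) (fun x hx => ?_) h0 (fun x hx => ?_) t ⟨h, le_rfl⟩
    · exact (hy x (hs ⟨hx.1, hx.2.le⟩)).mono_of_mem_nhdsWithin (Filter.mem_of_superset
        (Icc_mem_nhdsGE_of_mem hx) hs)
    · exact (k x).le_of_opNorm_le (hM x ⟨hx.1, hx.2.le⟩) _
  · rw [uIcc_of_ge h] at hM
    have hs : Icc t 0 ⊆ T := by rw [← uIcc_of_ge h]; exact hT.uIcc_subset ht
    have hs' : ∀ x ∈ Icc 0 (-t), -x ∈ Icc t 0 := fun x hx => ⟨by linarith [hx.2], by linarith [hx.1]⟩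
    have := eq_zero_of_abs_deriv_le_mul_abs_self_of_eq_zero_right (f := fun x => y (-x))
      (f' := fun x => - k (-x) (y (-x)))
      (K := M) (a := 0) (b := -t) ((hc.mono hs).comp continuous_neg.continuousOn hs')
      (fun x hx => ?_) (by simpa using h0) (fun x hx => ?_) (-t) ⟨by linarith, le_rfl⟩
    · simpa using this
    · have h1 := (hy (-x) (hs (hs' x ⟨hx.1, hx.2.le⟩)))
      have h2 := h1.scomp x (s := Icc 0 (-t)) (h := fun x => -x)
        (hasDerivWithinAt_neg x (Icc 0 (-t))) fun z hz => hs (hs' z hz)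
      rw [neg_one_smul] at h2
      exact h2.mono_of_mem_nhdsWithin (Icc_mem_nhdsGE_of_mem hx)
    · rw [norm_neg]
      exact (k (-x)).le_of_opNorm_le (hM (-x) (hs' x ⟨hx.1, hx.2.le⟩)) _

variable {A : Type} [NormedRing A] [NormedAlgebra ℝ A] [CompleteSpace A]

/-- The Picard iterates of the linear equation `F' = F K` with initial value `c`. -/
def picardIterate (K : ℝ → ℝ → A) (c : ℝ → A) : ℕ → ℝ → ℝ → A
  | 0 => fun t _ => c t
  | n + 1 => fun t s => ∫ x in (0 : ℝ)..s, picardIterate K c n t x * K t x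

theorem picardIterate_continuous {K : ℝ → ℝ → A} {c : ℝ → A}
    (hK : Continuous (fun p : ℝ × ℝ => K p.1 p.2)) (hc : Continuous c) (n : ℕ) :
    Continuous (fun p : ℝ × ℝ => picardIterate K c n p.1 p.2) := by
  induction n with
  | zero => exact hc.comp continuous_fst
  | succ n ih =>
    exact intervalIntegral.continuous_parametric_primitive_of_continuous (μ := volume)
      (f := fun t x => picardIterate K c n t x * K t x) (a₀ := 0) (ih.mul hK)

theorem norm_integral_pow_le {g : ℝ → V} {B : ℝ} {n : ℕ} {s : ℝ}
    (h : ∀ x ∈ uIcc 0 s, ‖g x‖ ≤ B * |x| ^ n) :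
    ‖∫ x in (0 : ℝ)..s, g x‖ ≤ B * |s| ^ (n + 1) / (n + 1) := by
  have hc : Continuous fun x : ℝ => B * |x - 0| ^ n := by fun_prop
  calc ‖∫ x in (0 : ℝ)..s, g x‖ = ‖∫ x in uIoc 0 s, g x‖ :=
        intervalIntegral.norm_intervalIntegral_eq _ _ _ _
    _ ≤ ∫ x in uIoc 0 s, B * |x - 0| ^ n := by
        refine norm_integral_le_of_norm_le
          ((hc.integrableOn_uIcc (a := 0) (b := s)).mono_set uIoc_subset_uIcc) ?_
        refine (ae_restrict_mem measurableSet_uIoc).mono fun x hx => ?_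
        rw [sub_zero]
        exact h x (uIoc_subset_uIcc hx)
    _ = _ := by rw [integral_const_mul, integral_pow_abs_sub_uIoc, sub_zero, mul_div_assoc]

/-- Each integration raises the power by one and supplies the next factor of the factorial. This
makes the Picard series converge and forces solutions of homogeneous Volterra equations to vanish.
-/
theorem volterra_pow_le {C M : ℝ} {n : ℕ} {s : ℝ} {g : ℝ → V}
    (h : ∀ x ∈ uIcc 0 s, ‖g x‖ ≤ C * (M * |x|) ^ n / n.factorial * M) :
    ‖∫ x in (0 : ℝ)..s, g x‖ ≤ C * (M * |s|) ^ (n + 1) / (n + 1).factorial := by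
  refine (norm_integral_pow_le (B := C * M ^ (n + 1) / n.factorial) (n := n)
    fun x hx => (h x hx).trans (le_of_eq ?_)).trans (le_of_eq ?_)
  · rw [mul_pow]; ring
  · rw [Nat.factorial_succ, mul_pow]
    push_cast
    field_simp

theorem norm_picardIterate_le {K : ℝ → ℝ → A} {c : ℝ → A} {C M : ℝ} {t s : ℝ}
    (hc : ‖c t‖ ≤ C) (hK : ∀ x ∈ uIcc 0 s, ‖K t x‖ ≤ M) (n : ℕ) :
    ∀ x ∈ uIcc 0 s, ‖picardIterate K c n t x‖ ≤ C * (M * |x|) ^ n / n.factorial := by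
  have hM : 0 ≤ M := (norm_nonneg _).trans (hK 0 left_mem_uIcc)
  have hC : 0 ≤ C := (norm_nonneg _).trans hc
  induction n with
  | zero => intro x _; simpa [picardIterate] using hc
  | succ n ih =>
    intro x hx
    refine volterra_pow_le fun z hz => ?_
    have hz' : z ∈ uIcc 0 s := uIcc_subset_uIcc_left hx hz
    refine (norm_mul_le _ _).trans ?_
    exact mul_le_mul (ih z hz') (hK z hz') (norm_nonneg _) (by positivity)

/-- Global solutions of linear equations, jointly continuous in a parameter. -/
theorem exists_linear_ode {K : ℝ → ℝ → A} {c : ℝ → A}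
    (hK : Continuous (fun p : ℝ × ℝ => K p.1 p.2)) (hc : Continuous c) :
    ∃ F : ℝ → ℝ → A, Continuous (fun p : ℝ × ℝ => F p.1 p.2) ∧ (∀ t, F t 0 = c t) ∧
      ∀ t s, HasDerivAt (F t) (F t s * K t s) s := by
  have hP := picardIterate_continuous hK hc
  have hsum : ∀ C M R : ℝ, Summable fun n : ℕ => C * (M * R) ^ n / n.factorial := by
    intro C M R
    simp_rw [mul_div_assoc]
    exact (Real.summable_pow_div_factorial (M * R)).mul_left C
  -- On the square of half-side `R` the iterates are dominated by the terms of `C exp (M R)`. This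
  -- gives continuity of the sum, and dominated convergence when the recursion is summed under the
  -- integral.
  have hbound : ∀ R : ℝ, ∃ C M : ℝ, 0 ≤ C ∧ 0 ≤ M ∧ ∀ n : ℕ, ∀ t ∈ Icc (-R) R, ∀ s ∈ Icc (-R) R,
      ‖picardIterate K c n t s‖ ≤ C * (M * R) ^ n / n.factorial ∧ ‖K t s‖ ≤ M := by
    intro R
    obtain ⟨C, hC⟩ := (isCompact_Icc (a := -R) (b := R)).exists_bound_of_continuousOn
      hc.continuousOn
    obtain ⟨M, hM⟩ := ((isCompact_Icc (a := -R) (b := R)).prod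
      (isCompact_Icc (a := -R) (b := R))).exists_bound_of_continuousOn hK.continuousOn
    refine ⟨max C 0, max M 0, le_max_right _ _, le_max_right _ _, fun n t ht s hs => ⟨?_, ?_⟩⟩
    · have hR : 0 ≤ R := by linarith [ht.1, ht.2]
      have h0 : (0 : ℝ) ∈ Icc (-R) R := ⟨by linarith, hR⟩
      refine (norm_picardIterate_le (C := max C 0) (M := max M 0) (s := s)
        ((hC t ht).trans (le_max_left _ _)) (fun x hx => ?_) n s right_mem_uIcc).trans ?_
      · exact (hM (t, x) ⟨ht, ordConnected_Icc.uIcc_subset h0 hs hx⟩).trans (le_max_left _ _)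
      · have : |s| ≤ R := abs_le.2 hs
        gcongr
    · exact (hM (t, s) ⟨ht, hs⟩).trans (le_max_left _ _)
  have hmem : ∀ t s : ℝ, ∃ R : ℝ, t ∈ Icc (-R) R ∧ s ∈ Icc (-R) R ∧ 0 ≤ R ∧
      Icc (-R) R ×ˢ Icc (-R) R ∈ nhds (t, s) := by
    intro t s
    refine ⟨max |t| |s| + 1, ?_⟩
    have h1 : |t| < max |t| |s| + 1 := (le_max_left _ _).trans_lt (lt_add_one _)
    have h2 : |s| < max |t| |s| + 1 := (le_max_right _ _).trans_lt (lt_add_one _)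
    rw [abs_lt] at h1 h2
    exact ⟨⟨h1.1.le, h1.2.le⟩, ⟨h2.1.le, h2.2.le⟩, by positivity,
      prod_mem_nhds (Icc_mem_nhds h1.1 h1.2) (Icc_mem_nhds h2.1 h2.2)⟩
  have hS : ∀ t s, Summable fun n => picardIterate K c n t s := by
    intro t s
    obtain ⟨R, ht, hs, -, -⟩ := hmem t s
    obtain ⟨C, M, -, -, h⟩ := hbound R
    exact Summable.of_norm_bounded (hsum C M R) fun n => (h n t ht s hs).1
  have hcont : Continuous (fun p : ℝ × ℝ => ∑' n, picardIterate K c n p.1 p.2) := by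
    rw [continuous_iff_continuousAt]
    rintro ⟨t, s⟩
    obtain ⟨R, -, -, -, hn⟩ := hmem t s
    obtain ⟨C, M, -, -, h⟩ := hbound R
    exact (continuousOn_tsum (fun n => (hP n).continuousOn) (hsum C M R)
      fun n p hp => (h n p.1 hp.1 p.2 hp.2).1).continuousAt hn
  have hint : ∀ t s, ∑' n, picardIterate K c n t s =
      c t + ∫ x in (0 : ℝ)..s, (∑' n, picardIterate K c n t x) * K t x := by
    intro t s
    obtain ⟨R, ht, hs, hR, -⟩ := hmem t s
    obtain ⟨C, M, hC, hM, h⟩ := hbound R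
    have hsub : ∀ x ∈ uIoc 0 s, x ∈ Icc (-R) R := fun x hx =>
      ordConnected_Icc.uIcc_subset ⟨by linarith, hR⟩ hs (uIoc_subset_uIcc hx)
    have hK1 : Continuous (K t) := hK.comp (f := fun x : ℝ => ((t, x) : ℝ × ℝ)) (by fun_prop)
    have hP1 : ∀ n, Continuous (picardIterate K c n t) := fun n =>
      (hP n).comp (f := fun x : ℝ => ((t, x) : ℝ × ℝ)) (by fun_prop)
    have := intervalIntegral.hasSum_integral_of_dominated_convergence (μ := volume) (a := 0)
      (b := s) (F := fun n x => picardIterate K c n t x * K t x)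
      (f := fun x => (∑' n, picardIterate K c n t x) * K t x)
      (fun n _ => C * (M * R) ^ n / n.factorial * M)
      (fun n => ((hP1 n).mul hK1).aestronglyMeasurable)
      (fun n => Filter.Eventually.of_forall fun x hx => ?_)
      (Filter.Eventually.of_forall fun x hx => (hsum C M R).mul_right M)
      (by simp)
      (Filter.Eventually.of_forall fun x hx => (hS t x).hasSum.mul_right _)
    · rw [(hS t s).tsum_eq_zero_add]
      congr 1
      exact this.tsum_eq
    · have := h n t ht x (hsub x hx)
      exact (norm_mul_le _ _).trans (mul_le_mul this.1 this.2 (norm_nonneg _) (by positivity))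
  refine ⟨fun t s => ∑' n, picardIterate K c n t s, hcont, fun t => ?_, fun t s => ?_⟩
  · change ∑' n, picardIterate K c n t 0 = c t
    rw [hint]; simp
  · have hK1 : Continuous (K t) := hK.comp (f := fun x : ℝ => ((t, x) : ℝ × ℝ)) (by fun_prop)
    have hF1 : Continuous (fun s => ∑' n, picardIterate K c n t s) :=
      hcont.comp (f := fun x : ℝ => ((t, x) : ℝ × ℝ)) (by fun_prop)
    have := (hasDerivAt_integral (hF1.mul hK1) s).const_add (c t)
    exact this.congr_of_eventuallyEq (Filter.Eventually.of_forall fun x => hint t x)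

theorem linear_ode_unique (hT : TimeInterval T) {K : ℝ → A} (hK : ContinuousOn K T)
    {F G : ℝ → A} (hF : ∀ t ∈ T, HasDerivWithinAt F (F t * K t) T t)
    (hG : ∀ t ∈ T, HasDerivWithinAt G (G t * K t) T t) (h0 : F 0 = G 0) {t : ℝ} (ht : t ∈ T) :
    F t = G t := by
  have := ode_eq_zero hT (k := fun t => (ContinuousLinearMap.mul ℝ A).flip (K t))
    (((ContinuousLinearMap.mul ℝ A).flip.continuous).comp_continuousOn hK) (y := F - G)
    (fun t ht => ?_) (by simp [h0]) ht
  · exact sub_eq_zero.1 this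
  · have := (hF t ht).sub (hG t ht)
    simpa [sub_mul] using this

/-- Here `S t` solves the equation on the segment from `0` to `t`, and the solution on `T` is the
diagonal `S t t`. By uniqueness it agrees near each time with a single solution on a compact
interval, so it inherits the derivative. -/
theorem exists_linear_ode_within (hT : TimeInterval T) {N : ℝ → A} (hN : ContinuousOn N T)
    (c : A) : ∃ G : ℝ → A, G 0 = c ∧ ∀ t ∈ T, HasDerivWithinAt G (G t * N t) T t := by
  have hloc : ∀ a b : ℝ, a ≤ 0 → 0 ≤ b → Icc a b ⊆ T → ∃ G : ℝ → A, G 0 = c ∧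
      ∀ t ∈ Icc a b, HasDerivAt G (G t * N t) t := by
    intro a b ha hb hab
    have hc : Continuous (fun x => N (projIcc a b (ha.trans hb) x)) :=
      (hN.mono hab).comp_continuous (by fun_prop) fun x => (projIcc a b (ha.trans hb) x).2
    obtain ⟨F, -, h0, hF⟩ := exists_linear_ode (A := A)
      (K := fun _ x => N (projIcc a b (ha.trans hb) x)) (c := fun _ => c)
      (hc.comp continuous_snd) continuous_const
    refine ⟨F 0, h0 0, fun t ht => ?_⟩
    have := hF 0 t
    rwa [projIcc_of_mem _ ht] at this
  have hex : ∀ t ∈ T, ∃ G : ℝ → A, G 0 = c ∧ ∀ x ∈ uIcc 0 t, HasDerivAt G (G x * N x) x := by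
    intro t ht
    have := hloc (min 0 t) (max 0 t) (min_le_left _ _) (le_max_left _ _) (hT.uIcc_subset ht)
    exact this
  choose! S hS0 hS using hex
  have huniq : ∀ a b : ℝ, Icc a b ⊆ T → ∀ G : ℝ → A, G 0 = c →
      (∀ t ∈ Icc a b, HasDerivAt G (G t * N t) t) → a ≤ 0 → 0 ≤ b → ∀ t ∈ Icc a b,
      S t t = G t := by
    intro a b hab G h0 hG ha hb t ht
    -- For `t = 0` the segment degenerates to a point and is not a `TimeInterval`, so the uniqueness
    -- lemma does not apply to it.
    by_cases h : t = 0
    · subst h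
      rw [hS0 0 hT.zero_mem, h0]
    have hsub : uIcc 0 t ⊆ Icc a b := ordConnected_Icc.uIcc_subset ⟨ha, hb⟩ ht
    have hI : TimeInterval (uIcc 0 t) :=
      ⟨ordConnected_uIcc, ⟨0, left_mem_uIcc, t, right_mem_uIcc, Ne.symm h⟩, left_mem_uIcc⟩
    exact linear_ode_unique hI (hN.mono (hsub.trans hab))
      (fun x hx => (hS t (hab ht) x hx).hasDerivWithinAt)
      (fun x hx => (hG x (hsub hx)).hasDerivWithinAt) (by rw [hS0 t (hab ht), h0]) right_mem_uIcc
  refine ⟨fun t => S t t, hS0 0 hT.zero_mem, fun t ht => ?_⟩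
  obtain ⟨a, b, ha, hb, hab, htab, hn⟩ := hT.exists_Icc ht
  obtain ⟨G, h0, hG⟩ := hloc a b ha hb hab
  have e := huniq a b hab G h0 hG ha hb
  have h1 := (hG t htab).hasDerivWithinAt (s := T)
  change HasDerivWithinAt (fun t => S t t) (S t t * N t) T t
  rw [e t htab]
  exact h1.congr_of_eventuallyEq (Filter.mem_of_superset hn e) (e t htab)

end LinearODE

end G2Flow

namespace G2Flow

/-! ### Flat connections on `T × ℝ` -/

section Frobenius

variable {T : Set ℝ} {A : Type} [NormedRing A] [NormedAlgebra ℝ A] [CompleteSpace A]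

/-- The bound on `D` is fed back into the equation. Each space integration gains a factor of the
factorial, while the inner time integral costs only the factor `|t|`, whence the constant `M + M'
|t|`. Letting the number of iterations grow gives zero. -/
theorem eq_zero_of_volterra (hT : TimeInterval T) {D K K' : ℝ → ℝ → A}
    (hD : ContinuousOn (fun p : ℝ × ℝ => D p.1 p.2) (T ×ˢ univ))
    (hK : ContinuousOn (fun p : ℝ × ℝ => K p.1 p.2) (T ×ˢ univ))
    (hK' : ContinuousOn (fun p : ℝ × ℝ => K' p.1 p.2) (T ×ˢ univ))
    (h : ∀ t ∈ T, ∀ s, D t s = ∫ x in (0 : ℝ)..s,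
      (D t x * K t x - ∫ τ in (0 : ℝ)..t, D τ x * K' τ x))
    {t s : ℝ} (ht : t ∈ T) : D t s = 0 := by
  have hsub : uIcc 0 t ×ˢ uIcc 0 s ⊆ T ×ˢ (univ : Set ℝ) :=
    prod_mono (hT.uIcc_subset ht) (subset_univ _)
  have hcomp : IsCompact (uIcc 0 t ×ˢ uIcc 0 s) := isCompact_uIcc.prod isCompact_uIcc
  obtain ⟨C, hC⟩ := hcomp.exists_bound_of_continuousOn (hD.mono hsub)
  obtain ⟨M, hM⟩ := hcomp.exists_bound_of_continuousOn (hK.mono hsub)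
  obtain ⟨M', hM'⟩ := hcomp.exists_bound_of_continuousOn (hK'.mono hsub)
  have h00 : ((0, 0) : ℝ × ℝ) ∈ uIcc 0 t ×ˢ uIcc 0 s := ⟨left_mem_uIcc, left_mem_uIcc⟩
  have hC0 := (norm_nonneg _).trans (hC _ h00)
  have hM0 := (norm_nonneg _).trans (hM _ h00)
  have hM'0 := (norm_nonneg _).trans (hM' _ h00)
  set R := M + M' * |t| with hR
  have hR0 : 0 ≤ R := by positivity
  have key : ∀ n : ℕ, ∀ τ ∈ uIcc 0 t, ∀ x ∈ uIcc 0 s,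
      ‖D τ x‖ ≤ C * (R * |x|) ^ n / n.factorial := by
    intro n
    induction n with
    | zero => intro τ hτ x hx; simpa using hC (τ, x) ⟨hτ, hx⟩
    | succ n ih =>
      intro τ hτ x hx
      rw [h τ (hT.uIcc_subset ht hτ) x]
      refine volterra_pow_le fun z hz => ?_
      have hz' : z ∈ uIcc 0 s := uIcc_subset_uIcc_left hx hz
      set B := C * (R * |z|) ^ n / n.factorial with hB
      have hB0 : 0 ≤ B := by positivity
      have h1 : ‖D τ z * K τ z‖ ≤ B * M := (norm_mul_le _ _).trans
        (mul_le_mul (ih τ hτ z hz') (hM (τ, z) ⟨hτ, hz'⟩) (norm_nonneg _) hB0)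
      have h2 : ‖∫ σ in (0 : ℝ)..τ, D σ z * K' σ z‖ ≤ B * M' * |t| := by
        refine (intervalIntegral.norm_integral_le_of_norm_le_const (C := B * M')
          fun σ hσ => ?_).trans ?_
        · have hσ' : σ ∈ uIcc 0 t := uIcc_subset_uIcc_left hτ (uIoc_subset_uIcc hσ)
          exact (norm_mul_le _ _).trans
            (mul_le_mul (ih σ hσ' z hz') (hM' (σ, z) ⟨hσ', hz'⟩) (norm_nonneg _) hB0)
        · have : |τ - 0| ≤ |t - 0| := abs_sub_left_of_mem_uIcc hτ
          rw [sub_zero, sub_zero] at this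
          rw [sub_zero]
          gcongr
      calc _ ≤ B * M + B * M' * |t| := (norm_sub_le _ _).trans (add_le_add h1 h2)
        _ = B * R := by rw [hR]; ring
  have hlim : Filter.Tendsto (fun n : ℕ => C * (R * |s|) ^ n / n.factorial) Filter.atTop
      (nhds 0) := by
    have := (FloorSemiring.tendsto_pow_div_factorial_atTop (R * |s|)).const_mul C
    simp_rw [mul_div_assoc]
    simpa using this
  have := ge_of_tendsto' hlim fun n => key n t right_mem_uIcc s right_mem_uIcc
  exact norm_le_zero_iff.1 this

theorem continuousOn_time_integral (hT : TimeInterval T) {f : ℝ → ℝ → A}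
    (hf : ContinuousOn (fun p : ℝ × ℝ => f p.1 p.2) (T ×ˢ univ)) :
    ContinuousOn (fun p : ℝ × ℝ => ∫ τ in (0 : ℝ)..p.1, f τ p.2) (T ×ˢ univ) := by
  refine continuousOn_of_forall_Icc hT (f := fun t s => ∫ τ in (0 : ℝ)..t, f τ s)
    fun a b ha hb hab => ?_
  have hc := continuous_clamp (ha.trans hb) (hf.mono (prod_mono hab subset_rfl))
  have hc' := (intervalIntegral.continuous_parametric_primitive_of_continuous (μ := volume)
    (f := fun s t => f (projIcc a b (ha.trans hb) t) s) (a₀ := 0)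
    (hc.comp continuous_swap)).comp continuous_swap
  refine hc'.continuousOn.congr ?_
  rintro ⟨t, s⟩ ⟨ht, -⟩
  refine intervalIntegral.integral_congr fun τ hτ => ?_
  have : τ ∈ Icc a b := ordConnected_Icc.uIcc_subset ⟨ha, hb⟩ ht hτ
  simp only [Prod.swap, projIcc_of_mem _ this]

/-- A flat connection on `T × ℝ` has a smooth global parallel frame. -/
theorem exists_parallel_frame (hT : TimeInterval T) {K N : ℝ → ℝ → A} (hK : SmoothOn T K)
    (hN : SmoothOn T N)
    (hflat : ∀ t ∈ T, ∀ s, timeDeriv T K t s + N t s * K t s = deriv (N t) s + K t s * N t s) :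
    ∃ F : ℝ → ℝ → A, F 0 0 = 1 ∧ SmoothOn T F ∧
      (∀ t ∈ T, ∀ s, HasDerivAt (F t) (F t s * K t s) s) ∧
      ∀ t ∈ T, ∀ s, HasDerivWithinAt (fun τ => F τ s) (F t s * N t s) T t := by
  -- The frame is transported in time along `s = 0` and from there in space at each fixed time. The
  -- space equation holds by construction, but differentiability in time away from `s = 0` is not
  -- yet known.
  obtain ⟨G, hG0, hG⟩ := exists_linear_ode_within hT (hN.slice 0).continuousOn (1 : A)
  have hGc : ContinuousOn G T := fun t ht => (hG t ht).continuousWithinAt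
  have hex : ∀ t ∈ T, ∃ Ft : ℝ → A, Ft 0 = G t ∧ ∀ s, HasDerivAt Ft (Ft s * K t s) s := by
    intro t ht
    obtain ⟨F, -, h0, hF⟩ := exists_linear_ode (A := A) (K := fun _ x => K t x) (c := fun _ => G t)
      ((hK.contDiff_slice ht).continuous.comp continuous_snd) continuous_const
    exact ⟨F 0, h0 0, hF 0⟩
  choose! F hF0 hF using hex
  have hFc : ContinuousOn (fun p : ℝ × ℝ => F p.1 p.2) (T ×ˢ univ) := by
    refine continuousOn_of_forall_Icc hT fun a b ha hb hab => ?_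
    have hKc := continuous_clamp (ha.trans hb) (hK.continuousOn.mono (prod_mono hab subset_rfl))
    have hGc' : Continuous (fun x => G (projIcc a b (ha.trans hb) x)) :=
      (hGc.mono hab).comp_continuous (by fun_prop) fun x => (projIcc a b (ha.trans hb) x).2
    obtain ⟨F', hc, h0, hF'⟩ := exists_linear_ode
      (K := fun t s => K (projIcc a b (ha.trans hb) t) s) hKc hGc'
    refine hc.continuousOn.congr ?_
    rintro ⟨t, s⟩ ⟨ht, -⟩
    have e : ∀ s, HasDerivAt (F' t) (F' t s * K t s) s := by
      intro s
      have := hF' t s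
      rwa [projIcc_of_mem _ ht] at this
    refine linear_ode_unique TimeInterval.univ
      (hK.contDiff_slice (hab ht)).continuous.continuousOn
      (fun s _ => (hF t (hab ht) s).hasDerivWithinAt) (fun s _ => (e s).hasDerivWithinAt) ?_
      (mem_univ s)
    rw [hF0 t (hab ht), h0, projIcc_of_mem _ ht]
  have hKt := hK.timeDeriv hT
  have hNs := hN.deriv hT
  have hFN : ContinuousOn (fun p : ℝ × ℝ => F p.1 p.2 * N p.1 p.2) (T ×ˢ univ) :=
    hFc.mul hN.continuousOn
  have hFK : ContinuousOn (fun p : ℝ × ℝ => F p.1 p.2 * K p.1 p.2) (T ×ˢ univ) :=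
    hFc.mul hK.continuousOn
  -- `W` is the space derivative of `F N`. Flatness rewrites it, in `hWK`, as the time derivative
  -- that `F K` would have if `F` had time derivative `F N`.
  set W : ℝ → ℝ → A := fun t s => F t s * K t s * N t s + F t s * deriv (N t) s with hW
  have hWc : ContinuousOn (fun p : ℝ × ℝ => W p.1 p.2) (T ×ˢ univ) :=
    (hFK.mul hN.continuousOn).add (hFc.mul hNs.continuousOn)
  have hWs : ∀ t ∈ T, ∀ s, HasDerivAt (fun s => F t s * N t s) (W t s) s := fun t ht s =>
    (hF t ht s).mul (hN.hasDerivAt ht s)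
  have hWK : ∀ t ∈ T, ∀ s, W t s = F t s * timeDeriv T K t s + F t s * N t s * K t s := by
    intro t ht s
    simp only [hW]
    rw [mul_assoc, mul_assoc, ← mul_add, ← mul_add, hflat t ht s, add_comm]
  -- `H` has time derivative `F N` by construction. Flatness makes `F - H` a solution of a
  -- homogeneous Volterra equation, so `F = H`; in this way `F` is never differentiated in time
  -- before its derivative is known.
  set H : ℝ → ℝ → A := fun t s => F 0 s + ∫ τ in (0 : ℝ)..t, F τ s * N τ s with hH
  have hHt : ∀ t ∈ T, ∀ s, HasDerivWithinAt (fun τ => H τ s) (F t s * N t s) T t := fun t ht s =>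
    (hasDerivWithinAt_integral hT (continuousOn_slice (f := fun t s => F t s * N t s) hFN s)
      ht).const_add (F 0 s)
  have hint : ∀ {f g : ℝ → A}, Continuous g → (∀ s, HasDerivAt f (g s) s) → ∀ s,
      f s = f 0 + ∫ x in (0 : ℝ)..s, g x := by
    intro f g hg hfg s
    rw [intervalIntegral.integral_eq_sub_of_hasDerivAt (fun x _ => hfg x)
      (hg.intervalIntegrable _ _)]
    abel
  have hintT : ∀ {f g : ℝ → A}, ContinuousOn g T → (∀ t ∈ T, HasDerivWithinAt f (g t) T t) →
      ∀ t ∈ T, f t = f 0 + ∫ x in (0 : ℝ)..t, g x := by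
    intro f g hg hfg t ht
    exact eqOn_of_hasDerivWithinAt_eq hT (g := fun t => f 0 + ∫ x in (0 : ℝ)..t, g x) hfg
      (fun t ht => (hasDerivWithinAt_integral hT hg ht).const_add _) (by simp) ht
  have hii : ∀ {f : ℝ → ℝ → A}, ContinuousOn (fun p : ℝ × ℝ => f p.1 p.2) (T ×ˢ univ) →
      ∀ t ∈ T, ∀ s, IntervalIntegrable (fun τ => f τ s) volume 0 t := fun hf t ht s =>
    ((continuousOn_slice hf s).mono (hT.uIcc_subset ht)).intervalIntegrable
  have hFGint : ∀ t ∈ T, ∀ s, F t s = G t + ∫ x in (0 : ℝ)..s, F t x * K t x := by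
    intro t ht s
    rw [← hF0 t ht]
    exact hint (continuous_slice (f := fun t s => F t s * K t s) hFK ht) (hF t ht) s
  have hHint : ∀ t ∈ T, ∀ s, H t s = G t + (∫ x in (0 : ℝ)..s, F 0 x * K 0 x) +
      ∫ x in (0 : ℝ)..s, ∫ τ in (0 : ℝ)..t, W τ x := by
    intro t ht s
    rw [integral_swap hT hWc ht]
    have e1 : ∫ τ in (0 : ℝ)..t, F τ s * N τ s =
        ∫ τ in (0 : ℝ)..t, (G τ * N τ 0 + ∫ x in (0 : ℝ)..s, W τ x) := by
      refine intervalIntegral.integral_congr fun τ hτ => ?_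
      have hτ' := hT.uIcc_subset ht hτ
      change F τ s * N τ s = G τ * N τ 0 + ∫ x in (0 : ℝ)..s, W τ x
      rw [← hF0 τ hτ']
      exact hint (continuous_slice hWc hτ') (hWs τ hτ') s
    have e2 : G t = 1 + ∫ τ in (0 : ℝ)..t, G τ * N τ 0 := by
      rw [← hG0]
      exact hintT (hGc.mul (hN.slice 0).continuousOn) hG t ht
    have i1 : IntervalIntegrable (fun τ => G τ * N τ 0) volume 0 t :=
      ((hGc.mul (hN.slice 0).continuousOn).mono (hT.uIcc_subset ht)).intervalIntegrable
    simp only [hH]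
    rw [e1, intervalIntegral.integral_add i1
      (hii (f := fun t s => ∫ x in (0 : ℝ)..s, W t x) (continuousOn_integral hT hWc) t ht s),
      hFGint 0 hT.zero_mem s, hG0, e2]
    abel
  have hHc : ContinuousOn (fun p : ℝ × ℝ => H p.1 p.2) (T ×ˢ univ) := by
    have c1 : ContinuousOn (fun p : ℝ × ℝ => G p.1) (T ×ˢ univ) :=
      hGc.comp continuousOn_fst fun p hp => hp.1
    have c2 : Continuous (fun p : ℝ × ℝ => ∫ x in (0 : ℝ)..p.2, F 0 x * K 0 x) := by
      have : Continuous fun s => ∫ x in (0 : ℝ)..s, F 0 x * K 0 x :=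
        intervalIntegral.continuous_primitive (fun a b => (continuous_slice
          (f := fun t s => F t s * K t s) hFK hT.zero_mem).intervalIntegrable a b) 0
      exact this.comp continuous_snd
    have c3 : ContinuousOn (fun p : ℝ × ℝ => ∫ τ in (0 : ℝ)..p.1, ∫ x in (0 : ℝ)..p.2, W τ x)
        (T ×ˢ univ) :=
      continuousOn_time_integral hT (f := fun t s => ∫ x in (0 : ℝ)..s, W t x)
        (continuousOn_integral hT hWc)
    refine ((c1.add c2.continuousOn).add c3).congr ?_
    rintro ⟨t, s⟩ ⟨ht, -⟩
    have := hHint t ht s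
    rw [integral_swap hT hWc ht] at this
    exact this
  have hDc : ContinuousOn (fun p : ℝ × ℝ => F p.1 p.2 - H p.1 p.2) (T ×ˢ univ) := hFc.sub hHc
  have hHK : ∀ t ∈ T, ∀ x, H t x * K t x = F 0 x * K 0 x +
      ∫ τ in (0 : ℝ)..t, (F τ x * N τ x * K τ x + H τ x * timeDeriv T K τ x) := by
    intro t ht x
    have h0 : H 0 x = F 0 x := by simp [hH]
    rw [← h0]
    exact hintT (continuousOn_slice (f := fun τ x =>
      F τ x * N τ x * K τ x + H τ x * timeDeriv T K τ x)
        ((hFN.mul hK.continuousOn).add (hHc.mul hKt.continuousOn)) x)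
      (fun t ht => (hHt t ht x).mul (hK.hasDerivWithinAt ht x)) t ht
  have hvol : ∀ t ∈ T, ∀ s, F t s - H t s = ∫ x in (0 : ℝ)..s,
      ((F t x - H t x) * K t x - ∫ τ in (0 : ℝ)..t, (F τ x - H τ x) * timeDeriv T K τ x) := by
    intro t ht s
    have e : ∀ x, (F t x - H t x) * K t x -
        ∫ τ in (0 : ℝ)..t, (F τ x - H τ x) * timeDeriv T K τ x =
        F t x * K t x - F 0 x * K 0 x - ∫ τ in (0 : ℝ)..t, W τ x := by
      intro x
      have i1 := hii (f := fun τ x => (F τ x - H τ x) * timeDeriv T K τ x)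
        (hDc.mul hKt.continuousOn) t ht x
      have i2 := hii (f := fun τ x => F τ x * N τ x * K τ x + H τ x * timeDeriv T K τ x)
        ((hFN.mul hK.continuousOn).add (hHc.mul hKt.continuousOn)) t ht x
      have e3 : ∫ τ in (0 : ℝ)..t, W τ x =
          (∫ τ in (0 : ℝ)..t, (F τ x - H τ x) * timeDeriv T K τ x) +
          ∫ τ in (0 : ℝ)..t, (F τ x * N τ x * K τ x + H τ x * timeDeriv T K τ x) := by
        rw [← intervalIntegral.integral_add i1 i2]
        refine intervalIntegral.integral_congr fun τ hτ => ?_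
        rw [hWK τ (hT.uIcc_subset ht hτ) x]
        noncomm_ring
      rw [e3, sub_mul, hHK t ht x]
      abel
    have j1 : ∀ t ∈ T, IntervalIntegrable (fun x => F t x * K t x) volume 0 s := fun t ht =>
      (continuous_slice (f := fun t s => F t s * K t s) hFK ht).intervalIntegrable _ _
    have j2 : IntervalIntegrable (fun x => ∫ τ in (0 : ℝ)..t, W τ x) volume 0 s := by
      have c1 := continuousOn_time_integral hT hWc
      exact (continuous_slice (f := fun t s => ∫ τ in (0 : ℝ)..t, W τ s) c1 ht).intervalIntegrable
        _ _
    simp_rw [e]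
    rw [intervalIntegral.integral_sub ((j1 t ht).sub (j1 0 hT.zero_mem)) j2,
      intervalIntegral.integral_sub (j1 t ht) (j1 0 hT.zero_mem), hFGint t ht s, hHint t ht s]
    abel
  have hFH : ∀ t ∈ T, ∀ s, F t s = H t s := fun t ht s => sub_eq_zero.1
    (eq_zero_of_volterra hT (D := fun t s => F t s - H t s) hDc hK.continuousOn hKt.continuousOn
      hvol ht)
  have hFt : ∀ t ∈ T, ∀ s, HasDerivWithinAt (fun τ => F τ s) (F t s * N t s) T t := fun t ht s =>
    (hHt t ht s).congr (fun τ hτ => hFH τ hτ s) (hFH t ht s)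
  refine ⟨F, by rw [hF0 0 hT.zero_mem, hG0], contDiffOn_infty.2 fun n => ?_, hF, hFt⟩
  -- Both partial derivatives are products of `F` with smooth functions, so each round gains one
  -- order of smoothness.
  induction n with
  | zero => exact contDiffOn_zero.2 hFc
  | succ n ih =>
    exact_mod_cast contDiffOn_succ_of_partials hT n hF hFt
      (ih.mul (hK.of_le (by exact_mod_cast le_top))) (ih.mul (hN.of_le (by exact_mod_cast le_top)))

end Frobenius

end G2Flow

namespace G2Flow

/-! ### The cross product -/

theorem vec_ext {x y : E7} (h0 : x 0 = y 0) (h1 : x 1 = y 1) (h2 : x 2 = y 2) (h3 : x 3 = y 3)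
    (h4 : x 4 = y 4) (h5 : x 5 = y 5) (h6 : x 6 = y 6) : x = y := by
  ext i
  fin_cases i <;> assumption

theorem vec_apply (a b c d e f g : ℝ) : ![a, b, c, d, e, f, g] 0 = a ∧
    ![a, b, c, d, e, f, g] 1 = b ∧ ![a, b, c, d, e, f, g] 2 = c ∧
    ![a, b, c, d, e, f, g] 3 = d ∧ ![a, b, c, d, e, f, g] 4 = e ∧
    ![a, b, c, d, e, f, g] 5 = f ∧ ![a, b, c, d, e, f, g] 6 = g :=
  ⟨rfl, rfl, rfl, rfl, rfl, rfl, rfl⟩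

/-- In coordinates, the identities for the cross product and for the Lie algebra of `G₂` become
polynomial identities. -/
theorem cross_eq (x y : E7) : cross x y = !₂[
    x 1 * y 2 - x 2 * y 1 + x 3 * y 4 - x 4 * y 3 - x 5 * y 6 + x 6 * y 5,
    -(x 0 * y 2) + x 2 * y 0 + x 3 * y 5 + x 4 * y 6 - x 5 * y 3 - x 6 * y 4,
    x 0 * y 1 - x 1 * y 0 + x 3 * y 6 - x 4 * y 5 + x 5 * y 4 - x 6 * y 3,
    -(x 0 * y 4) - x 1 * y 5 - x 2 * y 6 + x 4 * y 0 + x 5 * y 1 + x 6 * y 2,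
    x 0 * y 3 - x 1 * y 6 + x 2 * y 5 - x 3 * y 0 - x 5 * y 2 + x 6 * y 1,
    x 0 * y 6 + x 1 * y 3 - x 2 * y 4 - x 3 * y 1 + x 4 * y 2 - x 6 * y 0,
    -(x 0 * y 5) + x 1 * y 4 + x 2 * y 3 - x 3 * y 2 - x 4 * y 1 + x 5 * y 0] := by
  ext i
  have h1 : ∀ z : E7, (toOct z).1.re = 0 ∧ (toOct z).1.imI = z 0 ∧ (toOct z).1.imJ = z 1 ∧
      (toOct z).1.imK = z 2 ∧ (toOct z).2.re = z 3 ∧ (toOct z).2.imI = z 4 ∧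
      (toOct z).2.imJ = z 5 ∧ (toOct z).2.imK = z 6 := fun z => ⟨rfl, rfl, rfl, rfl, rfl, rfl, rfl, rfl⟩
  fin_cases i <;> simp [cross, ofOct, octMul, octConj, h1] <;> ring

theorem inner_eq (x y : E7) : inner ℝ x y = x 0 * y 0 + x 1 * y 1 + x 2 * y 2 + x 3 * y 3 +
    x 4 * y 4 + x 5 * y 5 + x 6 * y 6 := by
  simp [PiLp.inner_apply, Fin.sum_univ_seven, mul_comm]

theorem cross_add_left (x y z : E7) : cross (x + y) z = cross x z + cross y z := by
  apply vec_ext <;> simp only [cross_eq, vec_apply, PiLp.add_apply, PiLp.sub_apply,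
    PiLp.neg_apply, PiLp.smul_apply,
        smul_eq_mul, PiLp.zero_apply] <;> ring

theorem cross_smul_left (c : ℝ) (x y : E7) : cross (c • x) y = c • cross x y := by
  apply vec_ext <;> simp only [cross_eq, vec_apply, PiLp.add_apply, PiLp.sub_apply,
    PiLp.neg_apply, PiLp.smul_apply,
        smul_eq_mul, PiLp.zero_apply] <;> ring

theorem cross_anticomm (x y : E7) : cross x y = -cross y x := by
  apply vec_ext <;> simp only [cross_eq, vec_apply, PiLp.add_apply, PiLp.sub_apply,
    PiLp.neg_apply, PiLp.smul_apply,
        smul_eq_mul, PiLp.zero_apply] <;> ring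

theorem cross_self (x : E7) : cross x x = 0 := by
  apply vec_ext <;> simp only [cross_eq, vec_apply, PiLp.add_apply, PiLp.sub_apply,
    PiLp.neg_apply, PiLp.smul_apply,
        smul_eq_mul, PiLp.zero_apply] <;> ring

theorem cross_add_right (x y z : E7) : cross x (y + z) = cross x y + cross x z := by
  rw [cross_anticomm, cross_add_left, cross_anticomm y, cross_anticomm z, neg_add, neg_neg, neg_neg]

theorem cross_smul_right (c : ℝ) (x y : E7) : cross x (c • y) = c • cross x y := by
  rw [cross_anticomm, cross_smul_left, cross_anticomm y, smul_neg, neg_neg]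

/-- The cross product as a continuous bilinear map. -/
def crossL : E7 →L[ℝ] E7 →L[ℝ] E7 :=
  LinearMap.toContinuousLinearMap ((LinearMap.toContinuousLinearMap :
    (E7 →ₗ[ℝ] E7) ≃ₗ[ℝ] E7 →L[ℝ] E7).toLinearMap ∘ₗ
      LinearMap.mk₂ ℝ cross cross_add_left cross_smul_left cross_add_right
        (fun c x y => cross_smul_right c x y))

theorem crossL_apply (x y : E7) : crossL x y = cross x y := rfl

theorem cross_neg_left (x y : E7) : cross (-x) y = -cross x y := by
  rw [← crossL_apply, map_neg]; rfl

theorem cross_neg_right (x y : E7) : cross x (-y) = -cross x y := (crossL x).map_neg y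

theorem inner_cross_cyclic (x y z : E7) : inner ℝ (cross x y) z = inner ℝ x (cross y z) := by
  rw [inner_eq, inner_eq]; simp only [cross_eq, vec_apply]; ring

theorem inner_cross_self_left (x y : E7) : inner ℝ (cross x y) x = 0 := by
  rw [inner_eq]; simp only [cross_eq, vec_apply]; ring

theorem inner_cross_self_right (x y : E7) : inner ℝ (cross x y) y = 0 := by
  rw [inner_eq]; simp only [cross_eq, vec_apply]; ring

/-- The triple product formula of dimension three fails in dimension seven; only its part symmetric
in `x, y` survives. For pairwise orthogonal vectors it becomes `x × (y × z) = -y × (x × z)`, the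
rule behind the multiplication table of a `G₂`-frame. -/
theorem cross_cross_add (x y z : E7) : cross x (cross y z) + cross y (cross x z) =
    -(2 * inner ℝ x y) • z + (inner ℝ x z : ℝ) • y + (inner ℝ y z : ℝ) • x := by
  rw [inner_eq, inner_eq, inner_eq]
  apply vec_ext <;> simp only [cross_eq, vec_apply, PiLp.add_apply, PiLp.sub_apply,
    PiLp.neg_apply, PiLp.smul_apply,
        smul_eq_mul, PiLp.zero_apply] <;> ring

theorem cross_cross_self (x y : E7) : cross x (cross x y) =
    -(inner ℝ x x : ℝ) • y + (inner ℝ x y : ℝ) • x := by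
  rw [inner_eq, inner_eq]
  apply vec_ext <;> simp only [cross_eq, vec_apply, PiLp.add_apply, PiLp.sub_apply,
    PiLp.neg_apply, PiLp.smul_apply,
        smul_eq_mul, PiLp.zero_apply] <;> ring

/-! ### Linear maps in `G₂` -/

/-- The standard basis vectors of `ℝ⁷`. -/
def stdVec (i : Fin 7) : E7 := EuclideanSpace.single i 1

theorem stdVec_apply (i j : Fin 7) : stdVec i j = if j = i then 1 else 0 := by
  simp [stdVec]

theorem clm_mul_apply (F G : E7 →L[ℝ] E7) (x : E7) : (F * G) x = F (G x) := rfl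

theorem clm_ext {F G : E7 →L[ℝ] E7} (h : ∀ i, F (stdVec i) = G (stdVec i)) : F = G := by
  apply ContinuousLinearMap.coe_injective
  refine (EuclideanSpace.basisFun (Fin 7) ℝ).toBasis.ext fun i => ?_
  simpa [stdVec] using h i

theorem cross_stdVec_zero_one : cross (stdVec 0) (stdVec 1) = stdVec 2 := by
  ext i; fin_cases i <;> simp [cross_eq, stdVec_apply]

theorem cross_stdVec_zero_three : cross (stdVec 0) (stdVec 3) = stdVec 4 := by
  ext i; fin_cases i <;> simp [cross_eq, stdVec_apply]

theorem cross_stdVec_one_three : cross (stdVec 1) (stdVec 3) = stdVec 5 := by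
  ext i; fin_cases i <;> simp [cross_eq, stdVec_apply]

theorem cross_stdVec_one_four : cross (stdVec 1) (stdVec 4) = stdVec 6 := by
  ext i; fin_cases i <;> simp [cross_eq, stdVec_apply]

/-- Linear maps of `ℝ⁷` that belong to `G₂`. -/
def IsG2Map (F : E7 →L[ℝ] E7) : Prop :=
  (∀ x y, F (cross x y) = cross (F x) (F y)) ∧ ∀ x y, inner ℝ (F x) (F y) = inner ℝ x y

theorem IsG2Map.norm_map {F : E7 →L[ℝ] E7} (hF : IsG2Map F) (x : E7) : ‖F x‖ = ‖x‖ := by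
  rw [norm_eq_sqrt_real_inner, hF.2, ← norm_eq_sqrt_real_inner]

theorem IsG2Map.mul {F G : E7 →L[ℝ] E7} (hF : IsG2Map F) (hG : IsG2Map G) : IsG2Map (F * G) :=
  ⟨fun x y => by rw [clm_mul_apply, hG.1, hF.1]; rfl,
    fun x y => by rw [clm_mul_apply, clm_mul_apply, hF.2, hG.2]⟩

/-- The isometry of `ℝ⁷` given by a linear map in `G₂`. -/
def IsG2Map.equiv {F : E7 →L[ℝ] E7} (hF : IsG2Map F) : E7 ≃ₗᵢ[ℝ] E7 :=
  LinearIsometry.toLinearIsometryEquiv ⟨F.toLinearMap, hF.norm_map⟩ rfl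

theorem IsG2Map.equiv_apply {F : E7 →L[ℝ] E7} (hF : IsG2Map F) (x : E7) : hF.equiv x = F x := rfl

theorem IsG2Map.isG2_equiv {F : E7 →L[ℝ] E7} (hF : IsG2Map F) : IsG2 hF.equiv := hF.1

theorem IsG2Map.adjoint_mul {F : E7 →L[ℝ] E7} (hF : IsG2Map F) :
    ContinuousLinearMap.adjoint F * F = 1 := by
  ext1 x
  refine ext_inner_left ℝ fun y => ?_
  rw [clm_mul_apply, ContinuousLinearMap.adjoint_inner_right, hF.2]
  rfl

theorem IsG2Map.mul_adjoint {F : E7 →L[ℝ] E7} (hF : IsG2Map F) :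
    F * ContinuousLinearMap.adjoint F = 1 := by
  ext1 x
  obtain ⟨y, rfl⟩ := hF.equiv.surjective x
  rw [clm_mul_apply, hF.equiv_apply,
    ← clm_mul_apply (ContinuousLinearMap.adjoint F), hF.adjoint_mul]
  rfl

theorem IsG2Map.adjoint {F : E7 →L[ℝ] E7} (hF : IsG2Map F) :
    IsG2Map (ContinuousLinearMap.adjoint F) := by
  have h1 : ∀ x, ContinuousLinearMap.adjoint F (F x) = x := fun x => by
    rw [← clm_mul_apply (ContinuousLinearMap.adjoint F), hF.adjoint_mul]; rfl
  constructor
  · intro x y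
    obtain ⟨x, rfl⟩ := hF.equiv.surjective x
    obtain ⟨y, rfl⟩ := hF.equiv.surjective y
    simp only [hF.equiv_apply]
    rw [← hF.1, h1, h1, h1]
  · intro x y
    obtain ⟨x, rfl⟩ := hF.equiv.surjective x
    obtain ⟨y, rfl⟩ := hF.equiv.surjective y
    simp only [hF.equiv_apply]
    rw [hF.2, h1, h1]

/-! ### The Lie algebra of `G₂` -/

/-- Coordinates `(x₁, x₂, x₃; ν₁, ν₂; a₁₂, a₁₃, a₂₃)` on the Lie algebra of `G₂`: with the complex
vectors `ε₁ = e₁ - √-1 e₂`, `ε₂ = e₃ - √-1 e₄`, `ε₃ = e₅ + √-1 e₆`, the derivation maps `e₀` to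
`2 Re ∑ xⱼ ε̄ⱼ` and `εⱼ` to `-2 xⱼ e₀ + ∑ aⱼₖ εₖ` plus a combination of the `ε̄ₖ`. -/
abbrev G2Coord : Type := ℂ × ℂ × ℂ × ℝ × ℝ × ℂ × ℂ × ℂ

/-- The action of the Lie algebra of `G₂` on `ℝ⁷`, in coordinates. -/
def g2Act (κ : G2Coord) (x : E7) : E7 :=
  match κ with
  | (x₁, x₂, x₃, ν₁, ν₂, a, b, c) => !₂[
    -(2 * x₁.re) * x 1 + 2 * x₁.im * x 2 - 2 * x₂.re * x 3 + 2 * x₂.im * x 4 - 2 * x₃.re * x 5 -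
      2 * x₃.im * x 6,
    2 * x₁.re * x 0 - ν₁ * x 2 + (-a.re + x₃.im) * x 3 - (a.im + x₃.re) * x 4 -
      (b.re + x₂.im) * x 5 + (b.im - x₂.re) * x 6,
    -(2 * x₁.im) * x 0 + ν₁ * x 1 + (a.im - x₃.re) * x 3 - (a.re + x₃.im) * x 4 +
      (b.im + x₂.re) * x 5 + (b.re - x₂.im) * x 6,
    2 * x₂.re * x 0 + (a.re - x₃.im) * x 1 + (-a.im + x₃.re) * x 2 - ν₂ * x 4 +
      (-c.re + x₁.im) * x 5 + (c.im + x₁.re) * x 6,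
    -(2 * x₂.im) * x 0 + (a.im + x₃.re) * x 1 + (a.re + x₃.im) * x 2 + ν₂ * x 3 +
      (c.im - x₁.re) * x 5 + (c.re + x₁.im) * x 6,
    2 * x₃.re * x 0 + (b.re + x₂.im) * x 1 - (b.im + x₂.re) * x 2 + (c.re - x₁.im) * x 3 +
      (-c.im + x₁.re) * x 4 - (ν₁ + ν₂) * x 6,
    2 * x₃.im * x 0 + (-b.im + x₂.re) * x 1 + (-b.re + x₂.im) * x 2 - (c.im + x₁.re) * x 3 -
      (c.re + x₁.im) * x 4 + (ν₁ + ν₂) * x 5]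

/-- The Lie algebra of `G₂` as endomorphisms of `ℝ⁷`. -/
def g2Lie : G2Coord →L[ℝ] E7 →L[ℝ] E7 :=
  LinearMap.toContinuousLinearMap ((LinearMap.toContinuousLinearMap :
    (E7 →ₗ[ℝ] E7) ≃ₗ[ℝ] E7 →L[ℝ] E7).toLinearMap ∘ₗ
      LinearMap.mk₂ ℝ g2Act
        (fun κ κ' x => by
          obtain ⟨x₁, x₂, x₃, ν₁, ν₂, a, b, c⟩ := κ
          obtain ⟨x₁', x₂', x₃', ν₁', ν₂', a', b', c'⟩ := κ'
          apply vec_ext <;> simp only [g2Act, vec_apply, PiLp.add_apply, PiLp.sub_apply,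
            PiLp.neg_apply, PiLp.smul_apply,
        smul_eq_mul, PiLp.zero_apply,
            Prod.mk_add_mk, Prod.smul_mk, Complex.add_re, Complex.add_im, Complex.real_smul,
            Complex.re_ofReal_mul, Complex.im_ofReal_mul] <;> ring)
        (fun r κ x => by
          obtain ⟨x₁, x₂, x₃, ν₁, ν₂, a, b, c⟩ := κ
          apply vec_ext <;> simp only [g2Act, vec_apply, PiLp.add_apply, PiLp.sub_apply,
            PiLp.neg_apply, PiLp.smul_apply,
        smul_eq_mul, PiLp.zero_apply,
            Prod.mk_add_mk, Prod.smul_mk, Complex.add_re, Complex.add_im, Complex.real_smul,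
            Complex.re_ofReal_mul, Complex.im_ofReal_mul] <;> ring)
        (fun κ x y => by
          obtain ⟨x₁, x₂, x₃, ν₁, ν₂, a, b, c⟩ := κ
          apply vec_ext <;> simp only [g2Act, vec_apply, PiLp.add_apply, PiLp.sub_apply,
            PiLp.neg_apply, PiLp.smul_apply,
        smul_eq_mul, PiLp.zero_apply,
            Prod.mk_add_mk, Prod.smul_mk, Complex.add_re, Complex.add_im, Complex.real_smul,
            Complex.re_ofReal_mul, Complex.im_ofReal_mul] <;> ring)
        (fun r κ x => by
          obtain ⟨x₁, x₂, x₃, ν₁, ν₂, a, b, c⟩ := κ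
          apply vec_ext <;> simp only [g2Act, vec_apply, PiLp.add_apply, PiLp.sub_apply,
            PiLp.neg_apply, PiLp.smul_apply,
        smul_eq_mul, PiLp.zero_apply,
            Prod.mk_add_mk, Prod.smul_mk, Complex.add_re, Complex.add_im, Complex.real_smul,
            Complex.re_ofReal_mul, Complex.im_ofReal_mul] <;> ring))

theorem g2Lie_apply (κ : G2Coord) (x : E7) : g2Lie κ x = g2Act κ x := rfl

theorem g2Lie_cross (κ : G2Coord) (x y : E7) :
    g2Lie κ (cross x y) = cross (g2Lie κ x) y + cross x (g2Lie κ y) := by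
  obtain ⟨x₁, x₂, x₃, ν₁, ν₂, a, b, c⟩ := κ
  simp only [g2Lie_apply]
  apply vec_ext <;> simp only [g2Act, cross_eq, vec_apply, PiLp.add_apply, PiLp.sub_apply,
    PiLp.neg_apply, PiLp.smul_apply,
        smul_eq_mul, PiLp.zero_apply] <;> ring

theorem g2Lie_inner (κ : G2Coord) (x y : E7) :
    inner ℝ (g2Lie κ x) y + inner ℝ x (g2Lie κ y) = 0 := by
  obtain ⟨x₁, x₂, x₃, ν₁, ν₂, a, b, c⟩ := κ
  rw [g2Lie_apply, g2Lie_apply, inner_eq, inner_eq]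
  simp only [g2Act, vec_apply]
  ring

/-- The coordinates of an element of the Lie algebra of `G₂`. -/
def g2Coord : (E7 →L[ℝ] E7) →L[ℝ] G2Coord :=
  LinearMap.toContinuousLinearMap
  { toFun := fun D =>
      (⟨D (stdVec 0) 1 / 2, -D (stdVec 0) 2 / 2⟩, ⟨D (stdVec 0) 3 / 2, -D (stdVec 0) 4 / 2⟩,
        ⟨D (stdVec 0) 5 / 2, D (stdVec 0) 6 / 2⟩, D (stdVec 1) 2, D (stdVec 3) 4,
        ⟨D (stdVec 1) 3 + D (stdVec 0) 6 / 2, D (stdVec 1) 4 - D (stdVec 0) 5 / 2⟩,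
        ⟨D (stdVec 1) 5 + D (stdVec 0) 4 / 2, -D (stdVec 1) 6 + D (stdVec 0) 3 / 2⟩,
        ⟨D (stdVec 3) 5 - D (stdVec 0) 2 / 2, -D (stdVec 3) 6 - D (stdVec 0) 1 / 2⟩)
    map_add' := fun D D' => by
      simp only [Prod.mk_add_mk, Prod.mk.injEq, Complex.ext_iff]
      simp
      refine ⟨⟨?_, ?_⟩, ⟨?_, ?_⟩, ⟨?_, ?_⟩, ⟨?_, ?_⟩, ⟨?_, ?_⟩, ?_, ?_⟩ <;> ring
    map_smul' := fun c D => by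
      simp only [Prod.smul_mk, Prod.mk.injEq, Complex.ext_iff]
      simp
      refine ⟨⟨?_, ?_⟩, ⟨?_, ?_⟩, ⟨?_, ?_⟩, ⟨?_, ?_⟩, ⟨?_, ?_⟩, ?_, ?_⟩ <;> ring }

theorem g2Coord_apply (D : E7 →L[ℝ] E7) : g2Coord D =
      (⟨D (stdVec 0) 1 / 2, -D (stdVec 0) 2 / 2⟩, ⟨D (stdVec 0) 3 / 2, -D (stdVec 0) 4 / 2⟩,
        ⟨D (stdVec 0) 5 / 2, D (stdVec 0) 6 / 2⟩, D (stdVec 1) 2, D (stdVec 3) 4,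
        ⟨D (stdVec 1) 3 + D (stdVec 0) 6 / 2, D (stdVec 1) 4 - D (stdVec 0) 5 / 2⟩,
        ⟨D (stdVec 1) 5 + D (stdVec 0) 4 / 2, -D (stdVec 1) 6 + D (stdVec 0) 3 / 2⟩,
        ⟨D (stdVec 3) 5 - D (stdVec 0) 2 / 2, -D (stdVec 3) 6 - D (stdVec 0) 1 / 2⟩) := rfl

theorem g2Coord_g2Lie (κ : G2Coord) : g2Coord (g2Lie κ) = κ := by
  obtain ⟨x₁, x₂, x₃, ν₁, ν₂, a, b, c⟩ := κ
  simp only [g2Coord_apply, g2Lie_apply, Prod.mk.injEq, Complex.ext_iff]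
  simp [g2Act, stdVec_apply]
  constructor <;> ring

theorem g2Lie_injective : Function.Injective g2Lie :=
  Function.LeftInverse.injective g2Coord_g2Lie

/-- The vectors `e₀, e₁, e₃` generate `ℝ⁷` under the cross product, so a derivation is determined by
its values on them. -/
theorem derivation_ext {D D' : E7 →L[ℝ] E7}
    (hD : ∀ x y, D (cross x y) = cross (D x) y + cross x (D y))
    (hD' : ∀ x y, D' (cross x y) = cross (D' x) y + cross x (D' y))
    (h0 : D (stdVec 0) = D' (stdVec 0)) (h1 : D (stdVec 1) = D' (stdVec 1))
    (h3 : D (stdVec 3) = D' (stdVec 3)) : D = D' := by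
  have h4 : D (stdVec 4) = D' (stdVec 4) := by
    rw [← cross_stdVec_zero_three, hD, hD', h0, h3]
  refine clm_ext fun i => ?_
  fin_cases i
  · exact h0
  · exact h1
  · change D (stdVec 2) = D' (stdVec 2)
    rw [← cross_stdVec_zero_one, hD, hD', h0, h1]
  · exact h3
  · exact h4
  · change D (stdVec 5) = D' (stdVec 5)
    rw [← cross_stdVec_one_three, hD, hD', h1, h3]
  · change D (stdVec 6) = D' (stdVec 6)
    rw [← cross_stdVec_one_four, hD, hD', h1, h4]

theorem inner_stdVec_right (x : E7) (i : Fin 7) : inner ℝ x (stdVec i) = x i := by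
  simp [stdVec, EuclideanSpace.inner_single_right]

theorem inner_stdVec_left (x : E7) (i : Fin 7) : inner ℝ (stdVec i) x = x i := by
  rw [real_inner_comm, inner_stdVec_right]

/-- Skew-symmetric derivations of the cross product belong to the Lie algebra of `G₂`. -/
theorem g2Lie_g2Coord {D : E7 →L[ℝ] E7}
    (hD : ∀ x y, D (cross x y) = cross (D x) y + cross x (D y))
    (hs : ∀ x y, inner ℝ (D x) y + inner ℝ x (D y) = 0) : g2Lie (g2Coord D) = D := by
  have hs' : ∀ i j, D (stdVec i) j = -D (stdVec j) i := fun i j => by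
    have := hs (stdVec i) (stdVec j)
    rw [inner_stdVec_right, inner_stdVec_left] at this
    linarith
  have hd : ∀ i, D (stdVec i) i = 0 := fun i => by linarith [hs' i i]
  -- This matrix entry does not appear in `g2Coord`. The derivation rule for `e₂ = e₀ × e₁`
  -- expresses it by entries that do.
  have h32 : D (stdVec 2) 3 = D (stdVec 0) 5 - D (stdVec 1) 4 := by
    rw [← cross_stdVec_zero_one, hD]
    simp [cross_eq, stdVec_apply]
    ring
  refine derivation_ext (g2Lie_cross _) hD ?_ ?_ ?_
  · ext i
    fin_cases i <;> simp [g2Coord_apply, g2Lie_apply, g2Act, stdVec_apply, hd] <;> ring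
  · ext i
    have := hs' 0 1
    fin_cases i <;> simp [g2Coord_apply, g2Lie_apply, g2Act, stdVec_apply, hd] <;> linarith
  · ext i
    have := hs' 0 3
    have := hs' 1 3
    have := hs' 2 3
    fin_cases i <;> simp [g2Coord_apply, g2Lie_apply, g2Act, stdVec_apply, hd] <;> linarith

/-- The Lie bracket in coordinates. -/
def g2Bracket (κ η : G2Coord) : G2Coord :=
  match κ, η with
  | (x₁, x₂, x₃, μ₁, μ₂, a, b, c), (y₁, y₂, y₃, ν₁, ν₂, l, m, n) =>
    (-Complex.I * μ₁ * y₁ - y₂ * a - y₃ * b + Complex.I * ν₁ * x₁ + x₂ * l + x₃ * m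
        - 2 * Complex.I * (conj x₂ * conj y₃ - conj x₃ * conj y₂),
      y₁ * conj a - Complex.I * μ₂ * y₂ - y₃ * c - x₁ * conj l + Complex.I * ν₂ * x₂ + x₃ * n
        - 2 * Complex.I * (conj x₃ * conj y₁ - conj x₁ * conj y₃),
      y₁ * conj b + y₂ * conj c + Complex.I * (μ₁ + μ₂) * y₃ - x₁ * conj m - x₂ * conj n
        - Complex.I * (ν₁ + ν₂) * x₃ - 2 * Complex.I * (conj x₁ * conj y₂ - conj x₂ * conj y₁),
      (-3 * y₁ * conj x₁ + 3 * x₁ * conj y₁ - l * conj a - m * conj b + a * conj l + b * conj m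
        + (conj x₁ * y₁ + conj x₂ * y₂ + conj x₃ * y₃
          - conj y₁ * x₁ - conj y₂ * x₂ - conj y₃ * x₃)).im,
      (-3 * y₂ * conj x₂ + 3 * x₂ * conj y₂ - conj l * a - n * conj c + conj a * l + c * conj n
        + (conj x₁ * y₁ + conj x₂ * y₂ + conj x₃ * y₃
          - conj y₁ * x₁ - conj y₂ * x₂ - conj y₃ * x₃)).im,
      -3 * y₁ * conj x₂ + 3 * x₁ * conj y₂ + Complex.I * (ν₁ - ν₂) * a
        - Complex.I * (μ₁ - μ₂) * l - m * conj c + b * conj n,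
      -3 * y₁ * conj x₃ + 3 * x₁ * conj y₃ + Complex.I * (2 * ν₁ + ν₂) * b
        - Complex.I * (2 * μ₁ + μ₂) * m + l * c - a * n,
      -3 * y₂ * conj x₃ + 3 * x₂ * conj y₃ + Complex.I * (ν₁ + 2 * ν₂) * c
        - Complex.I * (μ₁ + 2 * μ₂) * n - conj l * b + conj a * m)

theorem g2Lie_bracket (κ η : G2Coord) :
    g2Lie κ * g2Lie η - g2Lie η * g2Lie κ = g2Lie (g2Bracket κ η) := by
  obtain ⟨x₁, x₂, x₃, μ₁, μ₂, a, b, c⟩ := κ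
  obtain ⟨y₁, y₂, y₃, ν₁, ν₂, l, m, n⟩ := η
  refine ContinuousLinearMap.ext fun v => ?_
  rw [sub_apply, clm_mul_apply,
    clm_mul_apply]
  simp only [g2Lie_apply]
  apply vec_ext <;> simp only [g2Act, g2Bracket, vec_apply, PiLp.sub_apply, Complex.add_re,
    Complex.add_im, Complex.sub_re, Complex.sub_im, Complex.mul_re, Complex.mul_im,
    Complex.neg_re, Complex.neg_im, Complex.conj_re, Complex.conj_im, Complex.I_re, Complex.I_im,
    Complex.ofReal_re, Complex.ofReal_im, Complex.re_ofNat, Complex.im_ofNat] <;> ring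

end G2Flow

namespace G2Flow

/-! ### `G₂`-frames -/

/-- The linear map with `e₀ ↦ u`, `e₁ ↦ p`, `e₃ ↦ q` that is compatible with the cross product
when `u, p, q` is a basic triple. -/
def frameMap (u p q : E7) : E7 →L[ℝ] E7 :=
  (EuclideanSpace.proj 0 : E7 →L[ℝ] ℝ).smulRight u +
    (EuclideanSpace.proj 1 : E7 →L[ℝ] ℝ).smulRight p +
    (EuclideanSpace.proj 2 : E7 →L[ℝ] ℝ).smulRight (cross u p) +
    (EuclideanSpace.proj 3 : E7 →L[ℝ] ℝ).smulRight q +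
    (EuclideanSpace.proj 4 : E7 →L[ℝ] ℝ).smulRight (cross u q) +
    (EuclideanSpace.proj 5 : E7 →L[ℝ] ℝ).smulRight (cross p q) +
    (EuclideanSpace.proj 6 : E7 →L[ℝ] ℝ).smulRight (-cross u (cross p q))

theorem frameMap_apply (u p q x : E7) : frameMap u p q x = x 0 • u + x 1 • p + x 2 • cross u p +
    x 3 • q + x 4 • cross u q + x 5 • cross p q + x 6 • -cross u (cross p q) := rfl

/-- An orthonormal triple with `a ⊥ b × c` multiplies like `e₀, e₁, e₃`. The full table of products
follows from `x × (x × y) = -y` for a unit vector `x ⊥ y` and from `x × (y × z) = -y × (x × z)` for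
orthogonal vectors; inner products reduce to this table by cyclicity of the triple product. -/
theorem isG2Map_frameMap {a b c : E7} (ha : inner ℝ a a = (1 : ℝ)) (hb : inner ℝ b b = (1 : ℝ))
    (hc : inner ℝ c c = (1 : ℝ)) (hab : inner ℝ a b = (0 : ℝ)) (hac : inner ℝ a c = (0 : ℝ))
    (hbc : inner ℝ b c = (0 : ℝ)) (habc : inner ℝ a (cross b c) = (0 : ℝ)) :
    IsG2Map (frameMap a b c) := by
  have hF := frameMap_apply a b c
  have hba : inner ℝ b a = (0 : ℝ) := by rw [real_inner_comm, hab]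
  have hca : inner ℝ c a = (0 : ℝ) := by rw [real_inner_comm, hac]
  have hcb : inner ℝ c b = (0 : ℝ) := by rw [real_inner_comm, hbc]
  have R1 : ∀ x y : E7, inner ℝ x x = (1 : ℝ) → inner ℝ x y = (0 : ℝ) →
      cross x (cross x y) = -y := fun x y hx hxy => by
    rw [cross_cross_self, hx, hxy, zero_smul, add_zero, neg_smul, one_smul]
  have R1' : ∀ x y : E7, inner ℝ x x = (1 : ℝ) → inner ℝ x y = (0 : ℝ) →
      cross x (cross y x) = y := fun x y hx hxy => by
    rw [cross_anticomm y, cross_neg_right, R1 x y hx hxy, neg_neg]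
  have R2 : ∀ x y z : E7, inner ℝ x y = (0 : ℝ) → inner ℝ x z = (0 : ℝ) →
      inner ℝ y z = (0 : ℝ) → cross x (cross y z) = -cross y (cross x z) := fun x y z h1 h2 h3 => by
    have := cross_cross_add x y z
    rw [h1, h2, h3] at this
    rw [eq_neg_iff_add_eq_zero, this]
    simp
  have cyc := inner_cross_cyclic
  -- The four products become opaque names, so that every entry of the multiplication table is a
  -- rewriting rule among the seven basis vectors and their negatives.
  obtain ⟨ab, hab'⟩ : ∃ v, v = cross a b := ⟨_, rfl⟩
  obtain ⟨ac, hac'⟩ : ∃ v, v = cross a c := ⟨_, rfl⟩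
  obtain ⟨bc, hbc'⟩ : ∃ v, v = cross b c := ⟨_, rfl⟩
  obtain ⟨d, hd'⟩ : ∃ v, v = cross a bc := ⟨_, rfl⟩
  rw [← hbc'] at habc
  simp only [← hab', ← hac', ← hbc', ← hd'] at hF
  have hba' : cross b a = -ab := by rw [hab', cross_anticomm]
  have hca' : cross c a = -ac := by rw [hac', cross_anticomm]
  have hcb' : cross c b = -bc := by rw [hbc', cross_anticomm]
  have bca : inner ℝ bc a = (0 : ℝ) := by rw [real_inner_comm, habc]
  have bcb : inner ℝ bc b = (0 : ℝ) := by rw [hbc', inner_cross_self_left]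
  have bbc : inner ℝ b bc = (0 : ℝ) := by rw [real_inner_comm, bcb]
  have bcc : inner ℝ bc c = (0 : ℝ) := by rw [hbc', inner_cross_self_right]
  have cbc : inner ℝ c bc = (0 : ℝ) := by rw [real_inner_comm, bcc]
  have aca : inner ℝ ac a = (0 : ℝ) := by rw [hac', inner_cross_self_left]
  have acb : inner ℝ ac b = (0 : ℝ) := by rw [hac', cyc, hcb', inner_neg_right, habc, neg_zero]
  have da : inner ℝ d a = (0 : ℝ) := by rw [hd', inner_cross_self_left]
  have a_ab : cross a ab = -b := by rw [hab', R1 a b ha hab]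
  have a_ac : cross a ac = -c := by rw [hac', R1 a c ha hac]
  have a_d : cross a d = -bc := by rw [hd', R1 a bc ha habc]
  have b_ab : cross b ab = a := by rw [hab', R1' b a hb hba]
  have b_bc : cross b bc = -c := by rw [hbc', R1 b c hb hbc]
  have b_ac : cross b ac = -d := by rw [hac', R2 b a c hba hbc hac, ← hbc', ← hd']
  have b_d : cross b d = ac := by
    rw [hd', R2 b a bc hba bbc habc, b_bc, cross_neg_right, neg_neg, ← hac']
  have c_ab : cross c ab = d := by
    rw [hab', R2 c a b hca hcb hab, hcb', cross_neg_right, neg_neg, ← hd']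
  have c_ac : cross c ac = a := by rw [hac', R1' c a hc hca]
  have c_bc : cross c bc = b := by rw [hbc', R1' c b hc hcb]
  have c_d : cross c d = -ab := by rw [hd', R2 c a bc hca cbc habc, c_bc, ← hab']
  have bc_b : cross bc b = c := by rw [cross_anticomm, b_bc, neg_neg]
  have bc_c : cross bc c = -b := by rw [cross_anticomm, c_bc]
  have ac_b : cross ac b = d := by rw [cross_anticomm, b_ac, neg_neg]
  have d_b : cross d b = -ac := by rw [cross_anticomm, b_d]
  have d_c : cross d c = ab := by rw [cross_anticomm, c_d, neg_neg]
  have db : inner ℝ d b = (0 : ℝ) := by rw [hd', cyc, bc_b, hac]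
  have dc : inner ℝ d c = (0 : ℝ) := by rw [hd', cyc, bc_c, inner_neg_right, hab, neg_zero]
  have bcbc : inner ℝ bc bc = (1 : ℝ) := by
    nth_rewrite 1 [hbc']; rw [cyc, c_bc, hb]
  have ac_ab : cross ac ab = bc := by
    rw [hab', R2 ac a b aca acb hab, ac_b, a_d, neg_neg]
  have bc_ab : cross bc ab = -ac := by rw [hab', R2 bc a b bca bcb hab, bc_b, ← hac']
  have d_ab : cross d ab = -c := by
    rw [hab', R2 d a b da db hab, d_b, cross_neg_right, neg_neg, a_ac]
  have bc_ac : cross bc ac = ab := by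
    rw [hac', R2 bc a c bca bcc hac, bc_c, cross_neg_right, neg_neg, ← hab']
  have d_ac : cross d ac = b := by rw [hac', R2 d a c da dc hac, d_c, a_ab, neg_neg]
  have bc_d : cross bc d = a := by rw [hd', R1' bc a bcbc bca]
  have ab_a : cross ab a = b := by rw [cross_anticomm, a_ab, neg_neg]
  have ac_a : cross ac a = c := by rw [cross_anticomm, a_ac, neg_neg]
  have bc_a : cross bc a = -d := by rw [hd', cross_anticomm]
  have d_a : cross d a = bc := by rw [cross_anticomm, a_d, neg_neg]
  have ab_b : cross ab b = -a := by rw [cross_anticomm, b_ab]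
  have ab_c : cross ab c = -d := by rw [cross_anticomm, c_ab]
  have ac_c : cross ac c = -a := by rw [cross_anticomm, c_ac]
  have ab_ac : cross ab ac = -bc := by rw [cross_anticomm, ac_ab]
  have ab_bc : cross ab bc = ac := by rw [cross_anticomm, bc_ab, neg_neg]
  have ab_d : cross ab d = c := by rw [cross_anticomm, d_ab, neg_neg]
  have ac_bc : cross ac bc = -ab := by rw [cross_anticomm, bc_ac]
  have ac_d : cross ac d = -b := by rw [cross_anticomm, d_ac]
  have d_bc : cross d bc = -a := by rw [cross_anticomm, bc_d]
  have iab : ∀ z, inner ℝ ab z = (inner ℝ a (cross b z) : ℝ) := fun z => by rw [hab', cyc]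
  have iac : ∀ z, inner ℝ ac z = (inner ℝ a (cross c z) : ℝ) := fun z => by rw [hac', cyc]
  have ibc : ∀ z, inner ℝ bc z = (inner ℝ b (cross c z) : ℝ) := fun z => by rw [hbc', cyc]
  have id' : ∀ z, inner ℝ d z = (inner ℝ a (cross bc z) : ℝ) := fun z => by rw [hd', cyc]
  have aab : inner ℝ a ab = (0 : ℝ) := by rw [real_inner_comm, hab', inner_cross_self_left]
  have aac : inner ℝ a ac = (0 : ℝ) := by rw [real_inner_comm, aca]
  have ad : inner ℝ a d = (0 : ℝ) := by rw [real_inner_comm, da]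
  have bab : inner ℝ b ab = (0 : ℝ) := by rw [real_inner_comm, hab', inner_cross_self_right]
  have bac : inner ℝ b ac = (0 : ℝ) := by rw [real_inner_comm, acb]
  have bd : inner ℝ b d = (0 : ℝ) := by rw [real_inner_comm, db]
  have cab : inner ℝ c ab = (0 : ℝ) := by
    rw [real_inner_comm, iab, ← hbc', habc]
  have cac : inner ℝ c ac = (0 : ℝ) := by rw [real_inner_comm, hac', inner_cross_self_right]
  have cd : inner ℝ c d = (0 : ℝ) := by rw [real_inner_comm, dc]
  constructor
  · intro x y
    rw [hF, hF, hF, cross_eq]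
    simp only [vec_apply, cross_add_left, cross_add_right, cross_smul_left, cross_smul_right,
      cross_neg_left, cross_neg_right, cross_self, ← hab', ← hac', ← hbc', ← hd', hba', hca', hcb',
      a_ab, a_ac, a_d, b_ab, b_bc, b_ac, b_d, c_ab, c_ac, c_bc, c_d, bc_b, bc_c, ac_b, d_b, d_c,
      ac_ab, bc_ab, d_ab, bc_ac, d_ac, bc_d, ab_a, ac_a, bc_a, d_a, ab_b, ab_c, ac_c, ab_ac, ab_bc,
      ab_d, ac_bc, ac_d, d_bc]
    module
  · intro x y
    rw [hF, hF, inner_eq x y]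
    simp only [inner_add_left, inner_add_right, inner_smul_left, inner_smul_right, inner_neg_left,
      inner_neg_right, iab, iac, ibc, id', ← hab', ← hac', ← hbc', ← hd', hba', hca', hcb',
      a_ab, a_ac, a_d, b_ab, b_bc, b_ac, b_d, c_ab, c_ac, c_bc, c_d, bc_b, bc_c,
      ac_ab, bc_ab, d_ab, bc_ac, d_ac, bc_d, bc_a, cross_self, inner_zero_right,
      ha, hb, hc, hab, hac, hbc, hba, hca, hcb, habc, bbc, cbc, aab, aac, ad, bab, bac, bd, cab,
      cac, cd, conj_trivial]
    ring

/-! ### Curves of `G₂`-frames -/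

variable {S : Set ℝ} {F : ℝ → E7 →L[ℝ] E7} {F' : E7 →L[ℝ] E7} {x : ℝ}

theorem HasDerivWithinAt.cross {v w : ℝ → E7} {v' w' : E7} (hv : HasDerivWithinAt v v' S x)
    (hw : HasDerivWithinAt w w' S x) :
    HasDerivWithinAt (fun s => cross (v s) (w s)) (cross v' (w x) + cross (v x) w') S x := by
  have := (crossL.hasFDerivAt (x := v x)).comp_hasDerivWithinAt x hv
  exact this.clm_apply hw

theorem hasDerivWithinAt_apply (hF : HasDerivWithinAt F F' S x) (v : E7) :
    HasDerivWithinAt (fun s => F s v) (F' v) S x := by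
  simpa using hF.clm_apply (hasDerivWithinAt_const x S v)

/-- The logarithmic derivative of a curve in `G₂` lies in the Lie algebra of `G₂`. -/
theorem IsG2Map.exists_g2Lie (hG : ∀ y ∈ S, IsG2Map (F y)) (hx : x ∈ S)
    (hS : UniqueDiffWithinAt ℝ S x) (hF : HasDerivWithinAt F F' S x) :
    F' = F x * g2Lie (g2Coord (ContinuousLinearMap.adjoint (F x) * F')) := by
  -- Differentiating the two identities that define `IsG2Map` and cancelling `F x` shows that `D` is
  -- a skew-symmetric derivation, hence in the image of `g2Lie`.
  set D := ContinuousLinearMap.adjoint (F x) * F' with hD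
  have hFD : F' = F x * D := by rw [hD, ← mul_assoc, (hG x hx).mul_adjoint, one_mul]
  clear_value D
  have hinj : Function.Injective (F x) := (hG x hx).equiv.injective
  have hap := fun v => hasDerivWithinAt_apply hF v
  rw [g2Lie_g2Coord (D := D)]
  · exact hFD
  · intro v w
    have h1 := hap (cross v w)
    have h2 : HasDerivWithinAt (fun s => F s (G2Flow.cross v w))
        (cross (F' v) (F x w) + cross (F x v) (F' w)) S x :=
      (HasDerivWithinAt.cross (hap v) (hap w)).congr (fun y hy => (hG y hy).1 v w)
        ((hG x hx).1 v w)
    have h3 := hS.eq_deriv S h1 h2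
    apply hinj
    rw [map_add, (hG x hx).1, (hG x hx).1, ← clm_mul_apply, ← clm_mul_apply, ← clm_mul_apply,
      ← hFD, h3]
  · intro v w
    have h1 := (hap v).inner ℝ (hap w)
    have h2 : HasDerivWithinAt (fun s => inner ℝ (F s v) (F s w) : ℝ → ℝ) 0 S x :=
      (hasDerivWithinAt_const x S (inner ℝ v w)).congr (fun y hy => (hG y hy).2 v w)
        ((hG x hx).2 v w)
    have h3 := hS.eq_deriv S h1 h2
    rw [hFD, clm_mul_apply, clm_mul_apply, (hG x hx).2, (hG x hx).2] at h3
    linarith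

end G2Flow

namespace G2Flow

/-! ### Smooth families of `G₂`-frames and the structure equations -/

section Frames

variable {T : Set ℝ} {F : ℝ → ℝ → E7 →L[ℝ] E7} {κ η : ℝ → ℝ → G2Coord} {t s : ℝ}

/-- A smooth `G₂`-frame field on `T × ℝ` with logarithmic derivatives `κ` in space, `η` in time. -/
structure IsFrame (T : Set ℝ) (F : ℝ → ℝ → E7 →L[ℝ] E7) (κ η : ℝ → ℝ → G2Coord) : Prop where
  smooth : SmoothOn T F
  smooth_space : SmoothOn T κ
  smooth_time : SmoothOn T η
  isG2Map : ∀ t ∈ T, ∀ s, IsG2Map (F t s)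
  space : ∀ t ∈ T, ∀ s, HasDerivAt (F t) (F t s * g2Lie (κ t s)) s
  time : ∀ t ∈ T, ∀ s, HasDerivWithinAt (fun τ => F τ s) (F t s * g2Lie (η t s)) T t

/-- The adjoint on endomorphisms of `ℝ⁷`, as a real linear map. -/
def adjointL : (E7 →L[ℝ] E7) →L[ℝ] E7 →L[ℝ] E7 :=
  LinearMap.toContinuousLinearMap
    { toFun := fun F => ContinuousLinearMap.adjoint F
      map_add' := fun F G => map_add _ F G
      map_smul' := fun c F => by simp }

theorem adjointL_apply (F : E7 →L[ℝ] E7) : adjointL F = ContinuousLinearMap.adjoint F := rfl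

theorem adjoint_g2Lie (κ : G2Coord) : ContinuousLinearMap.adjoint (g2Lie κ) = -g2Lie κ := by
  refine ContinuousLinearMap.ext fun x => ext_inner_right ℝ fun y => ?_
  rw [ContinuousLinearMap.adjoint_inner_left, neg_apply, inner_neg_left]
  linarith [g2Lie_inner κ x y]

theorem adjoint_mul_g2Lie (F : E7 →L[ℝ] E7) (κ : G2Coord) (x : E7) :
    adjointL (F * g2Lie κ) x = -g2Lie κ (adjointL F x) := by
  have : ContinuousLinearMap.adjoint (F * g2Lie κ) =
      ContinuousLinearMap.adjoint (g2Lie κ) * ContinuousLinearMap.adjoint F :=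
    ContinuousLinearMap.adjoint_comp F (g2Lie κ)
  rw [adjointL_apply, adjointL_apply, this, adjoint_g2Lie]
  rfl

theorem SmoothOn.clm_comp {E E' : Type} [NormedAddCommGroup E] [NormedSpace ℝ E]
    [NormedAddCommGroup E'] [NormedSpace ℝ E'] (L : E →L[ℝ] E') {f : ℝ → ℝ → E}
    (hf : SmoothOn T f) : SmoothOn T (fun t s => L (f t s)) :=
  L.contDiff.comp_contDiffOn hf

theorem exists_isFrame (hT : TimeInterval T) (hF : SmoothOn T F)
    (hG : ∀ t ∈ T, ∀ s, IsG2Map (F t s)) : ∃ κ η, IsFrame T F κ η := by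
  refine ⟨fun t s => g2Coord (adjointL (F t s) * deriv (F t) s),
    fun t s => g2Coord (adjointL (F t s) * timeDeriv T F t s), hF, ?_, ?_, hG, ?_, ?_⟩
  · exact SmoothOn.clm_comp g2Coord (ContDiffOn.mul (hF.clm_comp adjointL) (hF.deriv hT))
  · exact SmoothOn.clm_comp g2Coord (ContDiffOn.mul (hF.clm_comp adjointL) (hF.timeDeriv hT))
  · intro t ht s
    have h1 := hF.hasDerivAt ht s
    have h2 := IsG2Map.exists_g2Lie (S := univ) (fun s _ => hG t ht s) (mem_univ s)
      uniqueDiffWithinAt_univ h1.hasDerivWithinAt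
    rw [h2] at h1
    exact h1
  · intro t ht s
    have h1 := hF.hasDerivWithinAt ht s
    have h2 := IsG2Map.exists_g2Lie (fun τ hτ => hG τ hτ s) ht (hT.uniqueDiffOn t ht) h1
    rw [h2] at h1
    exact h1

theorem SmoothOn.hasDerivAt_clm {E E' : Type} [NormedAddCommGroup E] [NormedSpace ℝ E]
    [NormedAddCommGroup E'] [NormedSpace ℝ E'] (L : E →L[ℝ] E') {f : ℝ → ℝ → E}
    (hf : SmoothOn T f) (ht : t ∈ T) (s : ℝ) :
    HasDerivAt (fun s => L (f t s)) (L (_root_.deriv (f t) s)) s :=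
  L.hasFDerivAt.comp_hasDerivAt s (hf.hasDerivAt ht s)

theorem SmoothOn.hasDerivWithinAt_clm {E E' : Type} [NormedAddCommGroup E] [NormedSpace ℝ E]
    [NormedAddCommGroup E'] [NormedSpace ℝ E'] (L : E →L[ℝ] E') {f : ℝ → ℝ → E}
    (hf : SmoothOn T f) (ht : t ∈ T) (s : ℝ) :
    HasDerivWithinAt (fun τ => L (f τ s)) (L (G2Flow.timeDeriv T f t s)) T t :=
  L.hasFDerivAt.comp_hasDerivWithinAt t (hf.hasDerivWithinAt ht s)

/-- The structure equation of a frame. -/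
theorem IsFrame.zero_curvature (hT : TimeInterval T) (h : IsFrame T F κ η) (ht : t ∈ T) (s : ℝ) :
    timeDeriv T κ t s - deriv (η t) s = g2Bracket (κ t s) (η t s) := by
  have h1 := h.smooth.timeDeriv_deriv hT ht s
  have e1 : timeDeriv T (fun t s => deriv (F t) s) t s =
      F t s * g2Lie (η t s) * g2Lie (κ t s) + F t s * g2Lie (timeDeriv T κ t s) := by
    rw [timeDeriv_congr (fun t ht s => (h.space t ht s).deriv) ht s]
    exact timeDeriv_of_hasDerivWithinAt hT ht
      ((h.time t ht s).mul (h.smooth_space.hasDerivWithinAt_clm g2Lie ht s))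
  have e2 : deriv (timeDeriv T F t) s =
      F t s * g2Lie (κ t s) * g2Lie (η t s) + F t s * g2Lie (deriv (η t) s) := by
    have : timeDeriv T F t = fun s => F t s * g2Lie (η t s) :=
      funext fun s => timeDeriv_of_hasDerivWithinAt hT ht (h.time t ht s)
    rw [this]
    exact ((h.space t ht s).mul (h.smooth_time.hasDerivAt_clm g2Lie ht s)).deriv
  -- Equality of the mixed derivatives has become `F (η κ + κ_t) = F (κ η + η_s)`, with `κ, η` read
  -- as endomorphisms. Multiplication by the adjoint removes `F`.
  rw [e1, e2, mul_assoc, mul_assoc, ← mul_add, ← mul_add] at h1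
  have h2 := congrArg (ContinuousLinearMap.adjoint (F t s) * ·) h1
  simp only [← mul_assoc, (h.isG2Map t ht s).adjoint_mul, one_mul] at h2
  apply g2Lie_injective
  rw [← g2Lie_bracket, map_sub, sub_eq_sub_iff_add_eq_add, add_comm, h2, add_comm]

/-- Agreement at the origin spreads along `s = 0` by the time equation, and from there along each
line of constant time by the space equation. -/
theorem eqOn_of_linear_ode {V : Type} [NormedAddCommGroup V] [NormedSpace ℝ V]
    (hT : TimeInterval T) {k l : ℝ → ℝ → V →L[ℝ] V}
    (hk : ContinuousOn (fun p : ℝ × ℝ => k p.1 p.2) (T ×ˢ univ))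
    (hl : ContinuousOn (fun p : ℝ × ℝ => l p.1 p.2) (T ×ˢ univ)) {y z : ℝ → ℝ → V}
    (hy : ∀ t ∈ T, ∀ s, HasDerivAt (y t) (k t s (y t s)) s)
    (hy' : ∀ t ∈ T, ∀ s, HasDerivWithinAt (fun τ => y τ s) (l t s (y t s)) T t)
    (hz : ∀ t ∈ T, ∀ s, HasDerivAt (z t) (k t s (z t s)) s)
    (hz' : ∀ t ∈ T, ∀ s, HasDerivWithinAt (fun τ => z τ s) (l t s (z t s)) T t)
    (h0 : y 0 0 = z 0 0) : ∀ t ∈ T, ∀ s, y t s = z t s := by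
  have h1 : ∀ t ∈ T, y t 0 - z t 0 = 0 := fun t ht =>
    ode_eq_zero hT (k := fun t => l t 0) (hl.comp (f := fun t : ℝ => ((t, 0) : ℝ × ℝ))
      (by fun_prop) fun _ ht => ⟨ht, mem_univ _⟩) (y := fun t => y t 0 - z t 0)
      (fun t ht => by rw [map_sub]; exact (hy' t ht 0).sub (hz' t ht 0)) (by simp [h0]) ht
  intro t ht s
  refine sub_eq_zero.1 (ode_eq_zero TimeInterval.univ (k := k t) (hk.comp
    (f := fun s : ℝ => ((t, s) : ℝ × ℝ)) (by fun_prop) fun _ _ => ⟨ht, mem_univ _⟩)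
    (y := fun s => y t s - z t s) (fun s _ => ?_) (h1 t ht) (mem_univ s))
  rw [map_sub]
  exact ((hy t ht s).sub (hz t ht s)).hasDerivWithinAt

set_option synthInstance.maxHeartbeats 100000 in
/-- The fundamental theorem for `G₂`-frames: solutions of the structure equation come from
frames. -/
theorem exists_isFrame_of_zero_curvature (hT : TimeInterval T) (hκ : SmoothOn T κ)
    (hη : SmoothOn T η) (h : ∀ t ∈ T, ∀ s,
      timeDeriv T κ t s - deriv (η t) s = g2Bracket (κ t s) (η t s)) :
    ∃ F, F 0 0 = 1 ∧ IsFrame T F κ η := by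
  obtain ⟨F, h0, hF, hs, ht'⟩ := exists_parallel_frame hT (K := fun t s => g2Lie (κ t s))
    (N := fun t s => g2Lie (η t s)) (hκ.clm_comp g2Lie) (hη.clm_comp g2Lie) (by
      intro t ht s
      rw [timeDeriv_of_hasDerivWithinAt hT ht (hκ.hasDerivWithinAt_clm g2Lie ht s),
        (hη.hasDerivAt_clm g2Lie ht s).deriv, add_comm, ← sub_eq_zero]
      have := congrArg g2Lie (h t ht s)
      rw [← g2Lie_bracket, map_sub] at this
      rw [← sub_eq_zero] at this
      rw [← this]
      abel)
  refine ⟨F, h0, hF, hκ, hη, ?_, hs, ht'⟩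
  -- The `G₂` property is shown for the adjoint. For fixed `x` the vector `F* x` solves linear
  -- equations with coefficients `-κ, -η`. Elements of the Lie algebra act as derivations, so the
  -- cross product of two such solutions is again a solution; they are skew, so inner products of
  -- solutions are constant.
  have hcK : ∀ {μ : ℝ → ℝ → G2Coord}, SmoothOn T μ →
      ContinuousOn (fun p : ℝ × ℝ => -g2Lie (μ p.1 p.2)) (T ×ˢ univ) := fun hμ =>
    (g2Lie.continuous.comp_continuousOn hμ.continuousOn).neg
  have ds : ∀ x : E7, ∀ t ∈ T, ∀ s, HasDerivAt (fun s => adjointL (F t s) x)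
      (-g2Lie (κ t s) (adjointL (F t s) x)) s := fun x t ht s => by
    rw [← adjoint_mul_g2Lie]
    have := (adjointL.hasFDerivAt.comp_hasDerivAt s (hs t ht s)).clm_apply (hasDerivAt_const s x)
    simpa using this
  have dt : ∀ x : E7, ∀ t ∈ T, ∀ s, HasDerivWithinAt (fun τ => adjointL (F τ s) x)
      (-g2Lie (η t s) (adjointL (F t s) x)) T t := fun x t ht s => by
    rw [← adjoint_mul_g2Lie]
    have := (adjointL.hasFDerivAt.comp_hasDerivWithinAt t (ht' t ht s)).clm_apply
      (hasDerivWithinAt_const t T x)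
    simpa using this
  have hA0 : ∀ x, adjointL (F 0 0) x = x := fun x => by
    rw [h0, adjointL_apply]
    have : ContinuousLinearMap.adjoint (1 : E7 →L[ℝ] E7) = 1 := by
      rw [← ContinuousLinearMap.star_eq_adjoint, star_one]
    rw [this]; rfl
  have hcross : ∀ x y : E7, ∀ t ∈ T, ∀ s, cross (adjointL (F t s) x) (adjointL (F t s) y) =
      adjointL (F t s) (cross x y) := by
    intro x y
    refine eqOn_of_linear_ode hT (k := fun t s => -g2Lie (κ t s)) (l := fun t s => -g2Lie (η t s))
      (hcK hκ) (hcK hη) ?_ ?_ (ds _) (dt _) (by rw [hA0, hA0, hA0])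
    · intro t ht s
      have := HasDerivWithinAt.cross (ds x t ht s).hasDerivWithinAt
        (ds y t ht s).hasDerivWithinAt (S := univ)
      rw [hasDerivWithinAt_univ] at this
      refine this.congr_deriv ?_
      rw [neg_apply, g2Lie_cross, cross_neg_left, cross_neg_right, neg_add]
    · intro t ht s
      have := HasDerivWithinAt.cross (dt x t ht s) (dt y t ht s)
      refine this.congr_deriv ?_
      rw [neg_apply, g2Lie_cross, cross_neg_left, cross_neg_right, neg_add]
  have hinner : ∀ x y : E7, ∀ t ∈ T, ∀ s, inner ℝ (adjointL (F t s) x) (adjointL (F t s) y) =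
      (inner ℝ x y : ℝ) := by
    intro x y
    refine eqOn_of_linear_ode hT (k := fun t s => 0) (l := fun t s => 0) continuousOn_const
      continuousOn_const ?_ ?_ (fun t _ s => hasDerivAt_const s (inner ℝ x y))
      (fun t _ s => hasDerivWithinAt_const t T (inner ℝ x y)) (by rw [hA0, hA0])
    · intro t ht s
      have := (ds x t ht s).inner ℝ (ds y t ht s)
      refine this.congr_deriv ?_
      rw [inner_neg_left, inner_neg_right, zero_apply]
      linarith [g2Lie_inner (κ t s) (adjointL (F t s) x) (adjointL (F t s) y)]
    · intro t ht s
      have := (dt x t ht s).inner ℝ (dt y t ht s)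
      refine this.congr_deriv ?_
      rw [inner_neg_left, inner_neg_right, zero_apply]
      linarith [g2Lie_inner (η t s) (adjointL (F t s) x) (adjointL (F t s) y)]
  intro t ht s
  have : IsG2Map (adjointL (F t s)) := ⟨fun x y => (hcross x y t ht s).symm,
    fun x y => hinner x y t ht s⟩
  have h2 := this.adjoint
  rwa [adjointL_apply, ContinuousLinearMap.adjoint_adjoint] at h2

/-- Frames with the same logarithmic derivatives differ by an element of `G₂`. -/
theorem IsFrame.exists_isG2Map (hT : TimeInterval T) (h : IsFrame T F κ η)
    {F' : ℝ → ℝ → E7 →L[ℝ] E7} {κ' η' : ℝ → ℝ → G2Coord} (h' : IsFrame T F' κ' η')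
    (hκ : ∀ t ∈ T, ∀ s, κ' t s = κ t s) (hη : ∀ t ∈ T, ∀ s, η' t s = η t s) :
    ∃ g, IsG2Map g ∧ ∀ t ∈ T, ∀ s, F' t s = g * F t s := by
  have g0 := h.isG2Map 0 hT.zero_mem 0
  refine ⟨F' 0 0 * ContinuousLinearMap.adjoint (F 0 0),
    (h'.isG2Map 0 hT.zero_mem 0).mul g0.adjoint, ?_⟩
  have hc : ∀ {μ : ℝ → ℝ → G2Coord}, SmoothOn T μ → ContinuousOn (fun p : ℝ × ℝ =>
      (ContinuousLinearMap.compL ℝ E7 E7 E7).flip (g2Lie (μ p.1 p.2))) (T ×ˢ univ) := fun hμ =>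
    ((ContinuousLinearMap.compL ℝ E7 E7 E7).flip.continuous.comp g2Lie.continuous
      ).comp_continuousOn hμ.continuousOn
  -- The equations act on the frame by multiplication from the right, so a constant factor on the
  -- left preserves them. The constant is the one that matches the two frames at the origin.
  refine eqOn_of_linear_ode hT
    (k := fun t s => (ContinuousLinearMap.compL ℝ E7 E7 E7).flip (g2Lie (κ t s)))
    (l := fun t s => (ContinuousLinearMap.compL ℝ E7 E7 E7).flip (g2Lie (η t s)))
    (hc h.smooth_space) (hc h.smooth_time) ?_ ?_ ?_ ?_ ?_
  · intro t ht s
    have := h'.space t ht s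
    rwa [hκ t ht s] at this
  · intro t ht s
    have := h'.time t ht s
    rwa [hη t ht s] at this
  · intro t ht s
    have := (h.space t ht s).const_mul (F' 0 0 * ContinuousLinearMap.adjoint (F 0 0))
    rw [← mul_assoc] at this
    exact this
  · intro t ht s
    have := (h.time t ht s).const_mul (F' 0 0 * ContinuousLinearMap.adjoint (F 0 0))
    rw [← mul_assoc] at this
    exact this
  · rw [mul_assoc, g0.adjoint_mul, mul_one]

end Frames

end G2Flow

namespace G2Flow

/-! ### Rotations of frames by the maximal torus -/

/-- The element of the maximal torus of `G₂` given by two unit complex numbers. -/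
def rotMap (z w : ℂ) : E7 →L[ℝ] E7 :=
  frameMap (stdVec 0) (z.re • stdVec 1 + z.im • stdVec 2) (w.re • stdVec 3 + w.im • stdVec 4)

theorem rotMap_apply (z w : ℂ) (x : E7) : rotMap z w x = !₂[x 0, z.re * x 1 - z.im * x 2,
    z.im * x 1 + z.re * x 2, w.re * x 3 - w.im * x 4, w.im * x 3 + w.re * x 4,
    (z * w).re * x 5 - (z * w).im * x 6, (z * w).im * x 5 + (z * w).re * x 6] := by
  rw [rotMap, frameMap_apply]
  ext i
  fin_cases i <;> simp [cross_eq, stdVec_apply] <;> ring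

theorem isG2Map_rotMap {z w : ℂ} (hz : z.re ^ 2 + z.im ^ 2 = 1) (hw : w.re ^ 2 + w.im ^ 2 = 1) :
    IsG2Map (rotMap z w) := by
  apply isG2Map_frameMap <;> simp only [inner_eq, cross_eq, vec_apply, PiLp.add_apply,
    PiLp.smul_apply, smul_eq_mul, stdVec_apply, reduceIte, Fin.reduceEq, mul_zero, mul_one,
    zero_mul, add_zero, zero_add, neg_zero, sub_zero] <;> linarith

/-- The adjoint action of the maximal torus on the Lie algebra of `G₂`. -/
def rotCoord (z w : ℂ) (κ : G2Coord) : G2Coord :=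
  match κ with
  | (x₁, x₂, x₃, ν₁, ν₂, a, b, c) => (x₁ * z, x₂ * w, x₃ * conj (z * w), ν₁, ν₂, a * (z * conj w),
      b * (z ^ 2 * w), c * (z * w ^ 2))

-- Conjugation by an element of `G₂` turns derivations into derivations, so the formula for the
-- conjugate need only be checked on the generators `e₀, e₁, e₃`.
set_option maxHeartbeats 1000000 in
theorem g2Lie_mul_rotMap {z w : ℂ} (hz : z.re ^ 2 + z.im ^ 2 = 1) (hw : w.re ^ 2 + w.im ^ 2 = 1)
    (κ : G2Coord) : g2Lie κ * rotMap z w = rotMap z w * g2Lie (rotCoord z w κ) := by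
  have hR := isG2Map_rotMap hz hw
  have key : ContinuousLinearMap.adjoint (rotMap z w) * (g2Lie κ * rotMap z w) =
      g2Lie (rotCoord z w κ) := by
    have e : ∀ x y, g2Lie κ (rotMap z w x) = rotMap z w y →
        (ContinuousLinearMap.adjoint (rotMap z w) * (g2Lie κ * rotMap z w)) x = y := fun x y h => by
      rw [clm_mul_apply, clm_mul_apply, h, ← clm_mul_apply, hR.adjoint_mul]; rfl
    refine derivation_ext (fun x y => ?_) (g2Lie_cross _) (e _ _ ?_) (e _ _ ?_) (e _ _ ?_)
    · simp only [clm_mul_apply]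
      rw [hR.1, g2Lie_cross, map_add, hR.adjoint.1, hR.adjoint.1]
      simp only [← clm_mul_apply, hR.adjoint_mul]
      rfl
    all_goals
      clear e hR
      obtain ⟨x₁, x₂, x₃, ν₁, ν₂, a, b, c⟩ := κ
      obtain ⟨z, z'⟩ := z
      obtain ⟨w, w'⟩ := w
      simp only at hz hw
      rw [rotMap_apply, rotMap_apply]
      apply vec_ext <;> simp only [rotCoord, g2Lie_apply, g2Act, vec_apply, stdVec_apply, pow_two,
        reduceIte, Fin.reduceEq, Fin.isValue, mul_zero, mul_one, zero_mul, add_zero, zero_add,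
        neg_zero, sub_zero, Complex.mul_re, Complex.mul_im, Complex.conj_re,
        Complex.conj_im] <;> grind
  rw [← key, ← mul_assoc, hR.mul_adjoint, one_mul]

variable {T : Set ℝ} {F R : ℝ → ℝ → E7 →L[ℝ] E7} {κ η : ℝ → ℝ → G2Coord} {t s : ℝ}

theorem SmoothOn.cross {u v : ℝ → ℝ → E7} (hu : SmoothOn T u) (hv : SmoothOn T v) :
    SmoothOn T (fun t s => cross (u t s) (v t s)) :=
  ContDiffOn.clm_apply (hu.clm_comp crossL) hv

theorem SmoothOn.frameMap {u p q : ℝ → ℝ → E7} (hu : SmoothOn T u) (hp : SmoothOn T p)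
    (hq : SmoothOn T q) : SmoothOn T (fun t s => frameMap (u t s) (p t s) (q t s)) := by
  have h : ∀ (i : Fin 7) {v : ℝ → ℝ → E7}, SmoothOn T v → SmoothOn T
      (fun t s => (EuclideanSpace.proj i : E7 →L[ℝ] ℝ).smulRight (v t s)) := fun i v hv =>
    ContDiffOn.smulRight contDiffOn_const hv
  exact ((((((h 0 hu).add (h 1 hp)).add (h 2 (hu.cross hp))).add (h 3 hq)).add
    (h 4 (hu.cross hq))).add (h 5 (hp.cross hq))).add
    (h 6 (v := fun t s =>
      -G2Flow.cross (u t s) (G2Flow.cross (p t s) (q t s)))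
      (hu.cross (hp.cross hq)).neg)

/-- The gauge transformation `(F R)⁻¹ d(F R) = R⁻¹ (F⁻¹ dF) R + R⁻¹ dR`, where `κ'', η''` are the
conjugated coordinates. -/
theorem IsFrame.mul (h : IsFrame T F κ η) {κ' η' κ'' η'' : ℝ → ℝ → G2Coord}
    (hR : IsFrame T R κ' η') (hκ : SmoothOn T κ'') (hη : SmoothOn T η'')
    (h1 : ∀ t ∈ T, ∀ s, g2Lie (κ t s) * R t s = R t s * g2Lie (κ'' t s))
    (h2 : ∀ t ∈ T, ∀ s, g2Lie (η t s) * R t s = R t s * g2Lie (η'' t s)) :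
    IsFrame T (fun t s => F t s * R t s) (fun t s => κ'' t s + κ' t s)
      (fun t s => η'' t s + η' t s) where
  smooth := ContDiffOn.mul h.smooth hR.smooth
  smooth_space := ContDiffOn.add hκ hR.smooth_space
  smooth_time := ContDiffOn.add hη hR.smooth_time
  isG2Map t ht s := (h.isG2Map t ht s).mul (hR.isG2Map t ht s)
  space t ht s := by
    refine ((h.space t ht s).mul (hR.space t ht s)).congr_deriv ?_
    rw [mul_assoc, h1 t ht s, map_add]
    simp only [mul_add, mul_assoc]
  time t ht s := by
    refine ((h.time t ht s).mul (hR.time t ht s)).congr_deriv ?_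
    rw [mul_assoc, h2 t ht s, map_add]
    simp only [mul_add, mul_assoc]

theorem eq_of_g2Lie_torus {κ : G2Coord} {a b : ℝ} (h0 : g2Lie κ (stdVec 0) = 0)
    (h1 : g2Lie κ (stdVec 1) = a • stdVec 2) (h3 : g2Lie κ (stdVec 3) = b • stdVec 4) :
    κ = (0, 0, 0, a, b, 0, 0, 0) := by
  rw [← g2Coord_g2Lie κ, g2Coord_apply, h0, h1, h3]
  simp [stdVec_apply, Complex.ext_iff]

/-- The unit complex number `exp (√-1 θ)`. -/
def cis (θ : ℝ) : ℂ := ⟨Real.cos θ, Real.sin θ⟩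

theorem cis_eq (θ : ℝ) : cis θ = Complex.exp (θ * Complex.I) := by
  rw [Complex.exp_mul_I]
  apply Complex.ext <;> simp [cis, ← Complex.ofReal_cos, ← Complex.ofReal_sin]

theorem normSq_cis (θ : ℝ) : (cis θ).re ^ 2 + (cis θ).im ^ 2 = 1 := Real.cos_sq_add_sin_sq θ

theorem isFrame_rotMap (hT : TimeInterval T) {θ φ : ℝ → ℝ → ℝ} (hθ : SmoothOn T θ)
    (hφ : SmoothOn T φ) : IsFrame T (fun t s => rotMap (cis (θ t s)) (cis (φ t s)))
      (fun t s => (0, 0, 0, deriv (θ t) s, deriv (φ t) s, 0, 0, 0))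
      (fun t s => (0, 0, 0, timeDeriv T θ t s, timeDeriv T φ t s, 0, 0, 0)) := by
  have hc : ∀ {θ : ℝ → ℝ → ℝ} (i j : Fin 7), SmoothOn T θ → SmoothOn T (fun t s =>
      (cis (θ t s)).re • stdVec i + (cis (θ t s)).im • stdVec j) := fun i j hθ =>
    ((Real.contDiff_cos.comp_contDiffOn hθ).smul contDiffOn_const).add
      ((Real.contDiff_sin.comp_contDiffOn hθ).smul contDiffOn_const)
  have hsm : SmoothOn T (fun t s => rotMap (cis (θ t s)) (cis (φ t s))) :=
    SmoothOn.frameMap contDiffOn_const (hc 1 2 hθ) (hc 3 4 hφ)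
  have hG : ∀ t ∈ T, ∀ s, IsG2Map (rotMap (cis (θ t s)) (cis (φ t s))) := fun t _ s =>
    isG2Map_rotMap (normSq_cis _) (normSq_cis _)
  obtain ⟨κ, η, h⟩ := exists_isFrame hT hsm hG
  have r0 : ∀ z w : ℂ, rotMap z w (stdVec 0) = stdVec 0 := fun z w => by
    rw [rotMap_apply]; ext i; fin_cases i <;> simp [stdVec_apply]
  have r1 : ∀ z w : ℂ, rotMap z w (stdVec 1) = z.re • stdVec 1 + z.im • stdVec 2 := fun z w => by
    rw [rotMap_apply]; ext i; fin_cases i <;> simp [stdVec_apply]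
  have r2 : ∀ z w : ℂ, rotMap z w (stdVec 2) = -z.im • stdVec 1 + z.re • stdVec 2 := fun z w => by
    rw [rotMap_apply]; ext i; fin_cases i <;> simp [stdVec_apply]
  have r3 : ∀ z w : ℂ, rotMap z w (stdVec 3) = w.re • stdVec 3 + w.im • stdVec 4 := fun z w => by
    rw [rotMap_apply]; ext i; fin_cases i <;> simp [stdVec_apply]
  have r4 : ∀ z w : ℂ, rotMap z w (stdVec 4) = -w.im • stdVec 3 + w.re • stdVec 4 := fun z w => by
    rw [rotMap_apply]; ext i; fin_cases i <;> simp [stdVec_apply]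
  -- One computation serves both variables, with `S` the whole line for the space derivative and `S
  -- = T` for the time derivative. It is enough to differentiate the images of `e₀, e₁, e₃`.
  have main : ∀ (S : Set ℝ) (x : ℝ) (a b : ℝ → ℝ) (a' b' : ℝ) (μ : G2Coord), x ∈ S →
      UniqueDiffWithinAt ℝ S x → HasDerivWithinAt a a' S x → HasDerivWithinAt b b' S x →
      HasDerivWithinAt (fun y => rotMap (cis (a y)) (cis (b y)))
        (rotMap (cis (a x)) (cis (b x)) * g2Lie μ) S x → μ = (0, 0, 0, a', b', 0, 0, 0) := by
    intro S x a b a' b' μ hx hS ha hb hμ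
    have hR := isG2Map_rotMap (normSq_cis (a x)) (normSq_cis (b x))
    have inj : ∀ v w, rotMap (cis (a x)) (cis (b x)) v = rotMap (cis (a x)) (cis (b x)) w →
        v = w := fun v w h => hR.equiv.injective h
    have hv := fun i => hasDerivWithinAt_apply hμ (stdVec i)
    simp only [clm_mul_apply] at hv
    have hv0 := hv 0
    have hv1 := hv 1
    have hv3 := hv 3
    simp only [r0, r1, r3, cis] at hv0 hv1 hv3
    refine eq_of_g2Lie_torus (inj _ _ ?_) (inj _ _ ?_) (inj _ _ ?_)
    · rw [map_zero]
      exact hS.eq_deriv _ hv0 (hasDerivWithinAt_const _ _ _)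
    · rw [map_smul, r2]
      refine (hS.eq_deriv _ hv1 ((ha.cos.smul_const (stdVec 1)).add
        (ha.sin.smul_const (stdVec 2)))).trans ?_
      simp only [cis, smul_add, smul_smul]
      congr 2 <;> ring
    · rw [map_smul, r4]
      refine (hS.eq_deriv _ hv3 ((hb.cos.smul_const (stdVec 3)).add
        (hb.sin.smul_const (stdVec 4)))).trans ?_
      simp only [cis, smul_add, smul_smul]
      congr 2 <;> ring
  have eκ : ∀ t ∈ T, ∀ s, κ t s = (0, 0, 0, deriv (θ t) s, deriv (φ t) s, 0, 0, 0) :=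
    fun t ht s => main univ s (θ t) (φ t) _ _ _ (mem_univ _) uniqueDiffWithinAt_univ
      (hθ.hasDerivAt ht s).hasDerivWithinAt (hφ.hasDerivAt ht s).hasDerivWithinAt
      (h.space t ht s).hasDerivWithinAt
  have eη : ∀ t ∈ T, ∀ s, η t s =
      (0, 0, 0, timeDeriv T θ t s, timeDeriv T φ t s, 0, 0, 0) :=
    fun t ht s => main T t (fun τ => θ τ s) (fun τ => φ τ s) _ _ _ ht (hT.uniqueDiffOn t ht)
      (hθ.hasDerivWithinAt ht s) (hφ.hasDerivWithinAt ht s) (h.time t ht s)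
  exact ⟨hsm, h.smooth_space.congr fun t ht s => (eκ t ht s).symm,
    h.smooth_time.congr fun t ht s => (eη t ht s).symm, hG,
    fun t ht s => by rw [← eκ t ht s]; exact h.space t ht s,
    fun t ht s => by rw [← eη t ht s]; exact h.time t ht s⟩

theorem contDiff_cis : ContDiff ℝ ∞ cis := by
  have : cis = fun θ : ℝ => Complex.exp (θ * Complex.I) := funext cis_eq
  rw [this]
  exact (Complex.contDiff_exp (𝕜 := ℝ)).comp ((Complex.ofRealCLM.contDiff).mul contDiff_const)

theorem SmoothOn.cis {θ : ℝ → ℝ → ℝ} (hθ : SmoothOn T θ) : SmoothOn T (fun t s => cis (θ t s)) :=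
  contDiff_cis.comp_contDiffOn hθ

theorem SmoothOn.conj {f : ℝ → ℝ → ℂ} (hf : SmoothOn T f) :
    SmoothOn T (fun t s => conj (f t s)) :=
  hf.clm_comp (Complex.conjCLE : ℂ →L[ℝ] ℂ)

theorem SmoothOn.rotCoord {z w : ℝ → ℝ → ℂ} (hz : SmoothOn T z) (hw : SmoothOn T w)
    (hκ : SmoothOn T κ) : SmoothOn T (fun t s => rotCoord (z t s) (w t s) (κ t s)) := by
  have h1 := ContDiffOn.fst hκ
  have s1 := ContDiffOn.snd hκ
  have h2 := ContDiffOn.fst s1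
  have s2 := ContDiffOn.snd s1
  have h3 := ContDiffOn.fst s2
  have s3 := ContDiffOn.snd s2
  have h4 := ContDiffOn.fst s3
  have s4 := ContDiffOn.snd s3
  have h5 := ContDiffOn.fst s4
  have s5 := ContDiffOn.snd s4
  have h6 := ContDiffOn.fst s5
  have s6 := ContDiffOn.snd s5
  have h7 := ContDiffOn.fst s6
  have h8 := ContDiffOn.snd s6
  have hzw : SmoothOn T (fun t s => z t s * w t s) := ContDiffOn.mul hz hw
  exact (h1.mul hz).prodMk ((h2.mul hw).prodMk ((h3.mul hzw.conj).prodMk (h4.prodMk (h5.prodMk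
    ((h6.mul (hz.mul hw.conj)).prodMk ((h7.mul ((hz.pow 2).mul hw)).prodMk
      (h8.mul (hz.mul (hw.pow 2)))))))))

/-- The torus is abelian, so the rotation multiplies the complex coordinates by phases and shifts
the torus components by the derivatives of the angles. Suitable angles therefore remove the torus
components of the space derivative. -/
theorem IsFrame.rotate (hT : TimeInterval T) (h : IsFrame T F κ η) {θ φ : ℝ → ℝ → ℝ}
    (hθ : SmoothOn T θ) (hφ : SmoothOn T φ) :
    IsFrame T (fun t s => F t s * rotMap (cis (θ t s)) (cis (φ t s)))
      (fun t s => rotCoord (cis (θ t s)) (cis (φ t s)) (κ t s) +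
        (0, 0, 0, deriv (θ t) s, deriv (φ t) s, 0, 0, 0))
      (fun t s => rotCoord (cis (θ t s)) (cis (φ t s)) (η t s) +
        (0, 0, 0, timeDeriv T θ t s, timeDeriv T φ t s, 0, 0, 0)) :=
  h.mul (isFrame_rotMap hT hθ hφ) (hθ.cis.rotCoord hφ.cis h.smooth_space)
    (hθ.cis.rotCoord hφ.cis h.smooth_time)
    (fun _ _ _ => g2Lie_mul_rotMap (normSq_cis _) (normSq_cis _) _)
    (fun _ _ _ => g2Lie_mul_rotMap (normSq_cis _) (normSq_cis _) _)

theorem rotMap_stdVec_zero (z w : ℂ) : rotMap z w (stdVec 0) = stdVec 0 := by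
  rw [rotMap_apply]; ext i; fin_cases i <;> simp [stdVec_apply]

end G2Flow

namespace G2Flow

/-! ### Frames of Schrödinger flows -/

/-- The logarithmic space derivative of a frame adapted to a Schrödinger flow. -/
def flowCoord (p f₂ f₃ : ℂ) : G2Coord := (p, 0, 0, 0, 0, conj f₂, 0, -conj f₃)

/-- The function `φ̄₁² φ̄₂ / φ₁`. -/
def mixTerm (f₁ f₂ : ℝ → ℂ) (s : ℝ) : ℂ := conj (f₁ s) ^ 2 * conj (f₂ s) / f₁ s

/-- The expression whose space derivative is the leading part of the second equation. -/
def flux2 (f₁ f₂ : ℝ → ℂ) (s : ℝ) : ℂ := deriv f₂ s + 2 * (f₂ s * logDeriv f₁ s)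

/-- The expression whose space derivative is the leading part of the third equation. -/
def flux3 (f₁ f₂ f₃ : ℝ → ℂ) (s : ℝ) : ℂ :=
  deriv f₃ s + 2 * (f₃ s * logDeriv (fun y => f₁ y * f₂ y) s -
    Complex.I / f₂ s * deriv (mixTerm f₁ f₂) s)

/-- The logarithmic time derivative of a frame adapted to a Schrödinger flow. -/
def flowTime (f₁ f₂ f₃ : ℝ → ℂ) (ν₁ ν₂ : ℝ) (s : ℝ) : G2Coord :=
  (-Complex.I * deriv f₁ s, -Complex.I * (f₁ s * f₂ s), 0, ν₁, ν₂, Complex.I * conj (flux2 f₁ f₂ s),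
    -Complex.I * conj (f₂ s * f₃ s) + 2 * conj (mixTerm f₁ f₂ s),
    -Complex.I * conj (flux3 f₁ f₂ f₃ s))

theorem g2Bracket_flowCoord (p f₂ f₃ y₁ y₂ l m n : ℂ) (ν₁ ν₂ : ℝ) :
    g2Bracket (flowCoord p f₂ f₃) (y₁, y₂, 0, ν₁, ν₂, l, m, n) =
      (-(y₂ * conj f₂) + Complex.I * ν₁ * p, y₁ * f₂ - p * conj l,
        -(y₂ * f₃) - p * conj m - 2 * Complex.I * (conj p * conj y₂),
        -4 * (y₁ * conj p).im - 2 * (l * f₂).im,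
        2 * (l * f₂).im + 2 * (n * f₃).im + 2 * (y₁ * conj p).im,
        3 * p * conj y₂ + Complex.I * (ν₁ - ν₂) * conj f₂ + m * f₃,
        -(l * conj f₃) - conj f₂ * n,
        -(Complex.I * (ν₁ + 2 * ν₂) * conj f₃) + f₂ * m) := by
  simp only [g2Bracket, flowCoord, Prod.mk.injEq]
  refine ⟨?_, ?_, ?_, ?_, ?_, ?_, ?_, ?_⟩
  case refine_4 =>
    simp
    ring
  case refine_5 =>
    simp
    ring
  all_goals simp

section

variable {T : Set ℝ} {F : ℝ → ℝ → E7 →L[ℝ] E7} {κ η : ℝ → ℝ → G2Coord} {f₁ f₂ f₃ : ℝ → ℝ → ℂ}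
  {t s : ℝ}

theorem hasDerivAt_flowCoord {a b c : ℝ → ℂ} {a' b' c' : ℂ} {S : Set ℝ} {s : ℝ}
    (ha : HasDerivWithinAt a a' S s) (hb : HasDerivWithinAt b b' S s)
    (hc : HasDerivWithinAt c c' S s) :
    HasDerivWithinAt (fun x => flowCoord (a x) (b x) (c x)) (flowCoord a' b' c') S s :=
  ha.prodMk ((hasDerivWithinAt_const s S 0).prodMk ((hasDerivWithinAt_const s S 0).prodMk
    ((hasDerivWithinAt_const s S 0).prodMk ((hasDerivWithinAt_const s S 0).prodMk
      ((Complex.conjCLE.toContinuousLinearMap.hasFDerivAt.comp_hasDerivWithinAt s hb).prodMk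
        ((hasDerivWithinAt_const s S 0).prodMk
    (Complex.conjCLE.toContinuousLinearMap.hasFDerivAt.comp_hasDerivWithinAt s hc).neg))))))

theorem SmoothOn.flowCoord (h₁ : SmoothOn T f₁) (h₂ : SmoothOn T f₂) (h₃ : SmoothOn T f₃) :
    SmoothOn T (fun t s => flowCoord (f₁ t s) (f₂ t s) (f₃ t s)) :=
  ContDiffOn.prodMk h₁ (contDiffOn_const.prodMk (contDiffOn_const.prodMk (contDiffOn_const.prodMk
    (contDiffOn_const.prodMk (h₂.conj.prodMk (contDiffOn_const.prodMk h₃.conj.neg))))))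

/-- As `F` preserves the cross product, the equation can be pulled back to `e₀`. There a Lie algebra
element is seen only through its first three coordinates; the others belong to the stabiliser of
`e₀` and stay free. -/
theorem IsFrame.isSchrodingerFlow_iff (hT : TimeInterval T)
    (h : IsFrame T F (fun t s => flowCoord (f₁ t s) (f₂ t s) (f₃ t s)) η) (h₁ : SmoothOn T f₁)
    (h₂ : SmoothOn T f₂) (h₃ : SmoothOn T f₃) :
    (∀ t ∈ T, ∀ s, timeDeriv T (fun t s => F t s (stdVec 0)) t s =
      cross (F t s (stdVec 0)) (deriv (deriv fun s => F t s (stdVec 0)) s)) ↔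
    ∀ t ∈ T, ∀ s, (η t s).1 = -Complex.I * deriv (f₁ t) s ∧
      (η t s).2.1 = -Complex.I * (f₁ t s * f₂ t s) ∧ (η t s).2.2.1 = 0 := by
  refine forall_congr' fun t => forall_congr' fun ht => forall_congr' fun s => ?_
  have hG := h.isG2Map t ht s
  have d1 : (deriv fun s => F t s (stdVec 0)) = fun s =>
      F t s (g2Lie (G2Flow.flowCoord (f₁ t s) (f₂ t s) (f₃ t s)) (stdVec 0)) := funext fun s =>
    (hasDerivWithinAt_univ.1
      (hasDerivWithinAt_apply (h.space t ht s).hasDerivWithinAt (stdVec 0))).deriv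
  have d2 : deriv (deriv fun s => F t s (stdVec 0)) s =
      F t s (g2Lie (G2Flow.flowCoord (f₁ t s) (f₂ t s) (f₃ t s))
        (g2Lie (G2Flow.flowCoord (f₁ t s) (f₂ t s) (f₃ t s)) (stdVec 0)) +
        g2Lie (G2Flow.flowCoord (deriv (f₁ t) s) (deriv (f₂ t) s) (deriv (f₃ t) s)) (stdVec 0)) := by
    rw [d1]
    have e := hasDerivAt_flowCoord (h₁.hasDerivAt ht s).hasDerivWithinAt
      (h₂.hasDerivAt ht s).hasDerivWithinAt
      (h₃.hasDerivAt ht s).hasDerivWithinAt (S := univ)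
    have e2 := hasDerivWithinAt_apply (g2Lie.hasFDerivAt.comp_hasDerivWithinAt s e) (stdVec 0)
    rw [hasDerivWithinAt_univ] at e2
    rw [map_add]
    exact ((h.space t ht s).clm_apply e2).deriv
  have dt : timeDeriv T (fun t s => F t s (stdVec 0)) t s = F t s (g2Lie (η t s) (stdVec 0)) :=
    timeDeriv_of_hasDerivWithinAt hT ht (hasDerivWithinAt_apply (h.time t ht s) (stdVec 0))
  have inj : ∀ v w, F t s v = F t s w ↔ v = w := fun v w => hG.equiv.injective.eq_iff
  rw [d2, dt, ← hG.1, inj]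
  obtain ⟨y₁, y₂, y₃, ν₁, ν₂, l, m, n⟩ := η t s
  generalize f₁ t s = a
  generalize f₂ t s = b
  generalize f₃ t s = c
  generalize deriv (f₁ t) s = a'
  generalize deriv (f₂ t) s = b'
  generalize deriv (f₃ t) s = c'
  constructor
  · intro e
    have e1 := congrArg (fun v : E7 => v 1) e
    have e2 := congrArg (fun v : E7 => v 2) e
    have e3 := congrArg (fun v : E7 => v 3) e
    have e4 := congrArg (fun v : E7 => v 4) e
    have e5 := congrArg (fun v : E7 => v 5) e
    have e6 := congrArg (fun v : E7 => v 6) e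
    simp [G2Flow.flowCoord, g2Lie_apply, g2Act, cross_eq, stdVec_apply] at e1 e2 e3 e4 e5 e6
    refine ⟨?_, ?_, ?_⟩ <;> apply Complex.ext <;> simp <;> linarith
  · rintro ⟨e1, e2, e3⟩
    simp only at e1 e2 e3
    subst e1 e2 e3
    apply vec_ext <;>
      simp [G2Flow.flowCoord, g2Lie_apply, g2Act, cross_eq, stdVec_apply] <;> ring


theorem SmoothOn.div_complex {f g : ℝ → ℝ → ℂ} (hf : SmoothOn T f) (hg : SmoothOn T g)
    (h : ∀ t ∈ T, ∀ s, g t s ≠ 0) : SmoothOn T (fun t s => f t s / g t s) := by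
  simp only [div_eq_mul_inv]
  exact ContDiffOn.mul hf (ContDiffOn.inv hg fun p hp => h p.1 hp.1 p.2)

theorem SmoothOn.logDeriv (hT : TimeInterval T) {f : ℝ → ℝ → ℂ} (hf : SmoothOn T f)
    (h : ∀ t ∈ T, ∀ s, f t s ≠ 0) : SmoothOn T (fun t s => logDeriv (f t) s) :=
  (hf.deriv hT).div_complex hf h

theorem SmoothOn.ofReal {f : ℝ → ℝ → ℝ} (hf : SmoothOn T f) :
    SmoothOn T (fun t s => (f t s : ℂ)) :=
  hf.clm_comp Complex.ofRealCLM

theorem SmoothOn.re {f : ℝ → ℝ → ℂ} (hf : SmoothOn T f) : SmoothOn T (fun t s => (f t s).re) :=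
  hf.clm_comp Complex.reCLM

theorem SmoothOn.im {f : ℝ → ℝ → ℂ} (hf : SmoothOn T f) : SmoothOn T (fun t s => (f t s).im) :=
  hf.clm_comp Complex.imCLM

theorem SmoothOn.norm_sq {E : Type} [NormedAddCommGroup E] [InnerProductSpace ℝ E]
    {f : ℝ → ℝ → E} (hf : SmoothOn T f) : SmoothOn T (fun t s => ‖f t s‖ ^ 2) :=
  ContDiffOn.norm_sq ℝ hf

theorem SmoothOn.mixTerm (h₁ : SmoothOn T f₁) (h₂ : SmoothOn T f₂)
    (hn₁ : ∀ t ∈ T, ∀ s, f₁ t s ≠ 0) : SmoothOn T (fun t s => mixTerm (f₁ t) (f₂ t) s) :=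
  SmoothOn.div_complex (ContDiffOn.mul (ContDiffOn.pow h₁.conj 2) h₂.conj) h₁ hn₁

theorem SmoothOn.flux2 (hT : TimeInterval T) (h₁ : SmoothOn T f₁) (h₂ : SmoothOn T f₂)
    (hn₁ : ∀ t ∈ T, ∀ s, f₁ t s ≠ 0) : SmoothOn T (fun t s => flux2 (f₁ t) (f₂ t) s) :=
  ContDiffOn.add (h₂.deriv hT) (contDiffOn_const.mul (ContDiffOn.mul h₂ (h₁.logDeriv hT hn₁)))

theorem SmoothOn.flux3 (hT : TimeInterval T) (h₁ : SmoothOn T f₁) (h₂ : SmoothOn T f₂)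
    (h₃ : SmoothOn T f₃) (hn₁ : ∀ t ∈ T, ∀ s, f₁ t s ≠ 0) (hn₂ : ∀ t ∈ T, ∀ s, f₂ t s ≠ 0) :
    SmoothOn T (fun t s => flux3 (f₁ t) (f₂ t) (f₃ t) s) :=
  ContDiffOn.add (h₃.deriv hT) (contDiffOn_const.mul (ContDiffOn.sub
    (ContDiffOn.mul h₃ (SmoothOn.logDeriv hT (f := fun t s => f₁ t s * f₂ t s)
      (ContDiffOn.mul h₁ h₂) fun t ht s => mul_ne_zero (hn₁ t ht s) (hn₂ t ht s)))
    (ContDiffOn.mul (SmoothOn.div_complex (f := fun _ _ => Complex.I) contDiffOn_const h₂ hn₂)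
      ((h₁.mixTerm h₂ hn₁).deriv hT))))

end

/-! ### The structure equations of a Schrödinger flow -/

/-- Here `l₁, l₂` stand for the logarithmic derivatives of `f₁, f₂`, `m` for `mixTerm` and `w` for
its derivative divided by `f₂`, which makes the structure equation polynomial. The second, third and
seventh components hold identically, the third because of `hm`; the other five are the right-hand
side. -/
theorem flowCoord_sub_eq_g2Bracket_iff {a b c a' b' c' l₁ l₂ a₂ c₁ d₂ d₃ w m : ℂ} {ν₁ ν₂ μ₁ μ₂ : ℝ}
    (hm : a * m = conj a ^ 2 * conj b) :
    flowCoord a' b' c' - (-Complex.I * a₂, -Complex.I * (l₁ * a * b + a * (l₂ * b)), 0, μ₁, μ₂,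
      Complex.I * conj d₂, -Complex.I * conj (l₂ * b * c + b * c₁) + 2 * conj (w * b),
      -Complex.I * conj d₃) = g2Bracket (flowCoord a b c)
        (-Complex.I * (l₁ * a), -Complex.I * (a * b), 0, ν₁, ν₂,
          Complex.I * conj (l₂ * b + 2 * (b * l₁)), -Complex.I * conj (b * c) + 2 * conj m,
          -Complex.I * conj (c₁ + 2 * (c * (l₁ + l₂) - Complex.I * w))) ↔
    Complex.I * a' = a₂ - a * (b * conj b) - ν₁ * a ∧
    Complex.I * b' = d₂ + (ν₁ - ν₂ + 3 * (a * conj a)) * b - b * (c * conj c) +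
      2 * Complex.I * (m * conj c) ∧
    Complex.I * c' = d₃ + (ν₁ + 2 * ν₂) * c + c * (b * conj b) - 2 * Complex.I * (m * conj b) ∧
    μ₁ = -4 * l₁.re * Complex.normSq a + 2 * l₂.re * Complex.normSq b +
      4 * Complex.normSq b * l₁.re ∧
    μ₁ - μ₂ = -6 * l₁.re * Complex.normSq a + 4 * l₂.re * Complex.normSq b -
      2 * (c₁ * conj c).re + 2 * (4 * Complex.normSq b * l₁.re -
        Complex.normSq c * (2 * (l₁ + l₂).re) + 2 * (c * conj w).im) := by
  rw [g2Bracket_flowCoord]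
  have hm1 := congrArg Complex.re hm
  have hm2 := congrArg Complex.im hm
  obtain ⟨a, a_⟩ := a
  obtain ⟨b, b_⟩ := b
  obtain ⟨c, c_⟩ := c
  obtain ⟨m, m_⟩ := m
  simp only [flowCoord, Prod.mk_sub_mk, Prod.mk.injEq]
  simp [Complex.ext_iff, pow_two, Complex.normSq_apply] at hm1 hm2 ⊢
  constructor
  · rintro ⟨⟨h1, h2⟩, -, -, h3, h4, ⟨h5, h6⟩, -, h7, h8⟩
    refine ⟨⟨?_, ?_⟩, ⟨?_, ?_⟩, ⟨?_, ?_⟩, ?_, ?_⟩ <;> linarith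
  · rintro ⟨⟨h1, h2⟩, ⟨h5, h6⟩, ⟨h7, h8⟩, h3, h4⟩
    refine ⟨⟨?_, ?_⟩, ⟨?_, ?_⟩, ⟨?_, ?_⟩, ?_, ?_, ⟨?_, ?_⟩, ⟨?_, ?_⟩, ?_, ?_⟩ <;> linarith

theorem hasDerivAt_conj {f : ℝ → ℂ} {f' : ℂ} {s : ℝ} (h : HasDerivAt f f' s) :
    HasDerivAt (fun x => conj (f x)) (conj f') s :=
  Complex.conjCLE.toContinuousLinearMap.hasFDerivAt.comp_hasDerivAt s h

theorem logNormSqDeriv_eq {f : ℝ → ℂ} {s : ℝ} (h : DifferentiableAt ℝ f s) (h0 : f s ≠ 0) :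
    logNormSqDeriv f s = 2 * (logDeriv f s).re := by
  have h1 : HasDerivAt (fun x => ‖f x‖ ^ 2) (2 * inner ℝ (f s) (deriv f s)) s :=
    h.hasDerivAt.norm_sq
  have h2 := h1.log (by positivity)
  rw [logNormSqDeriv, h2.deriv, logDeriv_apply, Complex.div_re, ← Complex.normSq_eq_norm_sq,
    Complex.inner]
  simp
  ring

theorem logDeriv_mul_fun {f g : ℝ → ℂ} {s : ℝ} (hf : DifferentiableAt ℝ f s)
    (hg : DifferentiableAt ℝ g s) (hf0 : f s ≠ 0) (hg0 : g s ≠ 0) :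
    logDeriv (fun x => f x * g x) s = logDeriv f s + logDeriv g s :=
  logDeriv_mul s hf0 hg0 hf hg

/-- The quotient differentiated in `imTerm` is the complex conjugate of `mixTerm`. -/
theorem imTerm_eq {f₁ f₂ f₃ : ℝ → ℂ} {s : ℝ} (h : DifferentiableAt ℝ (mixTerm f₁ f₂) s) :
    imTerm f₁ f₂ f₃ s = (f₃ s * conj (deriv (mixTerm f₁ f₂) s / f₂ s)).im := by
  have : (fun x => f₁ x ^ 2 * f₂ x / conj (f₁ x)) = fun x => conj (mixTerm f₁ f₂ x) := by
    funext x
    simp [mixTerm]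
  rw [imTerm, this, (hasDerivAt_conj h.hasDerivAt).deriv, map_div₀]
  congr 1
  ring

/-- The first integrand of the system. -/
def density1 (f₁ f₂ : ℝ → ℂ) (s : ℝ) : ℝ := ‖f₂ s‖ ^ 2 * logNormSqDeriv f₁ s

/-- The second integrand of the system. -/
def density2 (f₁ f₂ f₃ : ℝ → ℂ) (s : ℝ) : ℝ :=
  2 * ‖f₂ s‖ ^ 2 * logNormSqDeriv f₁ s - ‖f₃ s‖ ^ 2 * logNormSqDeriv (fun y => f₁ y * f₂ y) s +
    2 * imTerm f₁ f₂ f₃ s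

set_option maxHeartbeats 1000000 in
/-- The structure equations for Schrödinger flows, in terms of the logarithmic time derivative in
the directions of the maximal torus. -/
theorem zero_curvature_iff {f₁ f₂ f₃ : ℝ → ℂ} {ν₁ ν₂ : ℝ → ℝ} {s : ℝ} {a' b' c' : ℂ}
    (h₁ : ContDiff ℝ ∞ f₁) (h₂ : ContDiff ℝ ∞ f₂) (h₃ : ContDiff ℝ ∞ f₃) (hn₁ : ∀ s, f₁ s ≠ 0)
    (hn₂ : ∀ s, f₂ s ≠ 0) (hν₁ : DifferentiableAt ℝ ν₁ s) (hν₂ : DifferentiableAt ℝ ν₂ s) :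
    flowCoord a' b' c' - deriv (fun x => flowTime f₁ f₂ f₃ (ν₁ x) (ν₂ x) x) s =
      g2Bracket (flowCoord (f₁ s) (f₂ s) (f₃ s)) (flowTime f₁ f₂ f₃ (ν₁ s) (ν₂ s) s) ↔
    Complex.I * a' = deriv (deriv f₁) s - f₁ s * (f₂ s * conj (f₂ s)) - ν₁ s * f₁ s ∧
    Complex.I * b' = deriv (flux2 f₁ f₂) s + (ν₁ s - ν₂ s + 3 * (f₁ s * conj (f₁ s))) * f₂ s -
      f₂ s * (f₃ s * conj (f₃ s)) + 2 * Complex.I * (mixTerm f₁ f₂ s * conj (f₃ s)) ∧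
    Complex.I * c' = deriv (flux3 f₁ f₂ f₃) s + (ν₁ s + 2 * ν₂ s) * f₃ s +
      f₃ s * (f₂ s * conj (f₂ s)) - 2 * Complex.I * (mixTerm f₁ f₂ s * conj (f₂ s)) ∧
    deriv ν₁ s = deriv (fun x => -2 * ‖f₁ x‖ ^ 2 + ‖f₂ x‖ ^ 2) s + 2 * density1 f₁ f₂ s ∧
    deriv ν₁ s - deriv ν₂ s =
      deriv (fun x => -3 * ‖f₁ x‖ ^ 2 + 2 * ‖f₂ x‖ ^ 2 - ‖f₃ x‖ ^ 2) s +
        2 * density2 f₁ f₂ f₃ s := by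
  have e1 : ∀ {f : ℝ → ℂ}, ContDiff ℝ ∞ f → ∀ x, HasDerivAt f (deriv f x) x := fun h x =>
    (h.differentiable (by simp) x).hasDerivAt
  have D : ∀ {f : ℝ → ℂ}, ContDiff ℝ ∞ f → ContDiff ℝ ∞ (deriv f) := fun h =>
    (contDiff_infty_iff_deriv.1 h).2
  have inv : ∀ {f g : ℝ → ℂ}, ContDiff ℝ ∞ f → ContDiff ℝ ∞ g → (∀ x, g x ≠ 0) →
      ContDiff ℝ ∞ (fun x => f x / g x) := fun {f g} hf hg h0 => by
    simp only [div_eq_mul_inv]; exact hf.mul (hg.inv h0)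
  have cj : ∀ {f : ℝ → ℂ}, ContDiff ℝ ∞ f → ContDiff ℝ ∞ (fun x => conj (f x)) := fun h =>
    (Complex.conjCLE : ℂ →L[ℝ] ℂ).contDiff.comp h
  have hm : ContDiff ℝ ∞ (mixTerm f₁ f₂) := inv (((cj h₁).pow 2).mul (cj h₂)) h₁ hn₁
  have hl : ContDiff ℝ ∞ (fun x => logDeriv f₁ x) := inv (D h₁) h₁ hn₁
  have h12 : ContDiff ℝ ∞ (fun x => logDeriv (fun y => f₁ y * f₂ y) x) :=
    inv (D (h₁.mul h₂)) (h₁.mul h₂) fun x => mul_ne_zero (hn₁ x) (hn₂ x)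
  have hf2 : ContDiff ℝ ∞ (flux2 f₁ f₂) := (D h₂).add (contDiff_const.mul (h₂.mul hl))
  have hf3 : ContDiff ℝ ∞ (flux3 f₁ f₂ f₃) := (D h₃).add (contDiff_const.mul
    ((h₃.mul h12).sub ((inv contDiff_const h₂ hn₂).mul (D hm))))
  -- All derivatives are written through logarithmic ones, to reach the polynomial form of
  -- `flowCoord_sub_eq_g2Bracket_iff`.
  have d1 : deriv f₁ s = logDeriv f₁ s * f₁ s := by
    rw [logDeriv_apply, div_mul_cancel₀ _ (hn₁ s)]
  have d2 : deriv f₂ s = logDeriv f₂ s * f₂ s := by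
    rw [logDeriv_apply, div_mul_cancel₀ _ (hn₂ s)]
  have l12 := logDeriv_mul_fun (e1 h₁ s).differentiableAt (e1 h₂ s).differentiableAt (hn₁ s) (hn₂ s)
  have dm : deriv (mixTerm f₁ f₂) s = deriv (mixTerm f₁ f₂) s / f₂ s * f₂ s := by
    rw [div_mul_cancel₀ _ (hn₂ s)]
  have key := ((e1 (D h₁) s).const_mul (-Complex.I)).prodMk
    ((((e1 h₁ s).mul (e1 h₂ s)).const_mul (-Complex.I)).prodMk
    ((hasDerivAt_const s (0 : ℂ)).prodMk (hν₁.hasDerivAt.prodMk (hν₂.hasDerivAt.prodMk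
    (((hasDerivAt_conj (e1 hf2 s)).const_mul Complex.I).prodMk
    ((((hasDerivAt_conj ((e1 h₂ s).mul (e1 h₃ s))).const_mul (-Complex.I)).add
      ((hasDerivAt_conj (e1 hm s)).const_mul 2)).prodMk
        ((hasDerivAt_conj (e1 hf3 s)).const_mul (-Complex.I))))))))
  have key' : deriv (fun x => flowTime f₁ f₂ f₃ (ν₁ x) (ν₂ x) x) s = _ := key.deriv
  have n1 : ∀ {f : ℝ → ℂ}, ContDiff ℝ ∞ f → HasDerivAt (fun x => ‖f x‖ ^ 2)
      (2 * (deriv f s * conj (f s)).re) s := fun {f} h => by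
    have := (e1 h s).norm_sq
    refine this.congr_deriv ?_
    rw [Complex.inner]
  have k1 : deriv (fun x => -2 * ‖f₁ x‖ ^ 2 + ‖f₂ x‖ ^ 2) s = _ :=
    (((n1 h₁).const_mul (-2)).add (n1 h₂)).deriv
  have k2 : deriv (fun x => -3 * ‖f₁ x‖ ^ 2 + 2 * ‖f₂ x‖ ^ 2 - ‖f₃ x‖ ^ 2) s = _ :=
    ((((n1 h₁).const_mul (-3)).add ((n1 h₂).const_mul 2)).sub (n1 h₃)).deriv
  rw [key', k1, k2, density1, density2, logNormSqDeriv_eq (e1 h₁ s).differentiableAt (hn₁ s),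
    logNormSqDeriv_eq (e1 (h₁.mul h₂) s).differentiableAt (mul_ne_zero (hn₁ s) (hn₂ s)),
    imTerm_eq (e1 hm s).differentiableAt, l12, flowTime, flux2, flux3, l12, d1, d2,
    div_mul_eq_mul_div, mul_div_assoc]
  have hmm : f₁ s * mixTerm f₁ f₂ s = conj (f₁ s) ^ 2 * conj (f₂ s) := by
    rw [mixTerm, mul_div_cancel₀ _ (hn₁ s)]
  generalize deriv (mixTerm f₁ f₂) s / f₂ s = w at *
  rw [dm, flowCoord_sub_eq_g2Bracket_iff hmm]
  have r : ∀ x y : ℂ, (x * y * conj y).re = x.re * Complex.normSq y := fun x y => by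
    rw [mul_assoc, Complex.mul_conj, Complex.re_mul_ofReal]
  rw [r, r]
  simp only [← Complex.normSq_eq_norm_sq]
  refine and_congr_right fun _ => and_congr_right fun _ => and_congr_right fun _ =>
    and_congr (Eq.congr_right ?_) (Eq.congr_right ?_)
  · ring
  · simp only [Complex.add_re]
    ring

end G2Flow

/-! ### The nonlocal terms as torus components, and the rest of the time derivative -/

namespace G2Flow

/-- The first torus component of the logarithmic time derivative. -/
def torus1 (f₁ f₂ : ℝ → ℂ) (s : ℝ) : ℝ :=
  -2 * ‖f₁ s‖ ^ 2 + ‖f₂ s‖ ^ 2 + 2 * ∫ x in (0 : ℝ)..s, density1 f₁ f₂ x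

/-- The second torus component of the logarithmic time derivative. -/
def torus2 (f₁ f₂ f₃ : ℝ → ℂ) (s : ℝ) : ℝ :=
  torus1 f₁ f₂ s - (-3 * ‖f₁ s‖ ^ 2 + 2 * ‖f₂ s‖ ^ 2 - ‖f₃ s‖ ^ 2 +
    2 * ∫ x in (0 : ℝ)..s, density2 f₁ f₂ f₃ x)

theorem rhs1_eq (f₁ f₂ : ℝ → ℂ) (s : ℝ) : rhs1 f₁ f₂ s =
    deriv (deriv f₁) s - f₁ s * (f₂ s * conj (f₂ s)) - torus1 f₁ f₂ s * f₁ s := by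
  simp only [rhs1, torus1, density1, Complex.mul_conj']
  push_cast
  ring

section

variable {T : Set ℝ} {F : ℝ → ℝ → E7 →L[ℝ] E7} {η : ℝ → ℝ → G2Coord} {f₁ f₂ f₃ : ℝ → ℝ → ℂ}
  {t s : ℝ}

theorem SmoothOn.logNormSqDeriv (hT : TimeInterval T) {f : ℝ → ℝ → ℂ} (hf : SmoothOn T f)
    (h : ∀ t ∈ T, ∀ s, f t s ≠ 0) : SmoothOn T (fun t s => logNormSqDeriv (f t) s) :=
  SmoothOn.congr (f := fun t s => 2 * (_root_.logDeriv (f t) s).re)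
    (ContDiffOn.mul contDiffOn_const (hf.logDeriv hT h).re) fun t ht s =>
      logNormSqDeriv_eq (hf.hasDerivAt ht s).differentiableAt (h t ht s)

theorem SmoothOn.density1 (hT : TimeInterval T) (h₁ : SmoothOn T f₁) (h₂ : SmoothOn T f₂)
    (hn₁ : ∀ t ∈ T, ∀ s, f₁ t s ≠ 0) : SmoothOn T (fun t s => density1 (f₁ t) (f₂ t) s) :=
  ContDiffOn.mul h₂.norm_sq (h₁.logNormSqDeriv hT hn₁)

theorem SmoothOn.imTerm (hT : TimeInterval T) (h₁ : SmoothOn T f₁) (h₂ : SmoothOn T f₂)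
    (h₃ : SmoothOn T f₃) (hn₁ : ∀ t ∈ T, ∀ s, f₁ t s ≠ 0) (hn₂ : ∀ t ∈ T, ∀ s, f₂ t s ≠ 0) :
    SmoothOn T (fun t s => imTerm (f₁ t) (f₂ t) (f₃ t) s) :=
  SmoothOn.im (f := fun _ _ => _ * _) (ContDiffOn.mul (h₃.div_complex h₂.conj fun t ht s =>
    (map_ne_zero _).2 (hn₂ t ht s)) (SmoothOn.deriv hT (f := fun _ _ => _ / _)
      (SmoothOn.div_complex (f := fun t s => f₁ t s ^ 2 * f₂ t s)
        (ContDiffOn.mul (ContDiffOn.pow h₁ 2) h₂) h₁.conj fun t ht s =>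
          (map_ne_zero _).2 (hn₁ t ht s))))

theorem SmoothOn.density2 (hT : TimeInterval T) (h₁ : SmoothOn T f₁) (h₂ : SmoothOn T f₂)
    (h₃ : SmoothOn T f₃) (hn₁ : ∀ t ∈ T, ∀ s, f₁ t s ≠ 0) (hn₂ : ∀ t ∈ T, ∀ s, f₂ t s ≠ 0) :
    SmoothOn T (fun t s => density2 (f₁ t) (f₂ t) (f₃ t) s) :=
  ContDiffOn.add (ContDiffOn.sub (ContDiffOn.mul (contDiffOn_const.mul h₂.norm_sq)
    (h₁.logNormSqDeriv hT hn₁)) (ContDiffOn.mul h₃.norm_sq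
      (SmoothOn.logNormSqDeriv hT (f := fun t s => f₁ t s * f₂ t s) (ContDiffOn.mul h₁ h₂)
        fun t ht s => mul_ne_zero (hn₁ t ht s) (hn₂ t ht s))))
    (contDiffOn_const.mul (h₁.imTerm hT h₂ h₃ hn₁ hn₂))

/-- The integral term is that of `torus1 - torus2`. The term in `3 |f₁|²` cancels the one contained
in this difference, and the cubic terms in `f₂` and `f₃` combine to coefficients `2` and `-2`. -/
theorem rhs2_eq (hT : TimeInterval T) (h₁ : SmoothOn T f₁) (h₂ : SmoothOn T f₂)
    (hn₁ : ∀ t ∈ T, ∀ s, f₁ t s ≠ 0) (ht : t ∈ T) (s : ℝ) : rhs2 (f₁ t) (f₂ t) (f₃ t) s =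
    deriv (flux2 (f₁ t) (f₂ t)) s + (torus1 (f₁ t) (f₂ t) s - torus2 (f₁ t) (f₂ t) (f₃ t) s +
      3 * (f₁ t s * conj (f₁ t s))) * f₂ t s - f₂ t s * (f₃ t s * conj (f₃ t s)) +
      2 * Complex.I * (mixTerm (f₁ t) (f₂ t) s * conj (f₃ t s)) := by
  have e : deriv (flux2 (f₁ t) (f₂ t)) s = deriv (deriv (f₂ t)) s +
      2 * deriv (fun x => f₂ t x * logDeriv (f₁ t) x) s :=
    (((h₂.deriv hT).hasDerivAt ht s).add ((SmoothOn.hasDerivAt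
      (f := fun t s => f₂ t s * logDeriv (f₁ t) s) (ContDiffOn.mul h₂ (h₁.logDeriv hT hn₁))
        ht s).const_mul 2)).deriv
  rw [e]
  simp only [rhs2, torus2, density2, mixTerm, Complex.mul_conj']
  push_cast
  ring

theorem rhs3_eq (hT : TimeInterval T) (h₁ : SmoothOn T f₁) (h₂ : SmoothOn T f₂)
    (h₃ : SmoothOn T f₃) (hn₁ : ∀ t ∈ T, ∀ s, f₁ t s ≠ 0) (hn₂ : ∀ t ∈ T, ∀ s, f₂ t s ≠ 0)
    (ht : t ∈ T) (s : ℝ) : rhs3 (f₁ t) (f₂ t) (f₃ t) s =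
    deriv (flux3 (f₁ t) (f₂ t) (f₃ t)) s +
      (torus1 (f₁ t) (f₂ t) s + 2 * torus2 (f₁ t) (f₂ t) (f₃ t) s) * f₃ t s +
      f₃ t s * (f₂ t s * conj (f₂ t s)) -
        2 * Complex.I * (mixTerm (f₁ t) (f₂ t) s * conj (f₂ t s)) := by
  have e : deriv (flux3 (f₁ t) (f₂ t) (f₃ t)) s = deriv (deriv (f₃ t)) s +
      2 * deriv (fun x => f₃ t x * logDeriv (fun y => f₁ t y * f₂ t y) x -
      Complex.I / f₂ t x * deriv (mixTerm (f₁ t) (f₂ t)) x) s :=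
    (((h₃.deriv hT).hasDerivAt ht s).add ((SmoothOn.hasDerivAt
      (f := fun t x => f₃ t x * logDeriv (fun y => f₁ t y * f₂ t y) x -
      Complex.I / f₂ t x * deriv (mixTerm (f₁ t) (f₂ t)) x) (ContDiffOn.sub
    (ContDiffOn.mul h₃ (SmoothOn.logDeriv hT (f := fun t s => f₁ t s * f₂ t s)
      (ContDiffOn.mul h₁ h₂) fun t ht s => mul_ne_zero (hn₁ t ht s) (hn₂ t ht s)))
    (ContDiffOn.mul (SmoothOn.div_complex (f := fun _ _ => Complex.I) contDiffOn_const h₂ hn₂)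
      ((h₁.mixTerm h₂ hn₁).deriv hT))) ht s).const_mul 2)).deriv
  have c1 : Continuous (density1 (f₁ t) (f₂ t)) :=
    ((h₁.density1 hT h₂ hn₁).contDiff_slice ht).continuous
  have c2 : Continuous (density2 (f₁ t) (f₂ t) (f₃ t)) :=
    ((h₁.density2 hT h₂ h₃ hn₁ hn₂).contDiff_slice ht).continuous
  -- The third equation contains `ν₁ + 2 ν₂ = 3 ν₁ - 2 (ν₁ - ν₂)`, so the two densities enter with
  -- weights `3` and `-2`.
  have e2 : (∫ x in (0 : ℝ)..s,
      (2 * ‖f₃ t x‖ ^ 2 * logNormSqDeriv (fun y => f₁ t y * f₂ t y) x -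
        ‖f₂ t x‖ ^ 2 * logNormSqDeriv (f₁ t) x - 4 * imTerm (f₁ t) (f₂ t) (f₃ t) x)) =
      3 * (∫ x in (0 : ℝ)..s, density1 (f₁ t) (f₂ t) x) -
        2 * ∫ x in (0 : ℝ)..s, density2 (f₁ t) (f₂ t) (f₃ t) x := by
    rw [← intervalIntegral.integral_const_mul, ← intervalIntegral.integral_const_mul,
      ← intervalIntegral.integral_sub ((c1.const_mul 3).intervalIntegrable _ _)
        ((c2.const_mul 2).intervalIntegrable _ _)]
    refine intervalIntegral.integral_congr fun x _ => ?_
    simp only [density1, density2]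
    ring
  rw [e, rhs3, e2]
  simp only [torus1, torus2, Complex.mul_conj']
  rw [show (fun y => conj (f₁ t y) ^ 2 * conj (f₂ t y) / f₁ t y) = mixTerm (f₁ t) (f₂ t) from rfl]
  simp only [mixTerm, pow_two (conj (f₂ t s))]
  push_cast
  ring

theorem eq_add_integral {g h d : ℝ → ℝ} (hg : Differentiable ℝ g) (hh : Differentiable ℝ h)
    (hd : Continuous d) (e : ∀ s, deriv g s = deriv h s + 2 * d s) (h0 : g 0 = h 0) (s : ℝ) :
    g s = h s + 2 * ∫ x in (0 : ℝ)..s, d x := by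
  have := intervalIntegral.integral_eq_sub_of_hasDerivAt (f := fun x => g x - h x)
    (f' := fun x => 2 * d x) (a := 0) (b := s)
    (fun x _ => ((hg x).hasDerivAt.sub (hh x).hasDerivAt).congr_deriv (by rw [e]; ring))
    ((hd.const_mul 2).intervalIntegrable _ _)
  rw [intervalIntegral.integral_const_mul] at this
  linarith

theorem SmoothOn.flowTime (hT : TimeInterval T) (h₁ : SmoothOn T f₁) (h₂ : SmoothOn T f₂)
    (h₃ : SmoothOn T f₃) (hn₁ : ∀ t ∈ T, ∀ s, f₁ t s ≠ 0) (hn₂ : ∀ t ∈ T, ∀ s, f₂ t s ≠ 0)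
    {ν₁ ν₂ : ℝ → ℝ → ℝ} (hν₁ : SmoothOn T ν₁) (hν₂ : SmoothOn T ν₂) :
    SmoothOn T (fun t s => flowTime (f₁ t) (f₂ t) (f₃ t) (ν₁ t s) (ν₂ t s) s) :=
  (ContDiffOn.mul contDiffOn_const (h₁.deriv hT)).prodMk
    ((ContDiffOn.mul contDiffOn_const (ContDiffOn.mul h₁ h₂)).prodMk
    (contDiffOn_const.prodMk (ContDiffOn.prodMk hν₁ (ContDiffOn.prodMk hν₂
    ((ContDiffOn.mul contDiffOn_const (h₁.flux2 hT h₂ hn₁).conj).prodMk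
    ((ContDiffOn.add (ContDiffOn.mul contDiffOn_const
      (SmoothOn.conj (f := fun t s => f₂ t s * f₃ t s) (ContDiffOn.mul h₂ h₃)))
      (ContDiffOn.mul contDiffOn_const (h₁.mixTerm h₂ hn₁).conj)).prodMk
    (ContDiffOn.mul contDiffOn_const (h₁.flux3 hT h₂ h₃ hn₁ hn₂).conj)))))))

theorem SmoothOn.timeDeriv_flowCoord (hT : TimeInterval T) (h₁ : SmoothOn T f₁)
    (h₂ : SmoothOn T f₂) (h₃ : SmoothOn T f₃) (ht : t ∈ T) (s : ℝ) :
    G2Flow.timeDeriv T (fun t s => G2Flow.flowCoord (f₁ t s) (f₂ t s) (f₃ t s)) t s =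
      G2Flow.flowCoord (G2Flow.timeDeriv T f₁ t s) (G2Flow.timeDeriv T f₂ t s)
        (G2Flow.timeDeriv T f₃ t s) :=
  timeDeriv_of_hasDerivWithinAt hT ht (hasDerivAt_flowCoord (h₁.hasDerivWithinAt ht s)
    (h₂.hasDerivWithinAt ht s) (h₃.hasDerivWithinAt ht s))

/-- The logarithmic time derivative of a frame adapted to a Schrödinger flow is determined up to its
torus components. -/
theorem IsFrame.eq_flowTime (hT : TimeInterval T)
    (h : IsFrame T F (fun t s => flowCoord (f₁ t s) (f₂ t s) (f₃ t s)) η) (h₁ : SmoothOn T f₁)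
    (h₂ : SmoothOn T f₂) (h₃ : SmoothOn T f₃) (hn₁ : ∀ t ∈ T, ∀ s, f₁ t s ≠ 0)
    (hn₂ : ∀ t ∈ T, ∀ s, f₂ t s ≠ 0)
    (hη : ∀ t ∈ T, ∀ s, (η t s).1 = -Complex.I * deriv (f₁ t) s ∧
      (η t s).2.1 = -Complex.I * (f₁ t s * f₂ t s) ∧ (η t s).2.2.1 = 0) (ht : t ∈ T) (s : ℝ) :
    η t s = flowTime (f₁ t) (f₂ t) (f₃ t) (η t s).2.2.2.1 (η t s).2.2.2.2.1 s := by
  have zc : ∀ s, _ := fun s => h.zero_curvature hT ht s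
  have e0 : ∀ s, η t s = (-Complex.I * deriv (f₁ t) s, -Complex.I * (f₁ t s * f₂ t s), 0,
      (η t s).2.2.2.1, (η t s).2.2.2.2.1, (η t s).2.2.2.2.2.1, (η t s).2.2.2.2.2.2.1,
      (η t s).2.2.2.2.2.2.2) := fun s => by
    obtain ⟨a, b, c⟩ := hη t ht s
    rw [← a, ← b, ← c]
  have dη : ∀ s (L : G2Coord →L[ℝ] ℂ) {g : ℝ → ℂ} {g' : ℂ}, (∀ s, L (η t s) = g s) →
      HasDerivAt g g' s → L (deriv (η t) s) = g' := fun s L g g' e hg => by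
    have := h.smooth_time.hasDerivAt_clm L ht s
    simp only [e] at this
    exact this.unique hg
  let S1 := ContinuousLinearMap.snd ℝ ℂ (ℂ × ℂ × ℝ × ℝ × ℂ × ℂ × ℂ)
  let S2 := ContinuousLinearMap.snd ℝ ℂ (ℂ × ℝ × ℝ × ℂ × ℂ × ℂ)
  let S3 := ContinuousLinearMap.snd ℝ ℂ (ℝ × ℝ × ℂ × ℂ × ℂ)
  let S4 := ContinuousLinearMap.snd ℝ ℝ (ℝ × ℂ × ℂ × ℂ)
  let S5 := ContinuousLinearMap.snd ℝ ℝ (ℂ × ℂ × ℂ)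
  let S6 := ContinuousLinearMap.snd ℝ ℂ (ℂ × ℂ)
  let P2 : G2Coord →L[ℝ] ℂ := (ContinuousLinearMap.fst ℝ ℂ (ℂ × ℝ × ℝ × ℂ × ℂ × ℂ)).comp S1
  let P3 : G2Coord →L[ℝ] ℂ := (ContinuousLinearMap.fst ℝ ℂ (ℝ × ℝ × ℂ × ℂ × ℂ)).comp (S2.comp S1)
  let P7 : G2Coord →L[ℝ] ℂ := (ContinuousLinearMap.fst ℝ ℂ ℂ).comp
    (S6.comp (S5.comp (S4.comp (S3.comp (S2.comp S1)))))
  have zc' : ∀ s, flowCoord (timeDeriv T f₁ t s) (timeDeriv T f₂ t s) (timeDeriv T f₃ t s) -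
      deriv (η t) s = _ := fun s => by
    rw [← h₁.timeDeriv_flowCoord hT h₂ h₃ ht s, zc s, e0 s, g2Bracket_flowCoord]
  have d1 : ∀ s, deriv (f₁ t) s = logDeriv (f₁ t) s * f₁ t s := fun s => by
    rw [logDeriv_apply, div_mul_cancel₀ _ (hn₁ t ht s)]
  have cc : ∀ {x y : ℂ}, conj x = y → x = conj y := fun h => by rw [← h, Complex.conj_conj]
  -- The second, third and seventh entries of `flowCoord` vanish, so these components of the
  -- structure equation contain no time derivative. Taken in this order they are linear equations
  -- for the remaining complex coordinates of `η`, solved by dividing by `f₁`, `f₁` and `conj f₂`.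
  have hl : ∀ s, (η t s).2.2.2.2.2.1 = Complex.I * conj (flux2 (f₁ t) (f₂ t) s) := fun s => by
    have z : 0 - P2 (deriv (η t) s) = _ := congrArg (fun x : G2Coord => x.2.1) (zc' s)
    rw [dη s P2 (fun s => (hη t ht s).2.1)
      (((h₁.hasDerivAt ht s).mul (h₂.hasDerivAt ht s)).const_mul (-Complex.I))] at z
    simp only at z
    refine (cc (mul_left_cancel₀ (hn₁ t ht s) (b := conj (η t s).2.2.2.2.2.1)
      (c := -Complex.I * flux2 (f₁ t) (f₂ t) s) ?_)).trans (by simp)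
    rw [flux2]
    rw [d1] at z
    linear_combination z
  have hm : ∀ s, (η t s).2.2.2.2.2.2.1 = -Complex.I * conj (f₂ t s * f₃ t s) +
      2 * conj (mixTerm (f₁ t) (f₂ t) s) := fun s => by
    have z : 0 - P3 (deriv (η t) s) = _ := congrArg (fun x : G2Coord => x.2.2.1) (zc' s)
    rw [dη s P3 (fun s => (hη t ht s).2.2) (hasDerivAt_const s (0 : ℂ))] at z
    simp only at z
    refine (cc (mul_left_cancel₀ (hn₁ t ht s) (b := conj (η t s).2.2.2.2.2.2.1)
      (c := Complex.I * (f₂ t s * f₃ t s) + 2 * mixTerm (f₁ t) (f₂ t) s) ?_)).trans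
        (by simp [Complex.conj_ofNat])
    have hmm : f₁ t s * mixTerm (f₁ t) (f₂ t) s = conj (f₁ t s) ^ 2 * conj (f₂ t s) := by
      rw [mixTerm, mul_div_cancel₀ _ (hn₁ t ht s)]
    simp only [map_mul, map_neg, Complex.conj_I] at z
    linear_combination z - 2 * hmm - 2 * conj (f₁ t s) ^ 2 * conj (f₂ t s) * Complex.I_mul_I
  have hn : (η t s).2.2.2.2.2.2.2 = -Complex.I * conj (flux3 (f₁ t) (f₂ t) (f₃ t) s) := by
    have z : 0 - P7 (deriv (η t) s) = _ :=
      congrArg (fun x : G2Coord => x.2.2.2.2.2.2.1) (zc' s)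
    rw [dη s P7 hm (((hasDerivAt_conj ((h₂.hasDerivAt ht s).mul
      (h₃.hasDerivAt ht s))).const_mul (-Complex.I)).add
        ((hasDerivAt_conj ((h₁.mixTerm h₂ hn₁).hasDerivAt ht s)).const_mul 2))] at z
    simp only [hl s] at z
    refine mul_left_cancel₀ ((map_ne_zero (starRingEnd ℂ)).2 (hn₂ t ht s)) ?_
    have d2 : deriv (f₂ t) s = logDeriv (f₂ t) s * f₂ t s := by
      rw [logDeriv_apply, div_mul_cancel₀ _ (hn₂ t ht s)]
    have dm : deriv (mixTerm (f₁ t) (f₂ t)) s =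
        deriv (mixTerm (f₁ t) (f₂ t)) s / f₂ t s * f₂ t s := by
      rw [div_mul_cancel₀ _ (hn₂ t ht s)]
    rw [flux3, logDeriv_mul_fun (h₁.hasDerivAt ht s).differentiableAt
      (h₂.hasDerivAt ht s).differentiableAt (hn₁ t ht s) (hn₂ t ht s), div_mul_eq_mul_div,
      mul_div_assoc]
    rw [flux2, d2] at z
    generalize deriv (mixTerm (f₁ t) (f₂ t)) s / f₂ t s = w at *
    rw [dm] at z
    simp only [map_mul, map_neg, map_add, map_sub, Complex.conj_I, Complex.conj_ofNat] at z ⊢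
    linear_combination z + 2 * conj (f₂ t s) * conj w * Complex.I_mul_I
  rw [e0 s, hl, hm, hn]
  rfl

end

end G2Flow

/-! ### Flow frames and solutions of the system -/

namespace G2Flow

section

variable {T : Set ℝ} {F : ℝ → ℝ → E7 →L[ℝ] E7} {η : ℝ → ℝ → G2Coord} {f₁ f₂ f₃ : ℝ → ℝ → ℂ}
  {t s : ℝ}

/-- A frame adapted to a Schrödinger flow, with complex curvature functions `f₁, f₂, f₃`. -/
structure IsFlowFrame (T : Set ℝ) (F : ℝ → ℝ → E7 →L[ℝ] E7) (f₁ f₂ f₃ : ℝ → ℝ → ℂ)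
    (η : ℝ → ℝ → G2Coord) : Prop where
  isFrame : IsFrame T F (fun t s => flowCoord (f₁ t s) (f₂ t s) (f₃ t s)) η
  smooth₁ : SmoothOn T f₁
  smooth₂ : SmoothOn T f₂
  smooth₃ : SmoothOn T f₃
  time_eq : ∀ t ∈ T, ∀ s, (η t s).1 = -Complex.I * deriv (f₁ t) s ∧
      (η t s).2.1 = -Complex.I * (f₁ t s * f₂ t s) ∧ (η t s).2.2.1 = 0

theorem SmoothOn.torus_left (hη : SmoothOn T η) : SmoothOn T (fun t s => (η t s).2.2.2.1) :=
  ContDiffOn.fst (ContDiffOn.snd (ContDiffOn.snd (ContDiffOn.snd hη)))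

theorem SmoothOn.torus_right (hη : SmoothOn T η) : SmoothOn T (fun t s => (η t s).2.2.2.2.1) :=
  ContDiffOn.fst (ContDiffOn.snd (ContDiffOn.snd (ContDiffOn.snd (ContDiffOn.snd hη))))

/-- With the complex coordinates of `η` known from `eq_flowTime`, the structure equation becomes
three evolution equations in which the torus components are still undetermined up to functions of
time. -/
theorem IsFlowFrame.flow_equations (hT : TimeInterval T) (h : IsFlowFrame T F f₁ f₂ f₃ η)
    (hn₁ : ∀ t ∈ T, ∀ s, f₁ t s ≠ 0) (hn₂ : ∀ t ∈ T, ∀ s, f₂ t s ≠ 0) (ht : t ∈ T) (s : ℝ) :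
    Complex.I * timeDeriv T f₁ t s = deriv (deriv (f₁ t)) s - f₁ t s * (f₂ t s * conj (f₂ t s)) -
      ((η t s).2.2.2.1 : ℂ) * f₁ t s ∧
    Complex.I * timeDeriv T f₂ t s = deriv (flux2 (f₁ t) (f₂ t)) s + (((η t s).2.2.2.1 : ℂ) -
      ((η t s).2.2.2.2.1 : ℂ) + 3 * (f₁ t s * conj (f₁ t s))) * f₂ t s -
      f₂ t s * (f₃ t s * conj (f₃ t s)) +
      2 * Complex.I * (mixTerm (f₁ t) (f₂ t) s * conj (f₃ t s)) ∧
    Complex.I * timeDeriv T f₃ t s = deriv (flux3 (f₁ t) (f₂ t) (f₃ t)) s +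
      (((η t s).2.2.2.1 : ℂ) + 2 * ((η t s).2.2.2.2.1 : ℂ)) * f₃ t s +
      f₃ t s * (f₂ t s * conj (f₂ t s)) -
      2 * Complex.I * (mixTerm (f₁ t) (f₂ t) s * conj (f₂ t s)) ∧
    deriv (fun s => (η t s).2.2.2.1) s =
      deriv (fun x => -2 * ‖f₁ t x‖ ^ 2 + ‖f₂ t x‖ ^ 2) s + 2 * density1 (f₁ t) (f₂ t) s ∧
    deriv (fun s => (η t s).2.2.2.1) s - deriv (fun s => (η t s).2.2.2.2.1) s =
      deriv (fun x => -3 * ‖f₁ t x‖ ^ 2 + 2 * ‖f₂ t x‖ ^ 2 - ‖f₃ t x‖ ^ 2) s +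
        2 * density2 (f₁ t) (f₂ t) (f₃ t) s :=
  (zero_curvature_iff (ν₁ := fun s => (η t s).2.2.2.1) (ν₂ := fun s => (η t s).2.2.2.2.1)
    (h.smooth₁.contDiff_slice ht) (h.smooth₂.contDiff_slice ht) (h.smooth₃.contDiff_slice ht)
    (hn₁ t ht) (hn₂ t ht) (h.isFrame.smooth_time.torus_left.hasDerivAt ht s).differentiableAt
    (h.isFrame.smooth_time.torus_right.hasDerivAt ht s).differentiableAt).1 (by
      have e : η t = _ := funext fun s => h.isFrame.eq_flowTime hT h.smooth₁ h.smooth₂ h.smooth₃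
        hn₁ hn₂ h.time_eq ht s
      have z := h.isFrame.zero_curvature hT ht s
      rwa [h.smooth₁.timeDeriv_flowCoord hT h.smooth₂ h.smooth₃ ht, congrFun e s, e] at z)

/-- With normalised torus components, the complex curvature functions solve the system. -/
theorem IsFlowFrame.isNLSTSolution (hT : TimeInterval T) (h : IsFlowFrame T F f₁ f₂ f₃ η)
    (hn₁ : ∀ t ∈ T, ∀ s, f₁ t s ≠ 0) (hn₂ : ∀ t ∈ T, ∀ s, f₂ t s ≠ 0)
    (i₁ : ∀ t ∈ T, (η t 0).2.2.2.1 = -2 * ‖f₁ t 0‖ ^ 2 + ‖f₂ t 0‖ ^ 2)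
    (i₂ : ∀ t ∈ T, (η t 0).2.2.2.1 - (η t 0).2.2.2.2.1 =
      -3 * ‖f₁ t 0‖ ^ 2 + 2 * ‖f₂ t 0‖ ^ 2 - ‖f₃ t 0‖ ^ 2) : IsNLSTSolution T f₁ f₂ f₃ := by
  have E := fun t ht s => h.flow_equations hT hn₁ hn₂ (t := t) ht s
  have sl : ∀ {f : ℝ → ℝ → ℝ}, SmoothOn T f → ∀ t ∈ T, Differentiable ℝ (f t) := fun hf t ht =>
    (hf.contDiff_slice ht).differentiable (by simp)
  have ν1 := h.isFrame.smooth_time.torus_left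
  have ν2 := h.isFrame.smooth_time.torus_right
  have m1 := h.smooth₁.norm_sq
  have m2 := h.smooth₂.norm_sq
  have m3 := h.smooth₃.norm_sq
  -- The space derivatives of `ν₁` and `ν₁ - ν₂` are prescribed, so the normalisation at `s = 0`
  -- turns the torus components into `torus1` and `torus2`.
  have t1 : ∀ t ∈ T, ∀ s, (η t s).2.2.2.1 = torus1 (f₁ t) (f₂ t) s := fun t ht s =>
    eq_add_integral (sl ν1 t ht) (((sl m1 t ht).const_mul (-2)).add (sl m2 t ht))
      ((h.smooth₁.density1 hT h.smooth₂ hn₁).contDiff_slice ht).continuous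
      (fun s => (E t ht s).2.2.2.1) (i₁ t ht) s
  have t2 : ∀ t ∈ T, ∀ s, (η t s).2.2.2.2.1 = torus2 (f₁ t) (f₂ t) (f₃ t) s := fun t ht s => by
    have := eq_add_integral ((sl ν1 t ht).sub (sl ν2 t ht))
      ((((sl m1 t ht).const_mul (-3)).add ((sl m2 t ht).const_mul 2)).sub (sl m3 t ht))
      ((h.smooth₁.density2 hT h.smooth₂ h.smooth₃ hn₁ hn₂).contDiff_slice ht).continuous
      (fun s => (((ν1.hasDerivAt ht s).sub (ν2.hasDerivAt ht s)).deriv).trans (E t ht s).2.2.2.2)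
      (i₂ t ht) s
    rw [torus2, ← t1 t ht s]
    simp only [Pi.sub_apply, Pi.add_apply] at this
    linear_combination -this
  refine ⟨h.smooth₁, h.smooth₂, h.smooth₃, hn₁, hn₂, fun t ht s => ?_, fun t ht s => ?_,
    fun t ht s => ?_⟩
  · rw [rhs1_eq, (E t ht s).1, t1 t ht s]
  · rw [rhs2_eq hT h.smooth₁ h.smooth₂ hn₁ ht, (E t ht s).2.1, t1 t ht s, t2 t ht s]
  · rw [rhs3_eq hT h.smooth₁ h.smooth₂ h.smooth₃ hn₁ hn₂ ht, (E t ht s).2.2.1, t1 t ht s,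
      t2 t ht s]

theorem SmoothOn.torus1 (hT : TimeInterval T) (h₁ : SmoothOn T f₁) (h₂ : SmoothOn T f₂)
    (hn₁ : ∀ t ∈ T, ∀ s, f₁ t s ≠ 0) : SmoothOn T (fun t s => torus1 (f₁ t) (f₂ t) s) :=
  ContDiffOn.add (ContDiffOn.add (contDiffOn_const.mul h₁.norm_sq) h₂.norm_sq)
    (contDiffOn_const.mul ((h₁.density1 hT h₂ hn₁).integral hT))

theorem SmoothOn.torus2 (hT : TimeInterval T) (h₁ : SmoothOn T f₁) (h₂ : SmoothOn T f₂)
    (h₃ : SmoothOn T f₃) (hn₁ : ∀ t ∈ T, ∀ s, f₁ t s ≠ 0) (hn₂ : ∀ t ∈ T, ∀ s, f₂ t s ≠ 0) :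
    SmoothOn T (fun t s => torus2 (f₁ t) (f₂ t) (f₃ t) s) :=
  ContDiffOn.sub (h₁.torus1 hT h₂ hn₁) (ContDiffOn.add (ContDiffOn.sub (ContDiffOn.add
    (contDiffOn_const.mul h₁.norm_sq) (contDiffOn_const.mul h₂.norm_sq)) h₃.norm_sq)
    (contDiffOn_const.mul ((h₁.density2 hT h₂ h₃ hn₁ hn₂).integral hT)))

/-- Solutions of the system come from frames. -/
theorem IsNLSTSolution.exists_isFlowFrame (hT : TimeInterval T) (h : IsNLSTSolution T f₁ f₂ f₃) :
    ∃ F η, IsFlowFrame T F f₁ f₂ f₃ η := by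
  obtain ⟨h₁, h₂, h₃, hn₁, hn₂, q₁, q₂, q₃⟩ := h
  have s1 := h₁.torus1 hT h₂ hn₁
  have s2 := h₁.torus2 hT h₂ h₃ hn₁ hn₂
  have m1 := h₁.norm_sq
  have m2 := h₂.norm_sq
  have m3 := h₃.norm_sq
  have sη := h₁.flowTime hT h₂ h₃ hn₁ hn₂ s1 s2
  obtain ⟨F, -, hF⟩ := exists_isFrame_of_zero_curvature hT (h₁.flowCoord h₂ h₃) sη (by
    intro t ht s
    rw [h₁.timeDeriv_flowCoord hT h₂ h₃ ht]
    have c1 := ((h₁.density1 hT h₂ hn₁).contDiff_slice ht).continuous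
    have c2 := ((h₁.density2 hT h₂ h₃ hn₁ hn₂).contDiff_slice ht).continuous
    have D1 : deriv (torus1 (f₁ t) (f₂ t)) s = _ :=
      ((((m1.hasDerivAt ht s).const_mul (-2)).add (m2.hasDerivAt ht s)).add
        ((hasDerivAt_integral c1 s).const_mul 2)).deriv
    have D2 : deriv (torus2 (f₁ t) (f₂ t) (f₃ t)) s = _ :=
      ((s1.hasDerivAt ht s).sub (((((m1.hasDerivAt ht s).const_mul (-3)).add
        ((m2.hasDerivAt ht s).const_mul 2)).sub (m3.hasDerivAt ht s)).add
        ((hasDerivAt_integral c2 s).const_mul 2))).deriv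
    refine (zero_curvature_iff (h₁.contDiff_slice ht) (h₂.contDiff_slice ht)
      (h₃.contDiff_slice ht) (hn₁ t ht) (hn₂ t ht) (s1.hasDerivAt ht s).differentiableAt
      (s2.hasDerivAt ht s).differentiableAt).2 ⟨?_, ?_, ?_, ?_, ?_⟩
    · rw [q₁ t ht, rhs1_eq]
    · rw [q₂ t ht, rhs2_eq hT h₁ h₂ hn₁ ht]
    · rw [q₃ t ht, rhs3_eq hT h₁ h₂ h₃ hn₁ hn₂ ht]
    · have e : deriv (fun x => -2 * ‖f₁ t x‖ ^ 2 + ‖f₂ t x‖ ^ 2) s = _ :=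
        (((m1.hasDerivAt ht s).const_mul (-2)).add (m2.hasDerivAt ht s)).deriv
      rw [e]
      exact D1
    · have e : deriv (fun x => -3 * ‖f₁ t x‖ ^ 2 + 2 * ‖f₂ t x‖ ^ 2 - ‖f₃ t x‖ ^ 2) s = _ :=
        ((((m1.hasDerivAt ht s).const_mul (-3)).add
        ((m2.hasDerivAt ht s).const_mul 2)).sub (m3.hasDerivAt ht s)).deriv
      rw [e]
      refine (congrArg (fun x => deriv (torus1 (f₁ t) (f₂ t)) s - x) D2).trans ?_
      simp only [sub_sub_cancel])
  exact ⟨F, _, hF, h₁, h₂, h₃, fun t ht s => ⟨rfl, rfl, rfl⟩⟩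

/-- Frames with the same complex curvature functions differ by an element of `G₂`. -/
theorem IsFlowFrame.exists_isG2Map (hT : TimeInterval T) {F' : ℝ → ℝ → E7 →L[ℝ] E7}
    {η' : ℝ → ℝ → G2Coord} (h : IsFlowFrame T F f₁ f₂ f₃ η) (h' : IsFlowFrame T F' f₁ f₂ f₃ η')
    (hn₁ : ∀ t ∈ T, ∀ s, f₁ t s ≠ 0) (hn₂ : ∀ t ∈ T, ∀ s, f₂ t s ≠ 0) :
    ∃ g, IsG2Map g ∧ ∀ t ∈ T, ∀ s, F' t s = g * F t s := by
  refine h.isFrame.exists_isG2Map hT h'.isFrame (fun _ _ _ => rfl) fun t ht s => ?_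
  have E := h.flow_equations hT hn₁ hn₂ ht s
  have E' := h'.flow_equations hT hn₁ hn₂ ht s
  -- The time derivatives of the two frames can differ only in the torus components. The first
  -- evolution equation determines `ν₁` since `f₁ ≠ 0`, and the second then determines `ν₂` since
  -- `f₂ ≠ 0`.
  have e1 : (η' t s).2.2.2.1 = (η t s).2.2.2.1 := by
    have := mul_right_cancel₀ (hn₁ t ht s) (sub_right_injective (E'.1.symm.trans E.1))
    exact_mod_cast this
  have e2 : (η' t s).2.2.2.2.1 = (η t s).2.2.2.2.1 := by
    have := E'.2.1.symm.trans E.2.1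
    rw [e1] at this
    have := mul_right_cancel₀ (hn₂ t ht s) (a := ((η' t s).2.2.2.2.1 : ℂ))
      (c := ((η t s).2.2.2.2.1 : ℂ)) (by linear_combination -this)
    exact_mod_cast this
  rw [h'.isFrame.eq_flowTime hT h.smooth₁ h.smooth₂ h.smooth₃ hn₁ hn₂ h'.time_eq ht s,
    h.isFrame.eq_flowTime hT h.smooth₁ h.smooth₂ h.smooth₃ hn₁ hn₂ h.time_eq ht s, e1, e2]

end

end G2Flow

namespace G2Flow

/-! ### The Frenet frame -/

/-- The logarithmic derivative of the `G₂`-Frenet frame. -/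
def frenetCoord (m r₁ r₂ c : ℝ) (a : ℂ) : G2Coord := ((m / 2 : ℝ), 0, 0, -r₁, -r₂, c, 0, a)

theorem frenetCoord_zero (m r₁ r₂ c : ℝ) (a : ℂ) :
    g2Lie (frenetCoord m r₁ r₂ c a) (stdVec 0) = m • stdVec 1 := by
  rw [g2Lie_apply]
  ext i
  fin_cases i <;> simp [frenetCoord, g2Act, stdVec_apply]
  ring

theorem frenetCoord_one (m r₁ r₂ c : ℝ) (a : ℂ) :
    g2Lie (frenetCoord m r₁ r₂ c a) (stdVec 1) =
      -m • stdVec 0 - r₁ • stdVec 2 + c • stdVec 3 := by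
  rw [g2Lie_apply]
  ext i
  fin_cases i <;> simp [frenetCoord, g2Act, stdVec_apply]
  ring

theorem frenetCoord_three (m r₁ r₂ c : ℝ) (a : ℂ) :
    g2Lie (frenetCoord m r₁ r₂ c a) (stdVec 3) =
      -c • stdVec 1 - r₂ • stdVec 4 + a.re • stdVec 5 - (a.im + m / 2) • stdVec 6 := by
  rw [g2Lie_apply]
  ext i
  fin_cases i <;> simp [frenetCoord, g2Act, stdVec_apply]

theorem frenetCoord_five (m r₁ r₂ c : ℝ) (a : ℂ) :
    g2Lie (frenetCoord m r₁ r₂ c a) (stdVec 5) =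
      -a.re • stdVec 3 + (a.im - m / 2) • stdVec 4 - (r₁ + r₂) • stdVec 6 := by
  rw [g2Lie_apply]
  ext i
  fin_cases i <;> simp [frenetCoord, g2Act, stdVec_apply]
  ring

theorem IsG2Map.inner_stdVec {F : E7 →L[ℝ] E7} (hF : IsG2Map F) (x : E7) (i : Fin 7) :
    inner ℝ (F x) (F (stdVec i)) = x i := by
  rw [hF.2, inner_stdVec_right]

theorem norm_sq_eq (x : E7) : ‖x‖ ^ 2 = inner ℝ x x := (real_inner_self_eq_norm_sq x).symm

theorem norm_stdVec (i : Fin 7) : ‖stdVec i‖ = 1 := by simp [stdVec]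

section Recognition

variable {F : ℝ → E7 →L[ℝ] E7} {m r₁ r₂ c : ℝ → ℝ} {a : ℝ → ℂ}

theorem hasDerivAt_apply {F' : E7 →L[ℝ] E7} {s : ℝ} (h : HasDerivAt F F' s) (x : E7) :
    HasDerivAt (fun s => F s x) (F' x) s :=
  hasDerivWithinAt_univ.1 (hasDerivWithinAt_apply h.hasDerivWithinAt x)

/-- This and the next lemmas read the invariants off any frame whose derivative has Frenet form.
Positivity of `m`, and later of `c`, makes the normalised vectors in the definitions equal to
columns of `F`, up to sign for `I₅` and `I₆`. -/
theorem k1_eq_of_frenet (hF : ∀ s, IsG2Map (F s)) (hd : ∀ s, HasDerivAt F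
    (F s * g2Lie (frenetCoord (m s) (r₁ s) (r₂ s) (c s) (a s))) s) (hm : ∀ s, 0 < m s) (s : ℝ) :
    k1 (fun s => F s (stdVec 0)) s = m s := by
  rw [k1, (hasDerivAt_apply (hd s) (stdVec 0)).deriv, clm_mul_apply, frenetCoord_zero, map_smul,
    norm_smul, (hF s).norm_map, norm_stdVec, mul_one, Real.norm_of_nonneg (hm s).le]

theorem frame1_eq_of_frenet (hF : ∀ s, IsG2Map (F s)) (hd : ∀ s, HasDerivAt F
    (F s * g2Lie (frenetCoord (m s) (r₁ s) (r₂ s) (c s) (a s))) s) (hm : ∀ s, 0 < m s) :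
    frame1 (fun s => F s (stdVec 0)) = fun s => F s (stdVec 1) := by
  funext s
  rw [frame1, k1_eq_of_frenet hF hd hm, (hasDerivAt_apply (hd s) (stdVec 0)).deriv, clm_mul_apply,
    frenetCoord_zero, map_smul, inv_smul_smul₀ (hm s).ne']

theorem deriv_frame1_of_frenet (hF : ∀ s, IsG2Map (F s)) (hd : ∀ s, HasDerivAt F
    (F s * g2Lie (frenetCoord (m s) (r₁ s) (r₂ s) (c s) (a s))) s) (hm : ∀ s, 0 < m s) (s : ℝ) :
    deriv (frame1 (fun s => F s (stdVec 0))) s =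
      F s (-m s • stdVec 0 - r₁ s • stdVec 2 + c s • stdVec 3) := by
  rw [frame1_eq_of_frenet hF hd hm, (hasDerivAt_apply (hd s) (stdVec 1)).deriv, clm_mul_apply,
    frenetCoord_one]

theorem frame5_eq_of_frenet (hF : ∀ s, IsG2Map (F s)) (hd : ∀ s, HasDerivAt F
    (F s * g2Lie (frenetCoord (m s) (r₁ s) (r₂ s) (c s) (a s))) s) (hm : ∀ s, 0 < m s) (s : ℝ) :
    frame5 (fun s => F s (stdVec 0)) s = -F s (stdVec 2) := by
  rw [frame5, frame1_eq_of_frenet hF hd hm, ← (hF s).1, cross_anticomm, cross_stdVec_zero_one,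
    map_neg]

theorem rho1_eq_of_frenet (hF : ∀ s, IsG2Map (F s)) (hd : ∀ s, HasDerivAt F
    (F s * g2Lie (frenetCoord (m s) (r₁ s) (r₂ s) (c s) (a s))) s) (hm : ∀ s, 0 < m s) (s : ℝ) :
    rho1 (fun s => F s (stdVec 0)) s = r₁ s := by
  rw [rho1, deriv_frame1_of_frenet hF hd hm, frame5_eq_of_frenet hF hd hm, inner_neg_right,
    (hF s).inner_stdVec]
  simp [stdVec_apply]

theorem kappa2_eq_of_frenet (hF : ∀ s, IsG2Map (F s)) (hd : ∀ s, HasDerivAt F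
    (F s * g2Lie (frenetCoord (m s) (r₁ s) (r₂ s) (c s) (a s))) s) (hm : ∀ s, 0 < m s)
    (hc : ∀ s, 0 ≤ c s) (s : ℝ) : kappa2 (fun s => F s (stdVec 0)) s = c s := by
  have h := rho1_eq_of_frenet hF hd hm s
  rw [rho1] at h
  rw [kappa2, h, deriv_frame1_of_frenet hF hd hm, (hF s).inner_stdVec, norm_sq_eq, (hF s).2,
    inner_eq]
  refine (congrArg Real.sqrt ?_).trans (Real.sqrt_sq (hc s))
  simp [stdVec_apply]
  ring

theorem frame2_eq_of_frenet (hF : ∀ s, IsG2Map (F s)) (hd : ∀ s, HasDerivAt F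
    (F s * g2Lie (frenetCoord (m s) (r₁ s) (r₂ s) (c s) (a s))) s) (hm : ∀ s, 0 < m s)
    (hc : ∀ s, 0 < c s) : frame2 (fun s => F s (stdVec 0)) = fun s => F s (stdVec 3) := by
  funext s
  have h := rho1_eq_of_frenet hF hd hm s
  rw [rho1] at h
  rw [frame2, kappa2_eq_of_frenet hF hd hm fun s => (hc s).le, h, deriv_frame1_of_frenet hF hd hm,
    (hF s).inner_stdVec, frame5_eq_of_frenet hF hd hm, inv_smul_eq_iff₀ (hc s).ne']
  have : (-m s • stdVec 0 - r₁ s • stdVec 2 + c s • stdVec 3) 0 = -m s := by simp [stdVec_apply]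
  rw [this, map_add, map_sub, map_smul, map_smul, map_smul, smul_neg]
  abel

theorem deriv_frame2_of_frenet (hF : ∀ s, IsG2Map (F s)) (hd : ∀ s, HasDerivAt F
    (F s * g2Lie (frenetCoord (m s) (r₁ s) (r₂ s) (c s) (a s))) s) (hm : ∀ s, 0 < m s)
    (hc : ∀ s, 0 < c s) (s : ℝ) : deriv (frame2 (fun s => F s (stdVec 0))) s =
      F s (-c s • stdVec 1 - r₂ s • stdVec 4 + (a s).re • stdVec 5 -
        ((a s).im + m s / 2) • stdVec 6) := by
  rw [frame2_eq_of_frenet hF hd hm hc, (hasDerivAt_apply (hd s) (stdVec 3)).deriv, clm_mul_apply,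
    frenetCoord_three]

theorem frame3_eq_of_frenet (hF : ∀ s, IsG2Map (F s)) (hd : ∀ s, HasDerivAt F
    (F s * g2Lie (frenetCoord (m s) (r₁ s) (r₂ s) (c s) (a s))) s) (hm : ∀ s, 0 < m s)
    (hc : ∀ s, 0 < c s) : frame3 (fun s => F s (stdVec 0)) = fun s => F s (stdVec 5) := by
  funext s
  rw [frame3, frame1_eq_of_frenet hF hd hm, frame2_eq_of_frenet hF hd hm hc, ← (hF s).1,
    cross_stdVec_one_three]

theorem frame6_eq_of_frenet (hF : ∀ s, IsG2Map (F s)) (hd : ∀ s, HasDerivAt F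
    (F s * g2Lie (frenetCoord (m s) (r₁ s) (r₂ s) (c s) (a s))) s) (hm : ∀ s, 0 < m s)
    (hc : ∀ s, 0 < c s) (s : ℝ) : frame6 (fun s => F s (stdVec 0)) s = -F s (stdVec 4) := by
  rw [frame6, frame2_eq_of_frenet hF hd hm hc, ← (hF s).1, cross_anticomm,
    cross_stdVec_zero_three, map_neg]

theorem cross_stdVec_five_zero : cross (stdVec 5) (stdVec 0) = stdVec 6 := by
  ext i; fin_cases i <;> simp [cross_eq, stdVec_apply]

theorem frame7_eq_of_frenet (hF : ∀ s, IsG2Map (F s)) (hd : ∀ s, HasDerivAt F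
    (F s * g2Lie (frenetCoord (m s) (r₁ s) (r₂ s) (c s) (a s))) s) (hm : ∀ s, 0 < m s)
    (hc : ∀ s, 0 < c s) (s : ℝ) : frame7 (fun s => F s (stdVec 0)) s = F s (stdVec 6) := by
  rw [frame7, frame3_eq_of_frenet hF hd hm hc, ← (hF s).1, cross_stdVec_five_zero]

theorem rho2_eq_of_frenet (hF : ∀ s, IsG2Map (F s)) (hd : ∀ s, HasDerivAt F
    (F s * g2Lie (frenetCoord (m s) (r₁ s) (r₂ s) (c s) (a s))) s) (hm : ∀ s, 0 < m s)
    (hc : ∀ s, 0 < c s) (s : ℝ) : rho2 (fun s => F s (stdVec 0)) s = r₂ s := by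
  rw [rho2, deriv_frame2_of_frenet hF hd hm hc, frame6_eq_of_frenet hF hd hm hc, inner_neg_right,
    (hF s).inner_stdVec]
  simp [stdVec_apply]

theorem alpha_eq_of_frenet (hF : ∀ s, IsG2Map (F s)) (hd : ∀ s, HasDerivAt F
    (F s * g2Lie (frenetCoord (m s) (r₁ s) (r₂ s) (c s) (a s))) s) (hm : ∀ s, 0 < m s)
    (hc : ∀ s, 0 < c s) (s : ℝ) : alpha (fun s => F s (stdVec 0)) s = (a s).re := by
  rw [alpha, deriv_frame2_of_frenet hF hd hm hc, frame3_eq_of_frenet hF hd hm hc,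
    (hF s).inner_stdVec]
  simp [stdVec_apply]

/-- Individually `β₁ = -(Im a + m / 2)` and `β₂ = -(Im a - m / 2)`. Their difference is forced by
the Lie algebra of `G₂`, so only the sum is a new invariant. -/
theorem beta_eq_of_frenet (hF : ∀ s, IsG2Map (F s)) (hd : ∀ s, HasDerivAt F
    (F s * g2Lie (frenetCoord (m s) (r₁ s) (r₂ s) (c s) (a s))) s) (hm : ∀ s, 0 < m s)
    (hc : ∀ s, 0 < c s) (s : ℝ) :
    beta1 (fun s => F s (stdVec 0)) s + beta2 (fun s => F s (stdVec 0)) s = -2 * (a s).im := by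
  rw [beta1, beta2, deriv_frame2_of_frenet hF hd hm hc, frame7_eq_of_frenet hF hd hm hc,
    frame3_eq_of_frenet hF hd hm hc, (hasDerivAt_apply (hd s) (stdVec 5)).deriv, clm_mul_apply,
    frenetCoord_five, frame6_eq_of_frenet hF hd hm hc, inner_neg_right,
    (hF s).inner_stdVec, (hF s).inner_stdVec]
  simp [stdVec_apply]
  ring

end Recognition

/-! ### Existence of the Frenet frame -/

section Existence

variable {T : Set ℝ} {u : ℝ → ℝ → E7} {t s : ℝ}

theorem SmoothOn.k1 (hT : TimeInterval T) (hu : SmoothOn T u)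
    (hk : ∀ t ∈ T, ∀ s, k1 (u t) s ≠ 0) : SmoothOn T (fun t s => k1 (u t) s) :=
  ContDiffOn.norm ℝ (hu.deriv hT) fun p hp => norm_ne_zero_iff.1 (hk p.1 hp.1 p.2)

theorem SmoothOn.frame1 (hT : TimeInterval T) (hu : SmoothOn T u)
    (hk : ∀ t ∈ T, ∀ s, G2Flow.k1 (u t) s ≠ 0) : SmoothOn T (fun t s => frame1 (u t) s) :=
  ContDiffOn.smul (ContDiffOn.inv (hu.k1 hT hk) fun p hp => hk p.1 hp.1 p.2) (hu.deriv hT)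

theorem SmoothOn.inner {v w : ℝ → ℝ → E7} (hv : SmoothOn T v) (hw : SmoothOn T w) :
    SmoothOn T (fun t s => (inner ℝ (v t s) (w t s) : ℝ)) :=
  ContDiffOn.inner ℝ hv hw

theorem SmoothOn.frame5 (hT : TimeInterval T) (hu : SmoothOn T u)
    (hk : ∀ t ∈ T, ∀ s, G2Flow.k1 (u t) s ≠ 0) : SmoothOn T (fun t s => frame5 (u t) s) :=
  (hu.frame1 hT hk).cross hu

theorem SmoothOn.rho1 (hT : TimeInterval T) (hu : SmoothOn T u)
    (hk : ∀ t ∈ T, ∀ s, G2Flow.k1 (u t) s ≠ 0) : SmoothOn T (fun t s => rho1 (u t) s) :=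
  ((hu.frame1 hT hk).deriv hT).inner (hu.frame5 hT hk)

theorem SmoothOn.kappa2 (hT : TimeInterval T) (hu : SmoothOn T u)
    (hk : ∀ t ∈ T, ∀ s, G2Flow.k1 (u t) s ≠ 0) (hκ : ∀ t ∈ T, ∀ s, kappa2 (u t) s ≠ 0) :
    SmoothOn T (fun t s => kappa2 (u t) s) := by
  refine ContDiffOn.sqrt (ContDiffOn.sub (ContDiffOn.sub
    ((hu.frame1 hT hk).deriv hT).norm_sq
    (ContDiffOn.pow (((hu.frame1 hT hk).deriv hT).inner hu) 2))
    (ContDiffOn.pow (hu.rho1 hT hk) 2)) fun p hp h => hκ p.1 hp.1 p.2 ?_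
  exact (congrArg Real.sqrt h).trans Real.sqrt_zero

theorem SmoothOn.frame2 (hT : TimeInterval T) (hu : SmoothOn T u)
    (hk : ∀ t ∈ T, ∀ s, G2Flow.k1 (u t) s ≠ 0) (hκ : ∀ t ∈ T, ∀ s, G2Flow.kappa2 (u t) s ≠ 0) :
    SmoothOn T (fun t s => frame2 (u t) s) :=
  ContDiffOn.smul (ContDiffOn.inv (hu.kappa2 hT hk hκ) fun p hp => hκ p.1 hp.1 p.2)
    (ContDiffOn.sub (ContDiffOn.sub ((hu.frame1 hT hk).deriv hT)
      (ContDiffOn.smul (((hu.frame1 hT hk).deriv hT).inner hu) hu))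
      (ContDiffOn.smul (hu.rho1 hT hk) (hu.frame5 hT hk)))

theorem inner_deriv_self {v : ℝ → E7} {s : ℝ} (hv : DifferentiableAt ℝ v s)
    (h : ∀ s, inner ℝ (v s) (v s) = (1 : ℝ)) : inner ℝ (deriv v s) (v s) = (0 : ℝ) := by
  have h1 := hv.hasDerivAt.inner ℝ hv.hasDerivAt
  simp only [h] at h1
  have h2 := h1.unique (hasDerivAt_const s (1 : ℝ))
  rw [real_inner_comm (deriv v s) (v s)] at h2
  linarith

theorem inner_self_eq_one {x : E7} (h : ‖x‖ = 1) : inner ℝ x x = (1 : ℝ) := by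
  rw [← norm_sq_eq, h, one_pow]

theorem deriv_eq_k1_smul {w : ℝ → E7} {s : ℝ} (hk : k1 w s ≠ 0) :
    deriv w s = k1 w s • frame1 w s := by
  rw [frame1, smul_inv_smul₀ hk]

theorem inner_frame1_self {w : ℝ → E7} {s : ℝ} (hk : k1 w s ≠ 0) :
    inner ℝ (frame1 w s) (frame1 w s) = (1 : ℝ) := by
  apply inner_self_eq_one
  rw [frame1, norm_smul, norm_inv, k1, norm_norm]
  exact inv_mul_cancel₀ hk

theorem inner_frame1_tangent {w : ℝ → E7} {s : ℝ} (hw : DifferentiableAt ℝ w s)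
    (h : ∀ s, ‖w s‖ = 1) : inner ℝ (frame1 w s) (w s) = (0 : ℝ) := by
  rw [frame1, inner_smul_left, inner_deriv_self hw fun s => inner_self_eq_one (h s), mul_zero]

theorem inner_cross_cross_right {x y : E7} (hx : inner ℝ x x = (1 : ℝ)) (hy : inner ℝ y y = (1 : ℝ))
    (hxy : inner ℝ x y = (0 : ℝ)) : inner ℝ (cross x y) (cross x y) = (1 : ℝ) := by
  rw [inner_cross_cyclic, cross_anticomm x y, cross_neg_right, cross_cross_self, hy,
    real_inner_comm x y, hxy, zero_smul, add_zero, neg_smul, one_smul, neg_neg, hx]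

/-- The defining decomposition of the derivative of the first normal. -/
theorem deriv_frame1_eq {w : ℝ → E7} {s : ℝ} (hκ : kappa2 w s ≠ 0) : deriv (frame1 w) s =
    (inner ℝ (deriv (frame1 w) s) (w s) : ℝ) • w s + rho1 w s • frame5 w s +
      kappa2 w s • frame2 w s := by
  rw [frame2, smul_inv_smul₀ hκ, rho1]
  abel

theorem exists_frenet_frame (hT : TimeInterval T) (hu : SmoothOn T u)
    (h1 : ∀ t ∈ T, ∀ s, ‖u t s‖ = 1) (hk : ∀ t ∈ T, ∀ s, k1 (u t) s ≠ 0)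
    (hκ : ∀ t ∈ T, ∀ s, kappa2 (u t) s ≠ 0) :
    ∃ F η, IsFrame T F (fun t s => frenetCoord (k1 (u t) s) (rho1 (u t) s) (rho2 (u t) s)
      (kappa2 (u t) s) ⟨alpha (u t) s, -(beta1 (u t) s + beta2 (u t) s) / 2⟩) η ∧
      ∀ t ∈ T, ∀ s, F t s (stdVec 0) = u t s := by
  have sI1 := hu.frame1 hT hk
  have sI2 := hu.frame2 hT hk hκ
  have dif : ∀ {v : ℝ → ℝ → E7}, SmoothOn T v → ∀ t ∈ T, ∀ s, DifferentiableAt ℝ (v t) s :=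
    fun hv t ht s => (hv.hasDerivAt ht s).differentiableAt
  have ip : ∀ t ∈ T, ∀ s, inner ℝ (frame1 (u t) s) (u t s) = (0 : ℝ) := fun t ht s =>
    inner_frame1_tangent (dif hu t ht s) (h1 t ht)
  have pp : ∀ t ∈ T, ∀ s, inner ℝ (frame1 (u t) s) (frame1 (u t) s) = (1 : ℝ) := fun t ht s =>
    inner_frame1_self (hk t ht s)
  have uu : ∀ t ∈ T, ∀ s, inner ℝ (u t s) (u t s) = (1 : ℝ) := fun t ht s =>
    inner_self_eq_one (h1 t ht s)
  have d1p : ∀ t ∈ T, ∀ s, inner ℝ (deriv (frame1 (u t)) s) (frame1 (u t) s) = (0 : ℝ) :=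
    fun t ht s => inner_deriv_self (dif sI1 t ht s) (pp t ht)
  have f55 : ∀ t ∈ T, ∀ s, inner ℝ (frame5 (u t) s) (frame5 (u t) s) = (1 : ℝ) := fun t ht s =>
    inner_cross_cross_right (pp t ht s) (uu t ht s) (ip t ht s)
  have f5u : ∀ t s, inner ℝ (frame5 (u t) s) (u t s) = (0 : ℝ) := fun t s =>
    inner_cross_self_right _ _
  have f5p : ∀ t s, inner ℝ (frame5 (u t) s) (frame1 (u t) s) = (0 : ℝ) := fun t s =>
    inner_cross_self_left _ _
  have qu : ∀ t ∈ T, ∀ s, inner ℝ (frame2 (u t) s) (u t s) = (0 : ℝ) := fun t ht s => by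
    rw [frame2, inner_smul_left, inner_sub_left, inner_sub_left, inner_smul_left, inner_smul_left,
      uu t ht s, f5u]
    simp
  have qp : ∀ t ∈ T, ∀ s, inner ℝ (frame2 (u t) s) (frame1 (u t) s) = (0 : ℝ) := fun t ht s => by
    rw [frame2, inner_smul_left, inner_sub_left, inner_sub_left, inner_smul_left, inner_smul_left,
      d1p t ht s, f5p, real_inner_comm (frame1 (u t) s) (u t s), ip t ht s]
    simp
  have q5 : ∀ t ∈ T, ∀ s, inner ℝ (frame2 (u t) s) (frame5 (u t) s) = (0 : ℝ) := fun t ht s => by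
    rw [frame2, inner_smul_left, inner_sub_left, inner_sub_left, inner_smul_left, inner_smul_left,
      f55 t ht s, real_inner_comm (frame5 (u t) s) (u t s), f5u]
    simp
  have qq : ∀ t ∈ T, ∀ s, inner ℝ (frame2 (u t) s) (frame2 (u t) s) = (1 : ℝ) := fun t ht s => by
    -- `Real.sqrt` is zero on negative numbers, so `κ₂ ≠ 0` shows that the radicand is nonnegative
    -- and equals `κ₂²`.
    have hX : 0 ≤ ‖deriv (frame1 (u t)) s‖ ^ 2 - inner ℝ (deriv (frame1 (u t)) s) (u t s) ^ 2 -
        inner ℝ (deriv (frame1 (u t)) s) (frame5 (u t) s) ^ 2 := by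
      by_contra hX
      exact hκ t ht s (Real.sqrt_eq_zero_of_nonpos (not_le.1 hX).le)
    have h2 := Real.sq_sqrt hX
    change kappa2 (u t) s ^ 2 = _ at h2
    have e := congrArg (fun v : E7 => (inner ℝ v v : ℝ)) (deriv_frame1_eq (hκ t ht s))
    simp only [inner_add_left, inner_add_right, inner_smul_left, inner_smul_right, uu t ht s,
      f55 t ht s, f5u, qu t ht s, q5 t ht s, real_inner_comm (frame5 (u t) s) (u t s),
      real_inner_comm (frame2 (u t) s) (u t s), real_inner_comm (frame2 (u t) s) (frame5 (u t) s),
      conj_trivial, mul_zero, mul_one, add_zero, zero_add] at e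
    rw [← norm_sq_eq] at e
    have h3 : kappa2 (u t) s ^ 2 ≠ 0 := pow_ne_zero 2 (hκ t ht s)
    rw [← rho1] at h2
    refine mul_left_cancel₀ h3 ?_
    linarith
  have uxp : ∀ t s, cross (u t s) (frame1 (u t) s) = -frame5 (u t) s := fun t s => by
    rw [frame5, cross_anticomm]
  have hG : ∀ t ∈ T, ∀ s, IsG2Map (frameMap (u t s) (frame1 (u t) s) (frame2 (u t) s)) :=
    fun t ht s => isG2Map_frameMap (uu t ht s) (pp t ht s) (qq t ht s)
      ((real_inner_comm _ _).trans (ip t ht s)) ((real_inner_comm _ _).trans (qu t ht s))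
      ((real_inner_comm _ _).trans (qp t ht s)) (by
        rw [← inner_cross_cyclic, uxp, inner_neg_left, real_inner_comm, q5 t ht s, neg_zero])
  obtain ⟨κ, η, h⟩ := exists_isFrame hT (hu.frameMap sI1 sI2) hG
  have F0 : ∀ t s, frameMap (u t s) (frame1 (u t) s) (frame2 (u t) s) (stdVec 0) = u t s :=
    fun t s => by rw [frameMap_apply]; simp [stdVec_apply]
  have F1 : ∀ t s, frameMap (u t s) (frame1 (u t) s) (frame2 (u t) s) (stdVec 1) =
    frame1 (u t) s := fun t s => by rw [frameMap_apply]; simp [stdVec_apply]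
  have F2 : ∀ t s, frameMap (u t s) (frame1 (u t) s) (frame2 (u t) s) (stdVec 2) =
    -frame5 (u t) s := fun t s => by rw [frameMap_apply, uxp]; simp [stdVec_apply]
  have F3 : ∀ t s, frameMap (u t s) (frame1 (u t) s) (frame2 (u t) s) (stdVec 3) =
    frame2 (u t) s := fun t s => by rw [frameMap_apply]; simp [stdVec_apply]
  have L0 : ∀ t ∈ T, ∀ s, g2Lie (κ t s) (stdVec 0) = k1 (u t) s • stdVec 1 := fun t ht s => by
    apply (hG t ht s).equiv.injective
    simp only [(hG t ht s).equiv_apply, map_smul, F1]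
    rw [← deriv_eq_k1_smul (hk t ht s), ← clm_mul_apply]
    have := hasDerivAt_apply (h.space t ht s) (stdVec 0)
    simp only [F0] at this
    exact this.deriv.symm
  have L1 : ∀ t ∈ T, ∀ s, g2Lie (κ t s) (stdVec 1) =
      (inner ℝ (deriv (frame1 (u t)) s) (u t s) : ℝ) • stdVec 0 - rho1 (u t) s • stdVec 2 +
        kappa2 (u t) s • stdVec 3 := fun t ht s => by
    apply (hG t ht s).equiv.injective
    simp only [(hG t ht s).equiv_apply, map_smul, map_add, map_sub, F0, F2, F3, smul_neg,
      sub_neg_eq_add]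
    rw [← deriv_frame1_eq (hκ t ht s), ← clm_mul_apply]
    have := hasDerivAt_apply (h.space t ht s) (stdVec 1)
    simp only [F1] at this
    exact this.deriv.symm
  -- The images of `e₀` and `e₁` fix all coordinates except the second torus component and the last
  -- one. The recognition lemmas identify these two with `-ρ₂` and the torsion.
  have form : ∀ t ∈ T, ∀ s, κ t s = frenetCoord (k1 (u t) s) (rho1 (u t) s)
      (-(κ t s).2.2.2.2.1) (kappa2 (u t) s) (κ t s).2.2.2.2.2.2.2 := fun t ht s => by
    conv_lhs => rw [← g2Coord_g2Lie (κ t s)]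
    have e := g2Coord_g2Lie (κ t s)
    rw [g2Coord_apply] at e
    rw [g2Coord_apply]
    conv_rhs => rw [← e]
    rw [L0 t ht s, L1 t ht s]
    simp [frenetCoord, stdVec_apply, Complex.ext_iff]
  have kp : ∀ t ∈ T, ∀ s, 0 < k1 (u t) s := fun t ht s =>
    lt_of_le_of_ne (norm_nonneg _) (hk t ht s).symm
  have cp : ∀ t ∈ T, ∀ s, 0 < kappa2 (u t) s := fun t ht s =>
    lt_of_le_of_ne (Real.sqrt_nonneg _) (hκ t ht s).symm
  have hd : ∀ t ∈ T, ∀ s, HasDerivAt (fun s => frameMap (u t s) (frame1 (u t) s) (frame2 (u t) s))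
      (frameMap (u t s) (frame1 (u t) s) (frame2 (u t) s) * g2Lie (frenetCoord (k1 (u t) s)
        (rho1 (u t) s) (-(κ t s).2.2.2.2.1) (kappa2 (u t) s) (κ t s).2.2.2.2.2.2.2)) s :=
    fun t ht s => by rw [← form t ht s]; exact h.space t ht s
  have final : ∀ t ∈ T, ∀ s, frenetCoord (k1 (u t) s) (rho1 (u t) s) (rho2 (u t) s)
      (kappa2 (u t) s) ⟨alpha (u t) s, -(beta1 (u t) s + beta2 (u t) s) / 2⟩ = κ t s :=
    fun t ht s => by
      have r2 := rho2_eq_of_frenet (hG t ht) (hd t ht) (kp t ht) (cp t ht) s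
      have al := alpha_eq_of_frenet (hG t ht) (hd t ht) (kp t ht) (cp t ht) s
      have be := beta_eq_of_frenet (hG t ht) (hd t ht) (kp t ht) (cp t ht) s
      simp only [F0] at r2 al be
      rw [form t ht s, ← r2]
      congr 1
      refine Complex.ext al ?_
      simp only
      change -(beta1 (fun s => u t s) s + beta2 (fun s => u t s) s) / 2 = _
      rw [be]
      ring
  refine ⟨_, η, ⟨h.smooth, h.smooth_space.congr final, h.smooth_time, hG, fun t ht s => ?_,
    h.time⟩, fun t _ s => F0 t s⟩
  rw [final t ht s]
  exact h.space t ht s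

end Existence

end G2Flow

namespace G2Flow

/-! ### The complex functions of a curve in terms of phases -/

theorem cis_add (x y : ℝ) : cis (x + y) = cis x * cis y := by
  simp only [cis_eq]
  rw [← Complex.exp_add]
  push_cast
  ring_nf

theorem conj_cis (x : ℝ) : conj (cis x) = cis (-x) := by
  apply Complex.ext <;> simp [cis]

theorem cis_zero : cis 0 = 1 := by
  apply Complex.ext <;> simp [cis]

theorem cis_mul_cis_neg (x : ℝ) : cis x * cis (-x) = 1 := by
  rw [← cis_add, add_neg_cancel, cis_zero]

theorem norm_cis (x : ℝ) : ‖cis x‖ = 1 := by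
  rw [cis_eq, Complex.norm_exp_ofReal_mul_I]

theorem exp_I_mul (x : ℝ) : Complex.exp (Complex.I * x) = cis x := by
  rw [cis_eq, mul_comm]

theorem exp_neg_I_mul (x : ℝ) : Complex.exp (-Complex.I * x) = cis (-x) := by
  rw [cis_eq]
  congr 1
  push_cast
  ring

theorem rFun_eq (w : ℝ → E7) (s : ℝ) :
    rFun w s = 1 / (Real.sqrt 2 : ℂ) * cis (-∫ x in (0 : ℝ)..s, rho1 w x) := by
  rw [rFun, exp_neg_I_mul]

theorem qFun_eq (w : ℝ → E7) (s : ℝ) :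
    qFun w s = 1 / (Real.sqrt 2 : ℂ) * cis (-∫ x in (0 : ℝ)..s, rho2 w x) := by
  rw [qFun, exp_neg_I_mul]

/-- The first phase of a family of curves. -/
def phase1 (u : ℝ → ℝ → E7) (A : ℝ → ℝ) (t s : ℝ) : ℝ := (∫ x in (0 : ℝ)..s, rho1 (u t) x) + A t

/-- The second phase of a family of curves. -/
def phase2 (u : ℝ → ℝ → E7) (B : ℝ → ℝ) (t s : ℝ) : ℝ := (∫ x in (0 : ℝ)..s, rho2 (u t) x) + B t

/-- The complex number `α - √-1 (β₁ + β₂) / 2`. -/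
def torsion (w : ℝ → E7) (s : ℝ) : ℂ := ⟨alpha w s, -(beta1 w s + beta2 w s) / 2⟩

theorem inv_sqrt_two_mul : (1 / (Real.sqrt 2 : ℂ)) * (1 / (Real.sqrt 2 : ℂ)) = 1 / 2 := by
  rw [div_mul_div_comm, one_mul, ← Complex.ofReal_mul, Real.mul_self_sqrt (by norm_num)]
  norm_num

theorem psi1_eq (u : ℝ → ℝ → E7) (A : ℝ → ℝ) (t s : ℝ) :
    psi1 u A t s = ((k1 (u t) s / 2 : ℝ) : ℂ) * cis (phase1 u A t s) := by
  rw [psi1, phi1, rFun_eq, exp_I_mul, phase1, cis_add, map_mul, conj_cis, neg_neg, map_div₀,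
    map_one, Complex.conj_ofReal]
  push_cast
  linear_combination (k1 (u t) s : ℂ) * cis (∫ x in (0 : ℝ)..s, rho1 (u t) x) * cis (A t) *
    inv_sqrt_two_mul

theorem psi2_eq (u : ℝ → ℝ → E7) (A B : ℝ → ℝ) (t s : ℝ) : psi2 u A B t s =
    conj ((kappa2 (u t) s : ℂ) * (cis (phase1 u A t s) * conj (cis (phase2 u B t s)))) := by
  have e : Complex.exp (-Complex.I * ((A t : ℂ) - (B t : ℂ))) = cis (-A t) * cis (B t) := by
    rw [← Complex.ofReal_sub, exp_neg_I_mul, ← cis_add]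
    congr 1
    ring
  rw [psi2, phi2, rFun_eq, qFun_eq, e, phase1, phase2]
  simp only [map_mul, conj_cis, neg_neg, map_div₀, map_one, Complex.conj_ofReal, neg_add, cis_add]
  linear_combination 2 * (kappa2 (u t) s : ℂ) * cis (-∫ x in (0 : ℝ)..s, rho1 (u t) x) *
    cis (∫ x in (0 : ℝ)..s, rho2 (u t) x) * cis (-A t) * cis (B t) * inv_sqrt_two_mul

theorem psi3_eq (u : ℝ → ℝ → E7) (A B : ℝ → ℝ) (t s : ℝ) : psi3 u A B t s =
    -conj (torsion (u t) s * (cis (phase1 u A t s) * cis (phase2 u B t s) ^ 2)) := by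
  have e : Complex.exp (-Complex.I * ((A t : ℂ) + 2 * (B t : ℂ))) =
      cis (-A t) * (cis (-B t) * cis (-B t)) := by
    rw [← cis_add, ← cis_add, show (A t : ℂ) + 2 * (B t : ℂ) = ((A t + 2 * B t : ℝ) : ℂ) by
      push_cast; ring, exp_neg_I_mul]
    congr 1
    ring
  have e2 : conj (torsion (u t) s) = (2 * (alpha (u t) s : ℂ) + Complex.I *
      ((beta1 (u t) s : ℂ) + (beta2 (u t) s : ℂ))) / 2 := by
    apply Complex.ext <;> simp [torsion]
    ring
  have e3 : (Real.sqrt 2 : ℂ) * (1 / (Real.sqrt 2 : ℂ)) = 1 :=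
    mul_one_div_cancel (by simp)
  rw [psi3, phi3, rFun_eq, qFun_eq, e, phase1, phase2]
  simp only [map_mul, map_pow, conj_cis, neg_neg, neg_add, cis_add, e2]
  generalize cis (-∫ x in (0 : ℝ)..s, rho1 (u t) x) = z
  generalize cis (-∫ x in (0 : ℝ)..s, rho2 (u t) x) = w
  generalize 2 * (alpha (u t) s : ℂ) + Complex.I *
      ((beta1 (u t) s : ℂ) + (beta2 (u t) s : ℂ)) = b
  have h := inv_sqrt_two_mul
  generalize 1 / (Real.sqrt 2 : ℂ) = x at *
  linear_combination (-b * z * w ^ 2 * cis (-A t) * cis (-B t) ^ 2) * (x ^ 2 * e3 + h)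

theorem norm_psi1 (u : ℝ → ℝ → E7) (A : ℝ → ℝ) (t s : ℝ) :
    ‖psi1 u A t s‖ = k1 (u t) s / 2 := by
  rw [psi1_eq, norm_mul, norm_cis, mul_one, Complex.norm_real, Real.norm_of_nonneg]
  exact div_nonneg (norm_nonneg _) zero_le_two

theorem norm_psi2 (u : ℝ → ℝ → E7) (A B : ℝ → ℝ) (t s : ℝ) :
    ‖psi2 u A B t s‖ = kappa2 (u t) s := by
  rw [psi2_eq, RCLike.norm_conj, norm_mul, norm_mul, RCLike.norm_conj, norm_cis, norm_cis, mul_one,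
    mul_one, Complex.norm_real]
  exact Real.norm_of_nonneg (Real.sqrt_nonneg _)

theorem norm_psi3 (u : ℝ → ℝ → E7) (A B : ℝ → ℝ) (t s : ℝ) :
    ‖psi3 u A B t s‖ = ‖torsion (u t) s‖ := by
  rw [psi3_eq, norm_neg, RCLike.norm_conj, norm_mul, norm_mul, norm_pow, norm_cis, norm_cis,
    one_pow, mul_one, mul_one]

/-- The reason for the phases in the definition of the complex functions: they are the coordinates
of the Frenet frame after the rotation that cancels its torus components `-ρ₁, -ρ₂`. -/
theorem flowCoord_psi (u : ℝ → ℝ → E7) (A B : ℝ → ℝ) (t s : ℝ) :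
    flowCoord (psi1 u A t s) (psi2 u A B t s) (psi3 u A B t s) =
      rotCoord (cis (phase1 u A t s)) (cis (phase2 u B t s)) (frenetCoord (k1 (u t) s)
        (rho1 (u t) s) (rho2 (u t) s) (kappa2 (u t) s) (torsion (u t) s)) +
        (0, 0, 0, rho1 (u t) s, rho2 (u t) s, 0, 0, 0) := by
  simp only [flowCoord, frenetCoord, rotCoord, psi1_eq, psi2_eq, psi3_eq, map_neg, neg_neg,
    Complex.conj_conj, zero_mul, Prod.mk_add_mk, add_zero, neg_add_cancel]

section

variable {T : Set ℝ} {u v : ℝ → ℝ → E7} {F : ℝ → ℝ → E7 →L[ℝ] E7} {η : ℝ → ℝ → G2Coord}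
  {f₁ f₂ f₃ : ℝ → ℝ → ℂ} {A B : ℝ → ℝ} {t s : ℝ}

theorem IsFrame.congr {κ κ' : ℝ → ℝ → G2Coord} (h : IsFrame T F κ η)
    (e : ∀ t ∈ T, ∀ s, κ' t s = κ t s) : IsFrame T F κ' η :=
  ⟨h.smooth, h.smooth_space.congr e, h.smooth_time, h.isG2Map,
    fun t ht s => by rw [e t ht s]; exact h.space t ht s, h.time⟩

theorem IsFlowFrame.congr (h : IsFlowFrame T F f₁ f₂ f₃ η) {g₁ g₂ g₃ : ℝ → ℝ → ℂ}
    (e₁ : ∀ t ∈ T, ∀ s, g₁ t s = f₁ t s) (e₂ : ∀ t ∈ T, ∀ s, g₂ t s = f₂ t s)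
    (e₃ : ∀ t ∈ T, ∀ s, g₃ t s = f₃ t s) : IsFlowFrame T F g₁ g₂ g₃ η where
  isFrame := h.isFrame.congr fun t ht s => by rw [e₁ t ht s, e₂ t ht s, e₃ t ht s]
  smooth₁ := h.smooth₁.congr e₁
  smooth₂ := h.smooth₂.congr e₂
  smooth₃ := h.smooth₃.congr e₃
  time_eq t ht s := by
    rw [show g₁ t = f₁ t from funext (e₁ t ht), e₂ t ht s]
    exact h.time_eq t ht s

theorem isSchrodingerFlow_iff_cross : IsSchrodingerFlow T u ↔
    SmoothOn T u ∧ (∀ t ∈ T, ∀ s, ‖u t s‖ = 1) ∧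
      ∀ t ∈ T, ∀ s, timeDeriv T u t s = cross (u t s) (deriv (deriv (u t)) s) := by
  have e : ∀ t s, kirchhoffJ (u t s) (tension (u t) s) =
      cross (u t s) (deriv (deriv (u t)) s) := fun t s => by
    rw [kirchhoffJ, tension, cross_add_right, cross_smul_right, cross_self, smul_zero, add_zero]
  constructor
  · rintro ⟨h1, h2, h3⟩
    exact ⟨h1, h2, fun t ht s => (h3 t ht s).trans (e t s)⟩
  · rintro ⟨h1, h2, h3⟩
    exact ⟨h1, h2, fun t ht s => (h3 t ht s).trans (e t s).symm⟩

theorem SmoothOn.of_frenetCoord {m r₁ r₂ c : ℝ → ℝ → ℝ} {a : ℝ → ℝ → ℂ}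
    (h : SmoothOn T (fun t s => frenetCoord (m t s) (r₁ t s) (r₂ t s) (c t s) (a t s))) :
    SmoothOn T r₂ ∧ SmoothOn T a := by
  refine ⟨?_, ContDiffOn.snd (ContDiffOn.snd (ContDiffOn.snd (ContDiffOn.snd (ContDiffOn.snd
    (ContDiffOn.snd (ContDiffOn.snd h))))))⟩
  have := ContDiffOn.neg h.torus_right
  simp only [frenetCoord, neg_neg] at this
  exact this

/-- A flow with nonzero curvatures has frames adapted to it. -/
theorem IsSchrodingerFlow.exists_isFlowFrame (hT : TimeInterval T) (h : IsSchrodingerFlow T u)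
    (hk : ∀ t ∈ T, ∀ s, k1 (u t) s ≠ 0) (hκ : ∀ t ∈ T, ∀ s, kappa2 (u t) s ≠ 0) :
    SmoothOn T (fun t s => torsion (u t) s) ∧ ∃ c d : ℝ → ℝ, ContDiffOn ℝ ∞ c T ∧
      ContDiffOn ℝ ∞ d T ∧ ∀ A B : ℝ → ℝ, ContDiffOn ℝ ∞ A T → ContDiffOn ℝ ∞ B T → ∃ F η,
        IsFlowFrame T F (psi1 u A) (psi2 u A B) (psi3 u A B) η ∧
        (∀ t ∈ T, ∀ s, F t s (stdVec 0) = u t s) ∧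
        ∀ t ∈ T, (η t 0).2.2.2.1 = c t + derivWithin A T t ∧
          (η t 0).2.2.2.2.1 = d t + derivWithin B T t := by
  obtain ⟨hu, hs, hfl⟩ := isSchrodingerFlow_iff_cross.1 h
  obtain ⟨F, η, hF, h0⟩ := exists_frenet_frame hT hu hs hk hκ
  obtain ⟨sr2, sa⟩ := SmoothOn.of_frenetCoord hF.smooth_space
  have sr1 := hu.rho1 hT hk
  refine ⟨sa, fun t => (η t 0).2.2.2.1, fun t => (η t 0).2.2.2.2.1,
    hF.smooth_time.torus_left.slice 0, hF.smooth_time.torus_right.slice 0, fun A B hA hB => ?_⟩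
  have sθ : SmoothOn T (phase1 u A) := ContDiffOn.add (sr1.integral hT) (SmoothOn.of_time hA)
  have sφ : SmoothOn T (phase2 u B) := ContDiffOn.add (sr2.integral hT) (SmoothOn.of_time hB)
  have dθ : ∀ t ∈ T, ∀ s, deriv (phase1 u A t) s = rho1 (u t) s := fun t ht s =>
    ((hasDerivAt_integral (sr1.contDiff_slice ht).continuous s).add_const (A t)).deriv
  have dφ : ∀ t ∈ T, ∀ s, deriv (phase2 u B t) s = rho2 (u t) s := fun t ht s =>
    ((hasDerivAt_integral (sr2.contDiff_slice ht).continuous s).add_const (B t)).deriv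
  have hR := hF.rotate hT sθ sφ
  have hR' := hR.congr (κ' := fun t s => flowCoord (psi1 u A t s) (psi2 u A B t s)
    (psi3 u A B t s)) fun t ht s => by rw [flowCoord_psi, dθ t ht s, dφ t ht s]; rfl
  have s1 : SmoothOn T (psi1 u A) := hR'.smooth_space.fst
  have s2 : SmoothOn T (psi2 u A B) := by
    have : SmoothOn T (fun t s => conj (conj (psi2 u A B t s))) :=
      SmoothOn.conj hR'.smooth_space.snd.snd.snd.snd.snd.fst
    simpa using this
  have s3 : SmoothOn T (psi3 u A B) := by
    have : SmoothOn T (fun t s => -conj (-conj (psi3 u A B t s))) :=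
      ContDiffOn.neg (SmoothOn.conj (f := fun t s => -conj (psi3 u A B t s))
        hR'.smooth_space.snd.snd.snd.snd.snd.snd.snd)
    simpa using this
  have e0 : ∀ t ∈ T, ∀ s, (F t s * rotMap (cis (phase1 u A t s)) (cis (phase2 u B t s)))
      (stdVec 0) = u t s := fun t ht s => by
    rw [clm_mul_apply, rotMap_stdVec_zero, h0 t ht s]
  refine ⟨_, _, ⟨hR', s1, s2, s3, ?_⟩, e0, fun t ht => ⟨?_, ?_⟩⟩
  · refine (hR'.isSchrodingerFlow_iff hT s1 s2 s3).1 fun t ht s => ?_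
    rw [timeDeriv_congr e0 ht s, hfl t ht s]
    have : (fun s => (F t s * rotMap (cis (phase1 u A t s)) (cis (phase2 u B t s)))
      (stdVec 0)) = u t := funext fun s => e0 t ht s
    rw [this, congrFun this s]
  -- At `s = 0` the integral of `ρ₁` is zero at every time, so only `A` contributes to the phase.
  · have : timeDeriv T (phase1 u A) t 0 = derivWithin A T t := by
      simp [timeDeriv, phase1]
    rw [← this]
    rfl
  · have : timeDeriv T (phase2 u B) t 0 = derivWithin B T t := by
      simp [timeDeriv, phase2]
    rw [← this]
    rfl

/-- Flows with nonzero curvatures give solutions of the system. -/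
theorem IsSchrodingerFlow.exists_isNLSTSolution (hT : TimeInterval T) (h : IsSchrodingerFlow T u)
    (hk : ∀ t ∈ T, ∀ s, k1 (u t) s ≠ 0) (hκ : ∀ t ∈ T, ∀ s, kappa2 (u t) s ≠ 0) :
    ∃ A B : ℝ → ℝ, ContDiffOn ℝ ∞ A T ∧ ContDiffOn ℝ ∞ B T ∧ A 0 = 0 ∧ B 0 = 0 ∧
      IsNLSTSolution T (psi1 u A) (psi2 u A B) (psi3 u A B) := by
  obtain ⟨st, c, d, hc, hd, H⟩ := h.exists_isFlowFrame hT hk hκ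
  have m1 := (h.smooth.k1 hT hk).slice 0
  have m2 := (h.smooth.kappa2 hT hk hκ).slice 0
  have m3 := st.norm_sq.slice 0
  -- `a` and `b` will be the derivatives of `A` and `B`. They are the amounts that move the torus
  -- components at `s = 0` from `c, d` to the values required by `IsFlowFrame.isNLSTSolution`. That
  -- the norms of the complex functions do not depend on `A, B` avoids circularity.
  let a : ℝ → ℝ := fun t => -2 * (k1 (u t) 0 / 2) ^ 2 + kappa2 (u t) 0 ^ 2 - c t
  let b : ℝ → ℝ := fun t => a t + (c t - d t) - (-3 * (k1 (u t) 0 / 2) ^ 2 +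
    2 * kappa2 (u t) 0 ^ 2 - ‖torsion (u t) 0‖ ^ 2)
  have ha : ContDiffOn ℝ ∞ a T :=
    ((contDiffOn_const.mul ((m1.div_const 2).pow 2)).add (m2.pow 2)).sub hc
  have hb : ContDiffOn ℝ ∞ b T :=
    (ha.add (hc.sub hd)).sub (((contDiffOn_const.mul ((m1.div_const 2).pow 2)).add
      (contDiffOn_const.mul (m2.pow 2))).sub m3)
  have hA := contDiffOn_integral hT ha
  have hB := contDiffOn_integral hT hb
  obtain ⟨F, η, hF, -, hη⟩ := H _ _ hA hB
  have dA : ∀ t ∈ T, derivWithin (fun t => ∫ x in (0 : ℝ)..t, a x) T t = a t := fun t ht =>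
    (hasDerivWithinAt_integral hT ha.continuousOn ht).derivWithin (hT.uniqueDiffOn t ht)
  have dB : ∀ t ∈ T, derivWithin (fun t => ∫ x in (0 : ℝ)..t, b x) T t = b t := fun t ht =>
    (hasDerivWithinAt_integral hT hb.continuousOn ht).derivWithin (hT.uniqueDiffOn t ht)
  refine ⟨_, _, hA, hB, intervalIntegral.integral_same, intervalIntegral.integral_same,
    hF.isNLSTSolution hT (fun t ht s => ?_) (fun t ht s => ?_) (fun t ht => ?_) fun t ht => ?_⟩
  · rw [← norm_ne_zero_iff, norm_psi1]
    exact div_ne_zero (hk t ht s) two_ne_zero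
  · rw [← norm_ne_zero_iff, norm_psi2]
    exact hκ t ht s
  · rw [(hη t ht).1, dA t ht, norm_psi1, norm_psi2]
    simp only [a]
    ring
  · rw [(hη t ht).1, (hη t ht).2, dA t ht, dB t ht, norm_psi1, norm_psi2, norm_psi3]
    simp only [a, b]
    ring

theorem HasTransform.exists_isFlowFrame (hT : TimeInterval T) (h : IsSchrodingerFlow T u)
    (hf : HasTransform T u f₁ f₂ f₃) (hn₁ : ∀ t ∈ T, ∀ s, f₁ t s ≠ 0)
    (hn₂ : ∀ t ∈ T, ∀ s, f₂ t s ≠ 0) :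
    ∃ F η, IsFlowFrame T F f₁ f₂ f₃ η ∧ ∀ t ∈ T, ∀ s, F t s (stdVec 0) = u t s := by
  obtain ⟨A, B, hA, hB, e⟩ := hf
  have hk : ∀ t ∈ T, ∀ s, k1 (u t) s ≠ 0 := fun t ht s h0 => hn₁ t ht s <| by
    rw [(e t ht s).1, psi1_eq, h0, zero_div, Complex.ofReal_zero, zero_mul]
  have hκ : ∀ t ∈ T, ∀ s, kappa2 (u t) s ≠ 0 := fun t ht s h0 => hn₂ t ht s <| by
    rw [(e t ht s).2.1, psi2_eq, h0, Complex.ofReal_zero, zero_mul, map_zero]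
  obtain ⟨-, c, d, -, -, H⟩ := h.exists_isFlowFrame hT hk hκ
  obtain ⟨F, η, hF, h0, -⟩ := H A B hA hB
  exact ⟨F, η, hF.congr (fun t ht s => (e t ht s).1) (fun t ht s => (e t ht s).2.1)
    (fun t ht s => (e t ht s).2.2), h0⟩

/-- Flows with the same complex functions are congruent. -/
theorem HasTransform.exists_isG2 (hT : TimeInterval T) (hu : IsSchrodingerFlow T u)
    (hv : IsSchrodingerFlow T v) (hfu : HasTransform T u f₁ f₂ f₃)
    (hfv : HasTransform T v f₁ f₂ f₃) (hn₁ : ∀ t ∈ T, ∀ s, f₁ t s ≠ 0)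
    (hn₂ : ∀ t ∈ T, ∀ s, f₂ t s ≠ 0) :
    ∃ g : E7 ≃ₗᵢ[ℝ] E7, IsG2 g ∧ ∀ t ∈ T, ∀ s, v t s = g (u t s) := by
  obtain ⟨F, η, hF, h0⟩ := hfu.exists_isFlowFrame hT hu hn₁ hn₂
  obtain ⟨F', η', hF', h0'⟩ := hfv.exists_isFlowFrame hT hv hn₁ hn₂
  obtain ⟨g, hg, e⟩ := hF.exists_isG2Map hT hF' hn₁ hn₂
  refine ⟨hg.equiv, hg.isG2_equiv, fun t ht s => ?_⟩
  rw [← h0 t ht s, ← h0' t ht s, e t ht s]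
  rfl

end

end G2Flow

namespace G2Flow

section

variable {T : Set ℝ} {u v : ℝ → ℝ → E7} {F : ℝ → ℝ → E7 →L[ℝ] E7} {η : ℝ → ℝ → G2Coord}
  {f f₁ f₂ f₃ : ℝ → ℝ → ℂ} {t s : ℝ}

/-! ### From solutions of the system to flows -/

/-- Nowhere vanishing smooth functions on `T × ℝ` have smooth arguments. -/
theorem SmoothOn.exists_arg (hT : TimeInterval T) (hf : SmoothOn T f)
    (hn : ∀ t ∈ T, ∀ s, f t s ≠ 0) :
    ∃ θ, SmoothOn T θ ∧ ∀ t ∈ T, ∀ s, f t s = (‖f t s‖ : ℂ) * G2Flow.cis (θ t s) := by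
  have sl := hf.logDeriv hT hn
  have st := ((hf.timeDeriv hT).div_complex hf hn).slice 0
  -- A logarithm of `f` is built by integrating `f_t / f` along `s = 0` and `f_s / f` in space from
  -- there. The product of `f` with `exp (-L)` has zero derivative along both paths; the argument is
  -- the imaginary part of `L`.
  let L₀ : ℝ → ℂ := fun t => Complex.log (f 0 0) +
    ∫ τ in (0 : ℝ)..t, G2Flow.timeDeriv T f τ 0 / f τ 0
  let L : ℝ → ℝ → ℂ := fun t s => L₀ t + ∫ x in (0 : ℝ)..s, _root_.logDeriv (f t) x
  have hL₀ : ContDiffOn ℝ ∞ L₀ T := contDiffOn_const.add (contDiffOn_integral hT st)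
  have hL : SmoothOn T L := ContDiffOn.add (SmoothOn.of_time hL₀) (sl.integral hT)
  have e0 : ∀ t ∈ T, f t 0 * Complex.exp (-L₀ t) = 1 := fun t ht => by
    refine eqOn_of_hasDerivWithinAt_eq hT (f := fun t => f t 0 * Complex.exp (-L₀ t))
      (g := fun _ => 1) (f' := fun _ => 0) (fun t ht => ?_)
      (fun t _ => hasDerivWithinAt_const t T 1) ?_ ht
    · have d1 := hf.hasDerivWithinAt ht 0
      have d2 : HasDerivWithinAt L₀ (G2Flow.timeDeriv T f t 0 / f t 0) T t :=
        (hasDerivWithinAt_integral hT st.continuousOn ht).const_add _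
      refine (d1.mul d2.neg.cexp).congr_deriv ?_
      have := hn t ht 0
      field_simp
      ring
    · simp only [L₀, intervalIntegral.integral_same, add_zero]
      rw [Complex.exp_neg, Complex.exp_log (hn 0 hT.zero_mem 0),
        mul_inv_cancel₀ (hn 0 hT.zero_mem 0)]
  have e1 : ∀ t ∈ T, ∀ s, f t s * Complex.exp (-L t s) = 1 := fun t ht s => by
    refine eqOn_of_hasDerivWithinAt_eq TimeInterval.univ
      (f := fun s => f t s * Complex.exp (-L t s))
      (g := fun _ => 1) (f' := fun _ => 0) (fun s _ => ?_)
      (fun s _ => hasDerivWithinAt_const s univ 1) ?_ (mem_univ s)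
    · have d1 := (hf.hasDerivAt ht s).hasDerivWithinAt (s := univ)
      have d2 : HasDerivWithinAt (L t) (_root_.logDeriv (f t) s) univ s :=
        ((hasDerivAt_integral (sl.contDiff_slice ht).continuous s).const_add _).hasDerivWithinAt
      refine (d1.mul d2.neg.cexp).congr_deriv ?_
      have := hn t ht s
      rw [logDeriv_apply]
      field_simp
      ring
    · simp only [L, intervalIntegral.integral_same, add_zero]
      exact e0 t ht
  refine ⟨fun t s => (L t s).im, hL.im, fun t ht s => ?_⟩
  have e2 : f t s = Complex.exp (L t s) := by
    have := e1 t ht s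
    rw [Complex.exp_neg, ← div_eq_mul_inv, div_eq_one_iff_eq (Complex.exp_ne_zero _)] at this
    exact this
  rw [e2, Complex.norm_exp, cis_eq, Complex.ofReal_exp, ← Complex.exp_add, Complex.re_add_im]

theorem IsFlowFrame.isSchrodingerFlow (hT : TimeInterval T) (h : IsFlowFrame T F f₁ f₂ f₃ η) :
    IsSchrodingerFlow T (fun t s => F t s (stdVec 0)) :=
  isSchrodingerFlow_iff_cross.2 ⟨ContDiffOn.clm_apply h.isFrame.smooth contDiffOn_const,
    fun t ht s => by rw [(h.isFrame.isG2Map t ht s).norm_map, norm_stdVec],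
    (h.isFrame.isSchrodingerFlow_iff hT h.smooth₁ h.smooth₂ h.smooth₃).2 h.time_eq⟩

theorem integral_deriv_eq {θ : ℝ → ℝ → ℝ} (hθ : SmoothOn T θ) (hT : TimeInterval T) (ht : t ∈ T)
    (s : ℝ) : ∫ x in (0 : ℝ)..s, deriv (θ t) x = θ t s - θ t 0 :=
  intervalIntegral.integral_eq_sub_of_hasDerivAt (fun x _ => hθ.hasDerivAt ht x)
    (((hθ.deriv hT).contDiff_slice ht).continuous.intervalIntegrable _ _)

/-- Every solution of the system is obtained from a flow. -/
theorem IsNLSTSolution.exists_flow (hT : TimeInterval T) (h : IsNLSTSolution T f₁ f₂ f₃) :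
    ∃ u, IsSchrodingerFlow T u ∧ (∀ t ∈ T, ∀ s, k1 (u t) s ≠ 0) ∧
      (∀ t ∈ T, ∀ s, kappa2 (u t) s ≠ 0) ∧ HasTransform T u f₁ f₂ f₃ := by
  obtain ⟨F, η, hF⟩ := h.exists_isFlowFrame hT
  obtain ⟨θ, sθ, eθ⟩ := h.smooth₁.exists_arg hT h.ne₁
  obtain ⟨ψ, sψ, eψ⟩ := h.smooth₂.exists_arg hT h.ne₂
  -- If the two phases of a curve are `θ` and `φ`, the second complex function has argument `φ - θ`.
  -- Hence `φ` is the sum of the arguments of `f₁` and `f₂`.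
  have sφ : SmoothOn T (fun t s => θ t s + ψ t s) := ContDiffOn.add sθ sψ
  set φ : ℝ → ℝ → ℝ := fun t s => θ t s + ψ t s with hφ
  have n1 : SmoothOn T (fun t s => -θ t s) := ContDiffOn.neg sθ
  have n2 : SmoothOn T (fun t s => -φ t s) := ContDiffOn.neg sφ
  -- Undoing the rotation turns the flow frame into one of Frenet form, from which the invariants of
  -- the curve can be read.
  have hR := hF.isFrame.rotate hT n1 n2
  let a : ℝ → ℝ → ℂ := fun t s => -conj (f₃ t s) * (cis (-θ t s) * cis (-φ t s) ^ 2)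
  have e2 : ∀ t ∈ T, ∀ s, conj (f₂ t s) = (‖f₂ t s‖ : ℂ) * (cis (θ t s) * cis (-φ t s)) :=
    fun t ht s => by
      conv_lhs => rw [eψ t ht s]
      rw [map_mul, Complex.conj_ofReal, conj_cis, ← cis_add]
      congr 2
      simp only [hφ]
      ring
  have cc : ∀ x : ℝ, cis (-x) * cis x = 1 := fun x => by rw [mul_comm, cis_mul_cis_neg]
  have hR' := hR.congr (κ' := fun t s => frenetCoord (2 * ‖f₁ t s‖) (deriv (θ t) s) (deriv (φ t) s)
      ‖f₂ t s‖ (a t s)) fun t ht s => by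
    have x1 : f₁ t s * cis (-θ t s) = ((2 * ‖f₁ t s‖ / 2 : ℝ) : ℂ) := by
      rw [mul_div_cancel_left₀ _ (two_ne_zero : (2 : ℝ) ≠ 0)]
      conv_lhs => rw [eθ t ht s]
      rw [mul_assoc, cis_mul_cis_neg, mul_one]
    have x2 : conj (f₂ t s) * (cis (-θ t s) * conj (cis (-φ t s))) = (‖f₂ t s‖ : ℂ) := by
      rw [e2 t ht s, conj_cis, neg_neg]
      linear_combination (‖f₂ t s‖ : ℂ) * cis (-φ t s) * cis (φ t s) * cc (θ t s) +
        (‖f₂ t s‖ : ℂ) * cc (φ t s)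
    have d1 : deriv (fun s => -θ t s) s = -deriv (θ t) s := (sθ.hasDerivAt ht s).neg.deriv
    have d2 : deriv (fun s => -φ t s) s = -deriv (φ t) s := (sφ.hasDerivAt ht s).neg.deriv
    simp only [frenetCoord, rotCoord, flowCoord, Prod.mk_add_mk, zero_mul, add_zero, zero_add, x1,
      x2, d1, d2, a]
  have e0 : ∀ t s, (F t s * rotMap (cis (-θ t s)) (cis (-φ t s))) (stdVec 0) = F t s (stdVec 0) :=
    fun t s => by rw [clm_mul_apply, rotMap_stdVec_zero]
  have m1 : ∀ t ∈ T, ∀ s, 0 < 2 * ‖f₁ t s‖ := fun t ht s =>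
    mul_pos two_pos (norm_pos_iff.2 (h.ne₁ t ht s))
  have m2 : ∀ t ∈ T, ∀ s, 0 < ‖f₂ t s‖ := fun t ht s => norm_pos_iff.2 (h.ne₂ t ht s)
  have rk : ∀ t ∈ T, ∀ s, k1 (fun s => F t s (stdVec 0)) s = 2 * ‖f₁ t s‖ := fun t ht s => by
    have := k1_eq_of_frenet (hR'.isG2Map t ht) (hR'.space t ht) (m1 t ht) s
    simpa only [e0] using this
  have r1 : ∀ t ∈ T, ∀ s, rho1 (fun s => F t s (stdVec 0)) s = deriv (θ t) s := fun t ht s => by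
    have := rho1_eq_of_frenet (hR'.isG2Map t ht) (hR'.space t ht) (m1 t ht) s
    simpa only [e0] using this
  have rκ : ∀ t ∈ T, ∀ s, kappa2 (fun s => F t s (stdVec 0)) s = ‖f₂ t s‖ := fun t ht s => by
    have := kappa2_eq_of_frenet (hR'.isG2Map t ht) (hR'.space t ht) (m1 t ht)
      (fun s => (m2 t ht s).le) s
    simpa only [e0] using this
  have r2 : ∀ t ∈ T, ∀ s, rho2 (fun s => F t s (stdVec 0)) s = deriv (φ t) s := fun t ht s => by
    have := rho2_eq_of_frenet (hR'.isG2Map t ht) (hR'.space t ht) (m1 t ht) (m2 t ht) s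
    simpa only [e0] using this
  have ra : ∀ t ∈ T, ∀ s, torsion (fun s => F t s (stdVec 0)) s = a t s := fun t ht s => by
    have al := alpha_eq_of_frenet (hR'.isG2Map t ht) (hR'.space t ht) (m1 t ht) (m2 t ht) s
    have be := beta_eq_of_frenet (hR'.isG2Map t ht) (hR'.space t ht) (m1 t ht) (m2 t ht) s
    simp only [e0] at al be
    refine Complex.ext al ?_
    simp only [torsion]
    rw [be]
    ring
  refine ⟨fun t s => F t s (stdVec 0), hF.isSchrodingerFlow hT, fun t ht s => ?_, fun t ht s => ?_,
    fun t => θ t 0, fun t => φ t 0, sθ.slice 0, sφ.slice 0, fun t ht s => ?_⟩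
  · rw [rk t ht s]
    exact (m1 t ht s).ne'
  · rw [rκ t ht s]
    exact (m2 t ht s).ne'
  · have p1 : phase1 (fun t s => F t s (stdVec 0)) (fun t => θ t 0) t s = θ t s := by
      simp only [phase1, r1 t ht]
      rw [integral_deriv_eq sθ hT ht, sub_add_cancel]
    have p2 : phase2 (fun t s => F t s (stdVec 0)) (fun t => φ t 0) t s = φ t s := by
      simp only [phase2, r2 t ht]
      rw [integral_deriv_eq sφ hT ht, sub_add_cancel]
    rw [psi1_eq, psi2_eq, psi3_eq, p1, p2, rk t ht s, rκ t ht s, ra t ht s]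
    refine ⟨?_, ?_, ?_⟩
    · rw [mul_div_cancel_left₀ _ (two_ne_zero : (2 : ℝ) ≠ 0)]
      exact eθ t ht s
    · rw [conj_cis, ← e2 t ht s, Complex.conj_conj]
    · simp only [a]
      have : -conj (f₃ t s) * (cis (-θ t s) * cis (-φ t s) ^ 2) *
          (cis (θ t s) * cis (φ t s) ^ 2) = -conj (f₃ t s) := by
        linear_combination -conj (f₃ t s) * ((cis (-φ t s) * cis (φ t s)) ^ 2 * cc (θ t s) +
          (cis (-φ t s) * cis (φ t s) + 1) * cc (φ t s))
      rw [this, map_neg, Complex.conj_conj, neg_neg]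

/-! ### Flows and binormal motions -/

/-- Exchanging the mixed derivatives gives `u_t = (u × u_s)_s`, which is `u × u_ss` because `u_s ×
u_s = 0`. -/
theorem IsBinormalMotion.isSchrodingerFlow (hT : TimeInterval T) {γ : ℝ → ℝ → E7}
    (h : IsBinormalMotion T γ) (e : ∀ t ∈ T, ∀ s, deriv (γ t) s = u t s) :
    IsSchrodingerFlow T u := by
  have hu : SmoothOn T u := (h.smooth.deriv hT).congr fun t ht s => (e t ht s).symm
  refine isSchrodingerFlow_iff_cross.2 ⟨hu, fun t ht s => by rw [← e t ht s, h.unit_speed t ht s],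
    fun t ht s => ?_⟩
  rw [timeDeriv_congr (f := fun t s => deriv (γ t) s) (fun t ht s => (e t ht s).symm) ht s,
    h.smooth.timeDeriv_deriv hT ht s,
    show timeDeriv T γ t = fun s => cross (u t s) (deriv (u t) s) from funext fun s => by
      rw [h.motion t ht s, show deriv (γ t) = u t from funext (e t ht)]]
  have := HasDerivWithinAt.cross (hu.hasDerivAt ht s).hasDerivWithinAt
    ((hu.deriv hT).hasDerivAt ht s).hasDerivWithinAt (S := univ)
  rw [hasDerivWithinAt_univ, cross_self, zero_add] at this
  exact this.deriv

/-- The first integral recovers the curve from its tangent, and the second moves the base point `s =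
0` with the velocity `u × u_s` required there. The velocity is then correct for all `s`, as `u_t` is
the space derivative of `u × u_s`. -/
theorem IsSchrodingerFlow.isBinormalMotion (hT : TimeInterval T) (h : IsSchrodingerFlow T u) :
    IsBinormalMotion T (fun t s => (∫ x in (0 : ℝ)..s, u t x) +
      ∫ τ in (0 : ℝ)..t, cross (u τ 0) (deriv (u τ) 0)) ∧
    ∀ t ∈ T, deriv (fun s => (∫ x in (0 : ℝ)..s, u t x) +
      ∫ τ in (0 : ℝ)..t, cross (u τ 0) (deriv (u τ) 0)) = u t := by
  obtain ⟨hu, hs, hf⟩ := isSchrodingerFlow_iff_cross.1 h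
  have sc : SmoothOn T (fun t s => cross (u t s) (deriv (u t) s)) := hu.cross (hu.deriv hT)
  have hd : ∀ t ∈ T, deriv (fun s => (∫ x in (0 : ℝ)..s, u t x) +
      ∫ τ in (0 : ℝ)..t, cross (u τ 0) (deriv (u τ) 0)) = u t := fun t ht => funext fun s =>
    ((hasDerivAt_integral (hu.contDiff_slice ht).continuous s).add_const _).deriv
  refine ⟨⟨ContDiffOn.add (hu.integral hT) (SmoothOn.of_time (contDiffOn_integral hT (sc.slice 0))),
    fun t ht s => by rw [hd t ht, hs t ht s], fun t ht s => ?_⟩, hd⟩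
  rw [hd t ht]
  have e1 : timeDeriv T (fun t s => (∫ x in (0 : ℝ)..s, u t x) +
      ∫ τ in (0 : ℝ)..t, cross (u τ 0) (deriv (u τ) 0)) t s = _ :=
    timeDeriv_of_hasDerivWithinAt hT ht (((hu.integral hT).hasDerivWithinAt ht s).add
      (hasDerivWithinAt_integral hT (sc.slice 0).continuousOn ht))
  rw [e1, hu.timeDeriv_integral hT ht s, intervalIntegral.integral_eq_sub_of_hasDerivAt
    (f := fun s => cross (u t s) (deriv (u t) s)), sub_add_cancel]
  · intro x _
    have := HasDerivWithinAt.cross (hu.hasDerivAt ht x).hasDerivWithinAt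
      ((hu.deriv hT).hasDerivAt ht x).hasDerivWithinAt (S := univ)
    rw [hasDerivWithinAt_univ, cross_self, zero_add] at this
    rw [hf t ht x]
    exact this
  · exact ((hu.timeDeriv hT).contDiff_slice ht).continuous.intervalIntegrable _ _

/-! ### Curves in `Im ℍ` -/

theorem inImH_cross {x y : E7} (hx : InImH x) (hy : InImH y) : InImH (cross x y) := by
  obtain ⟨a, b, c, d⟩ := hx
  obtain ⟨a', b', c', d'⟩ := hy
  refine ⟨?_, ?_, ?_, ?_⟩ <;>
    simp only [cross_eq, vec_apply, a, b, c, d, a', b', c', d'] <;> simp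

theorem inImH_smul {x : E7} (c : ℝ) (hx : InImH x) : InImH (c • x) := by
  obtain ⟨h1, h2, h3, h4⟩ := hx
  refine ⟨?_, ?_, ?_, ?_⟩ <;> simp [*]

theorem inImH_add {x y : E7} (hx : InImH x) (hy : InImH y) : InImH (x + y) := by
  obtain ⟨a, b, c, d⟩ := hx
  obtain ⟨a', b', c', d'⟩ := hy
  refine ⟨?_, ?_, ?_, ?_⟩ <;> simp [*]

theorem deriv_coord_eq_zero {w : ℝ → E7} (i : Fin 7) (h : ∀ s, w s i = 0) (s : ℝ) :
    deriv w s i = 0 := by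
  -- Where `w` is not differentiable, `deriv` is zero by convention, so no regularity is needed.
  by_cases hw : DifferentiableAt ℝ w s
  · have h1 : HasDerivAt (fun s => w s i) (deriv w s i) s :=
      (EuclideanSpace.proj i : E7 →L[ℝ] ℝ).hasFDerivAt.comp_hasDerivAt s hw.hasDerivAt
    simp only [h] at h1
    exact h1.unique (hasDerivAt_const s 0)
  · rw [deriv_zero_of_not_differentiableAt hw]
    rfl

theorem inImH_deriv {w : ℝ → E7} (h : ∀ s, InImH (w s)) (s : ℝ) : InImH (deriv w s) :=
  ⟨deriv_coord_eq_zero 3 (fun s => (h s).1) s, deriv_coord_eq_zero 4 (fun s => (h s).2.1) s,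
    deriv_coord_eq_zero 5 (fun s => (h s).2.2.1) s, deriv_coord_eq_zero 6 (fun s => (h s).2.2.2) s⟩

theorem integral_coord_eq_zero {w : ℝ → E7} (i : Fin 7) (a b : ℝ)
    (hi : IntervalIntegrable w volume a b) (h : ∀ x ∈ uIcc a b, w x i = 0) :
    (∫ x in a..b, w x) i = 0 := by
  have := (EuclideanSpace.proj i : E7 →L[ℝ] ℝ).intervalIntegral_comp_comm hi
  exact this.symm.trans ((intervalIntegral.integral_congr (g := fun _ => (0 : ℝ))
    fun x hx => h x hx).trans (by simp))

theorem inImH_integral {w : ℝ → E7} {a b : ℝ} (hi : IntervalIntegrable w volume a b)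
    (h : ∀ x ∈ uIcc a b, InImH (w x)) : InImH (∫ x in a..b, w x) :=
  ⟨integral_coord_eq_zero 3 a b hi fun s hs => (h s hs).1,
    integral_coord_eq_zero 4 a b hi fun s hs => (h s hs).2.1,
    integral_coord_eq_zero 5 a b hi fun s hs => (h s hs).2.2.1,
    integral_coord_eq_zero 6 a b hi fun s hs => (h s hs).2.2.2⟩

/-- In the three-dimensional space `Im ℍ` the square of a triple product is the Gram determinant. -/
theorem gram_identity {x u p : E7} (hx : InImH x) (hu : InImH u) (hp : InImH p) :
    (inner ℝ x (cross p u) : ℝ) ^ 2 = inner ℝ x x * (inner ℝ u u * inner ℝ p p - inner ℝ u p ^ 2)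
      - inner ℝ x u * (inner ℝ x u * inner ℝ p p - inner ℝ u p * inner ℝ x p) +
      inner ℝ x p * (inner ℝ x u * inner ℝ u p - inner ℝ u u * inner ℝ x p) := by
  obtain ⟨a, b, c, d⟩ := hx
  obtain ⟨a', b', c', d'⟩ := hu
  obtain ⟨a_, b_, c_, d_⟩ := hp
  simp only [inner_eq, cross_eq, vec_apply, a, b, c, d, a', b', c', d', a_, b_, c_, d_]
  ring

/-- In `Im ℍ` the vectors `w, I₁, I₅` span everything, and the derivative of `I₁` is orthogonal to
`I₁`. The Gram identity expresses this as the vanishing of the radicand of `κ₂`. -/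
theorem kappa2_eq_zero_of_inImH {w : ℝ → E7} (hw : ContDiff ℝ ∞ w) (h : ∀ s, InImH (w s))
    (h1 : ∀ s, ‖w s‖ = 1) (hk : ∀ s, k1 w s ≠ 0) (s : ℝ) : kappa2 w s = 0 := by
  have hp : ∀ s, InImH (frame1 w s) := fun s => inImH_smul _ (inImH_deriv h s)
  have hx := inImH_deriv hp s
  have hwd : ContDiff ℝ ∞ (deriv w) := (contDiff_infty_iff_deriv.1 hw).2
  have dI : DifferentiableAt ℝ (frame1 w) s := by
    have hd := hwd.differentiable (by simp) s
    exact ((hd.norm ℝ (norm_ne_zero_iff.1 (hk s))).inv (hk s)).smul hd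
  have g := gram_identity hx (h s) (hp s)
  rw [inner_deriv_self dI fun s => inner_frame1_self (hk s), inner_self_eq_one (h1 s),
    inner_frame1_self (hk s), real_inner_comm (frame1 w s) (w s),
    inner_frame1_tangent (hw.differentiable (by simp) s) h1] at g
  rw [kappa2, frame5, norm_sq_eq, g]
  simp only [mul_one, mul_zero, zero_mul, sub_zero, add_zero, zero_pow, ne_eq,
    OfNat.ofNat_ne_zero, not_false_eq_true]
  rw [← Real.sqrt_zero]
  congr 1
  ring

end

end G2Flow

namespace G2Flow

/-! ### The focusing nonlinear Schrödinger equation -/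

section

variable {T : Set ℝ} {u v : ℝ → ℝ → E7} {F : ℝ → ℝ → E7 →L[ℝ] E7} {η : ℝ → ℝ → G2Coord}
  {f : ℝ → ℝ → ℂ} {t s : ℝ}

/-- The nonlinear Schrödinger equation, up to a phase, for the complex curvature of a flow with a
parallel normal frame `P, Q`. -/
theorem exists_nls_of_parallel (hT : TimeInterval T) {P Q : ℝ → ℝ → E7} {p : ℝ → ℝ → ℂ}
    (hu : SmoothOn T u) (hP : SmoothOn T P) (hQ : SmoothOn T Q) (hp : SmoothOn T p)
    (uP : ∀ t ∈ T, ∀ s, inner ℝ (P t s) (u t s) = (0 : ℝ))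
    (uQ : ∀ t ∈ T, ∀ s, inner ℝ (Q t s) (u t s) = (0 : ℝ))
    (PP : ∀ t ∈ T, ∀ s, inner ℝ (P t s) (P t s) = (1 : ℝ))
    (QQ : ∀ t ∈ T, ∀ s, inner ℝ (Q t s) (Q t s) = (1 : ℝ))
    (PQ : ∀ t ∈ T, ∀ s, inner ℝ (P t s) (Q t s) = (0 : ℝ))
    (us : ∀ t ∈ T, ∀ s, deriv (u t) s = (2 * (p t s).re) • P t s - (2 * (p t s).im) • Q t s)
    (Ps : ∀ t ∈ T, ∀ s, deriv (P t) s = (-2 * (p t s).re) • u t s)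
    (Qs : ∀ t ∈ T, ∀ s, deriv (Q t) s = (2 * (p t s).im) • u t s)
    (ut : ∀ t ∈ T, ∀ s, timeDeriv T u t s =
      (2 * (deriv (p t) s).im) • P t s + (2 * (deriv (p t) s).re) • Q t s) :
    ∃ c : ℝ → ℝ, ContDiffOn ℝ ∞ c T ∧ ∀ t ∈ T, ∀ s, Complex.I * timeDeriv T p t s =
      deriv (deriv (p t)) s + 2 * (‖p t s‖ : ℂ) ^ 2 * p t s - c t * p t s := by
  have QP : ∀ t ∈ T, ∀ s, inner ℝ (Q t s) (P t s) = (0 : ℝ) := fun t ht s =>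
    (real_inner_comm _ _).trans (PQ t ht s)
  have Pu : ∀ t ∈ T, ∀ s, inner ℝ (u t s) (P t s) = (0 : ℝ) := fun t ht s =>
    (real_inner_comm _ _).trans (uP t ht s)
  have Qu : ∀ t ∈ T, ∀ s, inner ℝ (u t s) (Q t s) = (0 : ℝ) := fun t ht s =>
    (real_inner_comm _ _).trans (uQ t ht s)
  have td : ∀ {v w : ℝ → ℝ → E7} {x : ℝ}, SmoothOn T v → SmoothOn T w →
      (∀ t ∈ T, ∀ s, inner ℝ (v t s) (w t s) = x) → ∀ t ∈ T, ∀ s,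
      inner ℝ (v t s) (timeDeriv T w t s) + inner ℝ (timeDeriv T v t s) (w t s) = (0 : ℝ) :=
    fun {v w x} hv hw h t ht s => by
      have := (hv.hasDerivWithinAt ht s).inner ℝ (hw.hasDerivWithinAt ht s)
      exact (hT.uniqueDiffOn t ht).eq_deriv _ this
        ((hasDerivWithinAt_const t T x).congr (fun t ht => h t ht s) (h t ht s))
  have sν : SmoothOn T (fun t s => (inner ℝ (timeDeriv T P t s) (Q t s) : ℝ)) :=
    (hP.timeDeriv hT).inner hQ
  -- The speed at which `P` turns towards `Q` in time. It plays the role of the torus component: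
  -- only its space derivative is determined.
  set ν : ℝ → ℝ → ℝ := fun t s => inner ℝ (timeDeriv T P t s) (Q t s) with hν
  have hp' := hp.deriv hT
  have hpt := hp.timeDeriv hT
  have i1 : ∀ t ∈ T, ∀ s, inner ℝ (timeDeriv T P t s) (P t s) = (0 : ℝ) := fun t ht s => by
    have := td hP hP PP t ht s
    rw [real_inner_comm] at this
    linarith
  have i2 : ∀ t ∈ T, ∀ s, inner ℝ (timeDeriv T Q t s) (Q t s) = (0 : ℝ) := fun t ht s => by
    have := td hQ hQ QQ t ht s
    rw [real_inner_comm] at this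
    linarith
  have i3 : ∀ t ∈ T, ∀ s, inner ℝ (timeDeriv T Q t s) (P t s) = -ν t s := fun t ht s => by
    have := td hP hQ PQ t ht s
    rw [real_inner_comm] at this
    simp only [hν]
    linarith
  have i4 : ∀ t ∈ T, ∀ s, inner ℝ (timeDeriv T P t s) (u t s) = -2 * (deriv (p t) s).im :=
    fun t ht s => by
      have := td hP hu uP t ht s
      rw [ut t ht s, inner_add_right, inner_smul_right, inner_smul_right, PP t ht s,
        PQ t ht s] at this
      linarith
  have e1 : ∀ t ∈ T, ∀ s, timeDeriv T (fun t s => deriv (u t) s) t s =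
      ((2 * (p t s).re) • timeDeriv T P t s + (2 * (timeDeriv T p t s).re) • P t s) -
      ((2 * (p t s).im) • timeDeriv T Q t s + (2 * (timeDeriv T p t s).im) • Q t s) :=
    fun t ht s => by
      rw [timeDeriv_congr us ht s]
      exact timeDeriv_of_hasDerivWithinAt hT ht
        ((((hp.hasDerivWithinAt_clm Complex.reCLM ht s).const_mul 2).smul
          (hP.hasDerivWithinAt ht s)).sub
        (((hp.hasDerivWithinAt_clm Complex.imCLM ht s).const_mul 2).smul
          (hQ.hasDerivWithinAt ht s)))
  have e2 : ∀ t ∈ T, ∀ s, deriv (timeDeriv T u t) s =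
      ((2 * (deriv (p t) s).im) • ((-2 * (p t s).re) • u t s) +
        (2 * (deriv (deriv (p t)) s).im) • P t s) +
      ((2 * (deriv (p t) s).re) • ((2 * (p t s).im) • u t s) +
        (2 * (deriv (deriv (p t)) s).re) • Q t s) := fun t ht s => by
    rw [show timeDeriv T u t = _ from funext (ut t ht), ← Ps t ht s, ← Qs t ht s]
    exact ((((hp'.hasDerivAt_clm Complex.imCLM ht s).const_mul 2).smul (hP.hasDerivAt ht s)).add
      (((hp'.hasDerivAt_clm Complex.reCLM ht s).const_mul 2).smul (hQ.hasDerivAt ht s))).deriv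
  -- The components of `u_st = u_ts` along `P` and `Q` give the real and the imaginary part of the
  -- time derivative of `p`.
  have mixed : ∀ t ∈ T, ∀ s, _ := fun t ht s =>
    (e1 t ht s).symm.trans ((hu.timeDeriv_deriv hT ht s).trans (e2 t ht s))
  have q1 : ∀ t ∈ T, ∀ s, (timeDeriv T p t s).re =
      (deriv (deriv (p t)) s).im - (p t s).im * ν t s := fun t ht s => by
    have := congrArg (fun x : E7 => (inner ℝ x (P t s) : ℝ)) (mixed t ht s)
    simp only [inner_add_left, inner_sub_left, real_inner_smul_left, i1 t ht s, i3 t ht s,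
      PP t ht s, QP t ht s, Pu t ht s] at this
    linarith
  have q2 : ∀ t ∈ T, ∀ s, (timeDeriv T p t s).im =
      (p t s).re * ν t s - (deriv (deriv (p t)) s).re := fun t ht s => by
    have := congrArg (fun x : E7 => (inner ℝ x (Q t s) : ℝ)) (mixed t ht s)
    simp only [inner_add_left, inner_sub_left, real_inner_smul_left, i2 t ht s,
      QQ t ht s, PQ t ht s, Qu t ht s] at this
    simp only [hν]
    linarith
  have dν : ∀ t ∈ T, ∀ s, HasDerivAt (ν t)
      (-4 * ((p t s).re * (deriv (p t) s).re + (p t s).im * (deriv (p t) s).im)) s :=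
    fun t ht s => by
      have d1 : deriv (timeDeriv T P t) s =
          (-2 * (p t s).re) • timeDeriv T u t s + (-2 * (timeDeriv T p t s).re) • u t s := by
        rw [← hP.timeDeriv_deriv hT ht s, timeDeriv_congr Ps ht s]
        exact timeDeriv_of_hasDerivWithinAt hT ht
          (((hp.hasDerivWithinAt_clm Complex.reCLM ht s).const_mul (-2)).smul
            (hu.hasDerivWithinAt ht s))
      refine (((hP.timeDeriv hT).hasDerivAt ht s).inner ℝ (hQ.hasDerivAt ht s)).congr_deriv ?_
      rw [d1, Qs t ht s, ut t ht s]
      simp only [inner_add_left, real_inner_smul_left, real_inner_smul_right, i4 t ht s,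
        QQ t ht s, PQ t ht s, Qu t ht s]
      ring
  let c : ℝ → ℝ := fun t => ν t 0 + 2 * ‖p t 0‖ ^ 2
  -- Both sides have the same space derivative, so the difference is a function `c` of time, which a
  -- phase change can absorb.
  have eν : ∀ t ∈ T, ∀ s, ν t s = -2 * ‖p t s‖ ^ 2 + c t := fun t ht s => by
    refine eqOn_of_hasDerivWithinAt_eq TimeInterval.univ
      (fun s _ => (dν t ht s).hasDerivWithinAt) (g := fun s => -2 * ‖p t s‖ ^ 2 + c t)
      (fun s _ => ?_) (by simp only [c]; ring) (mem_univ s)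
    refine ((((hp.hasDerivAt ht s).norm_sq.const_mul (-2)).add_const (c t)).congr_deriv
      ?_).hasDerivWithinAt
    rw [Complex.inner]
    simp
    ring
  refine ⟨c, (sν.slice 0).add (contDiffOn_const.mul (hp.norm_sq.slice 0)), fun t ht s => ?_⟩
  have h1 := q1 t ht s
  have h2 := q2 t ht s
  rw [eν t ht s] at h1 h2
  rw [← Complex.ofReal_pow]
  apply Complex.ext
  · simp only [Complex.mul_re, Complex.I_re, Complex.I_im, Complex.sub_re, Complex.add_re,
      Complex.ofReal_re, Complex.ofReal_im, Complex.mul_im, Complex.re_ofNat, Complex.im_ofNat, h2]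
    ring
  · simp only [Complex.mul_re, Complex.I_re, Complex.I_im, Complex.sub_im, Complex.add_im,
      Complex.ofReal_re, Complex.ofReal_im, Complex.mul_im, Complex.re_ofNat, Complex.im_ofNat, h1]
    ring

/-- The radicand of `κ₂` is the squared length of the difference of the two sides. Vanishing of
`Real.sqrt` only says that it is nonpositive, which suffices. -/
theorem deriv_frame1_eq_of_kappa2_eq_zero {w : ℝ → E7} (hw : ∀ s, DifferentiableAt ℝ w s)
    (hI : ∀ s, DifferentiableAt ℝ (frame1 w) s) (h1 : ∀ s, ‖w s‖ = 1) (hk : ∀ s, k1 w s ≠ 0)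
    (hκ : ∀ s, kappa2 w s = 0) (s : ℝ) :
    deriv (frame1 w) s = -k1 w s • w s + rho1 w s • frame5 w s := by
  have uu := inner_self_eq_one (h1 s)
  have ip := inner_frame1_tangent (hw s) h1
  have f55 : inner ℝ (frame5 w s) (frame5 w s) = (1 : ℝ) :=
    inner_cross_cross_right (inner_frame1_self (hk s)) uu ip
  have f5u : inner ℝ (frame5 w s) (w s) = (0 : ℝ) := inner_cross_self_right _ _
  have uf5 : inner ℝ (w s) (frame5 w s) = (0 : ℝ) := (real_inner_comm _ _).trans f5u
  have e1 : inner ℝ (deriv (frame1 w) s) (w s) = -k1 w s := by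
    have h2 := (hI s).hasDerivAt.inner ℝ (hw s).hasDerivAt
    have h3 : (fun s => (inner ℝ (frame1 w s) (w s) : ℝ)) = fun _ => 0 := funext fun s =>
      inner_frame1_tangent (hw s) h1
    rw [h3] at h2
    have h4 := h2.unique (hasDerivAt_const s (0 : ℝ))
    rw [deriv_eq_k1_smul (hk s), inner_smul_right, inner_frame1_self (hk s)] at h4
    linarith
  have X := Real.sqrt_eq_zero'.1 (hκ s)
  rw [← rho1, e1] at X
  rw [← sub_eq_zero, ← norm_eq_zero, ← sq_eq_zero_iff]
  refine le_antisymm (le_of_eq_of_le ?_ X) (sq_nonneg _)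
  have e2 : inner ℝ (w s) (deriv (frame1 w) s) = -k1 w s := (real_inner_comm _ _).trans e1
  have e3 : inner ℝ (frame5 w s) (deriv (frame1 w) s) = rho1 w s := real_inner_comm _ _
  have e4 : inner ℝ (deriv (frame1 w) s) (frame5 w s) = rho1 w s := rfl
  rw [norm_sq_eq, norm_sq_eq]
  simp only [inner_sub_left, inner_sub_right, inner_add_left, inner_add_right,
    real_inner_smul_left, real_inner_smul_right, e1, e2, e3, e4, uu, f55, f5u, uf5]
  ring

/-- Flows with vanishing second curvature give solutions of the focusing nonlinear Schrödinger
equation. -/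
theorem IsSchrodingerFlow.exists_isNLSSolution (hT : TimeInterval T) (h : IsSchrodingerFlow T u)
    (hk : ∀ t ∈ T, ∀ s, k1 (u t) s ≠ 0) (hκ : ∀ t ∈ T, ∀ s, kappa2 (u t) s = 0) :
    ∃ A : ℝ → ℝ, ContDiffOn ℝ ∞ A T ∧ A 0 = 0 ∧ IsNLSSolution T (psi1 u A) := by
  obtain ⟨hu, hs, hf⟩ := isSchrodingerFlow_iff_cross.1 h
  have sk := hu.k1 hT hk
  have sI1 := hu.frame1 hT hk
  have sI5 := hu.frame5 hT hk
  have sr := hu.rho1 hT hk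
  let θ : ℝ → ℝ → ℝ := fun t s => ∫ x in (0 : ℝ)..s, rho1 (u t) x
  have sθ : SmoothOn T θ := sr.integral hT
  have dθ : ∀ t ∈ T, ∀ s, HasDerivAt (θ t) (rho1 (u t) s) s := fun t ht s =>
    hasDerivAt_integral (sr.contDiff_slice ht).continuous s
  have sc : SmoothOn T (fun t s => Real.cos (θ t s)) := Real.contDiff_cos.comp_contDiffOn sθ
  have ss : SmoothOn T (fun t s => Real.sin (θ t s)) := Real.contDiff_sin.comp_contDiffOn sθ
  -- The pair `I₁, -I₅` is rotated by the angle `∫ρ₁`. This makes it parallel: the space derivatives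
  -- of `P` and `Q` are multiples of `u`.
  let P : ℝ → ℝ → E7 := fun t s =>
    Real.cos (θ t s) • frame1 (u t) s - Real.sin (θ t s) • frame5 (u t) s
  let Q : ℝ → ℝ → E7 := fun t s =>
    -Real.sin (θ t s) • frame1 (u t) s - Real.cos (θ t s) • frame5 (u t) s
  let p : ℝ → ℝ → ℂ := fun t s => ((k1 (u t) s / 2 : ℝ) : ℂ) * cis (θ t s)
  have sP : SmoothOn T P := ContDiffOn.sub (ContDiffOn.smul sc sI1) (ContDiffOn.smul ss sI5)
  have sQ : SmoothOn T Q :=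
    ContDiffOn.sub (ContDiffOn.smul (ContDiffOn.neg ss) sI1) (ContDiffOn.smul sc sI5)
  have sp : SmoothOn T p := ContDiffOn.mul
    (SmoothOn.ofReal (f := fun t s => k1 (u t) s / 2) (ContDiffOn.div_const sk 2)) sθ.cis
  have pre : ∀ t s, (p t s).re = k1 (u t) s / 2 * Real.cos (θ t s) := fun t s => by
    simp only [p, Complex.re_ofReal_mul, cis]
  have pim : ∀ t s, (p t s).im = k1 (u t) s / 2 * Real.sin (θ t s) := fun t s => by
    simp only [p, Complex.im_ofReal_mul, cis]
  have uu : ∀ t ∈ T, ∀ s, inner ℝ (u t s) (u t s) = (1 : ℝ) := fun t ht s =>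
    inner_self_eq_one (hs t ht s)
  have dif : ∀ {v : ℝ → ℝ → E7}, SmoothOn T v → ∀ t ∈ T, ∀ s, DifferentiableAt ℝ (v t) s :=
    fun hv t ht s => (hv.hasDerivAt ht s).differentiableAt
  have i1u : ∀ t ∈ T, ∀ s, inner ℝ (frame1 (u t) s) (u t s) = (0 : ℝ) := fun t ht s =>
    inner_frame1_tangent (dif hu t ht s) (hs t ht)
  have ui1 : ∀ t ∈ T, ∀ s, inner ℝ (u t s) (frame1 (u t) s) = (0 : ℝ) := fun t ht s =>
    (real_inner_comm _ _).trans (i1u t ht s)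
  have i11 : ∀ t ∈ T, ∀ s, inner ℝ (frame1 (u t) s) (frame1 (u t) s) = (1 : ℝ) := fun t ht s =>
    inner_frame1_self (hk t ht s)
  have i55 : ∀ t ∈ T, ∀ s, inner ℝ (frame5 (u t) s) (frame5 (u t) s) = (1 : ℝ) := fun t ht s =>
    inner_cross_cross_right (i11 t ht s) (uu t ht s) (i1u t ht s)
  have i5u : ∀ t s, inner ℝ (frame5 (u t) s) (u t s) = (0 : ℝ) := fun t s =>
    inner_cross_self_right _ _
  have i51 : ∀ t s, inner ℝ (frame5 (u t) s) (frame1 (u t) s) = (0 : ℝ) := fun t s =>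
    inner_cross_self_left _ _
  have i15 : ∀ t s, inner ℝ (frame1 (u t) s) (frame5 (u t) s) = (0 : ℝ) := fun t s =>
    (real_inner_comm _ _).trans (i51 t s)
  have u1 : ∀ t s, cross (u t s) (frame1 (u t) s) = -frame5 (u t) s := fun t s => by
    rw [frame5, cross_anticomm]
  have u5 : ∀ t ∈ T, ∀ s, cross (u t s) (frame5 (u t) s) = frame1 (u t) s := fun t ht s => by
    rw [frame5, cross_anticomm (frame1 (u t) s), cross_neg_right, cross_cross_self, uu t ht s,
      ui1 t ht s, zero_smul, add_zero, neg_smul, one_smul, neg_neg]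
  have d0 : ∀ t ∈ T, ∀ s, HasDerivAt (u t) (k1 (u t) s • frame1 (u t) s) s := fun t ht s => by
    rw [← deriv_eq_k1_smul (hk t ht s)]
    exact hu.hasDerivAt ht s
  have d1 : ∀ t ∈ T, ∀ s, HasDerivAt (frame1 (u t))
      (-k1 (u t) s • u t s + rho1 (u t) s • frame5 (u t) s) s := fun t ht s => by
    rw [← deriv_frame1_eq_of_kappa2_eq_zero (dif hu t ht) (dif sI1 t ht) (hs t ht) (hk t ht)
      (hκ t ht)]
    exact sI1.hasDerivAt ht s
  have d5 : ∀ t ∈ T, ∀ s, HasDerivAt (frame5 (u t)) (-rho1 (u t) s • frame1 (u t) s) s :=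
    fun t ht s => by
      have := HasDerivWithinAt.cross (d1 t ht s).hasDerivWithinAt (d0 t ht s).hasDerivWithinAt
        (S := univ)
      rw [hasDerivWithinAt_univ] at this
      refine this.congr_deriv ?_
      rw [cross_add_left, cross_smul_left, cross_smul_left, cross_smul_right, cross_self,
        cross_self, cross_anticomm (frame5 (u t) s), u5 t ht s]
      simp
  have dk : ∀ t ∈ T, ∀ s, HasDerivAt (k1 (u t)) (deriv (k1 (u t)) s) s := fun t ht s =>
    sk.hasDerivAt ht s
  have dp : ∀ t ∈ T, ∀ s,
      (deriv (p t) s).re = deriv (k1 (u t)) s / 2 * Real.cos (θ t s) -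
        k1 (u t) s / 2 * (Real.sin (θ t s) * rho1 (u t) s) ∧
      (deriv (p t) s).im = deriv (k1 (u t)) s / 2 * Real.sin (θ t s) +
        k1 (u t) s / 2 * (Real.cos (θ t s) * rho1 (u t) s) := fun t ht s => by
    have h1 := sp.hasDerivAt_clm Complex.reCLM ht s
    have h2 := sp.hasDerivAt_clm Complex.imCLM ht s
    simp only [Complex.reCLM_apply, Complex.imCLM_apply, pre, pim] at h1 h2
    constructor
    · refine (h1.unique (((dk t ht s).div_const 2).mul (dθ t ht s).cos)).trans ?_
      ring
    · exact h2.unique (((dk t ht s).div_const 2).mul (dθ t ht s).sin)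
  have cs : ∀ t s, Real.cos (θ t s) ^ 2 + Real.sin (θ t s) ^ 2 = 1 := fun t s =>
    Real.cos_sq_add_sin_sq _
  obtain ⟨c, hc, H⟩ := exists_nls_of_parallel hT hu sP sQ sp
    (fun t ht s => by
      simp only [P, inner_sub_left, real_inner_smul_left, i1u t ht s, i5u]
      ring)
    (fun t ht s => by
      simp only [Q, inner_sub_left, real_inner_smul_left, i1u t ht s, i5u]
      ring)
    (fun t ht s => by
      simp only [P, inner_sub_left, inner_sub_right, real_inner_smul_left, real_inner_smul_right,
        i11 t ht s, i55 t ht s, i15, i51]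
      linear_combination cs t s)
    (fun t ht s => by
      simp only [Q, inner_sub_left, inner_sub_right, real_inner_smul_left, real_inner_smul_right,
        i11 t ht s, i55 t ht s, i15, i51]
      linear_combination cs t s)
    (fun t ht s => by
      simp only [P, Q, inner_sub_left, inner_sub_right, real_inner_smul_left,
        real_inner_smul_right, i11 t ht s, i55 t ht s, i15, i51]
      ring)
    (fun t ht s => by
      rw [(d0 t ht s).deriv, pre, pim]
      simp only [P, Q]
      match_scalars
      · linear_combination -k1 (u t) s * cs t s
      · ring)
    (fun t ht s => by
      have : deriv (P t) s = _ := (((dθ t ht s).cos.smul (d1 t ht s)).sub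
        ((dθ t ht s).sin.smul (d5 t ht s))).deriv
      rw [this, pre]
      module)
    (fun t ht s => by
      have : deriv (Q t) s = _ := (((dθ t ht s).sin.neg.smul (d1 t ht s)).sub
        ((dθ t ht s).cos.smul (d5 t ht s))).deriv
      rw [this, pim]
      simp only [Pi.neg_apply]
      module)
    (fun t ht s => by
      have d2 : deriv (deriv (u t)) s =
          k1 (u t) s • (-k1 (u t) s • u t s + rho1 (u t) s • frame5 (u t) s) +
            deriv (k1 (u t)) s • frame1 (u t) s := by
        rw [show deriv (u t) = fun s => k1 (u t) s • frame1 (u t) s from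
          funext fun s => (d0 t ht s).deriv]
        exact ((dk t ht s).smul (d1 t ht s)).deriv
      rw [hf t ht s, d2, (dp t ht s).1, (dp t ht s).2]
      simp only [P, Q, cross_add_right, cross_smul_right, cross_self, u1, u5 t ht s]
      match_scalars
      · linear_combination -k1 (u t) s * rho1 (u t) s * cs t s
      · linear_combination deriv (k1 (u t)) s * cs t s)
  -- The phase with derivative `-c` removes the term `c(t) p` from the equation.
  have hA := (contDiffOn_integral hT hc).neg
  refine ⟨fun t => -∫ x in (0 : ℝ)..t, c x, hA, by simp, ?_, fun t ht s => ?_, fun t ht s => ?_⟩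
  all_goals
    have eq : psi1 u (fun t => -∫ x in (0 : ℝ)..t, c x) = fun t s =>
        p t s * cis (-∫ x in (0 : ℝ)..t, c x) := by
      funext t s
      rw [psi1_eq, phase1, cis_add, ← mul_assoc]
  · rw [eq]
    exact ContDiffOn.mul sp (SmoothOn.cis (SmoothOn.of_time hA))
  · rw [← norm_ne_zero_iff, norm_psi1]
    exact div_ne_zero (hk t ht s) two_ne_zero
  · rw [eq]
    have dA : HasDerivWithinAt (fun t => cis (-∫ x in (0 : ℝ)..t, c x))
        (cis (-∫ x in (0 : ℝ)..t, c x) * (((-c t : ℝ) : ℂ) * Complex.I)) T t := by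
      simp only [cis_eq]
      exact ((hasDerivWithinAt_integral hT hc.continuousOn ht).neg.ofReal_comp.mul_const
        Complex.I).cexp
    have e1 : timeDeriv T (fun t s => p t s * cis (-∫ x in (0 : ℝ)..t, c x)) t s = _ :=
      timeDeriv_of_hasDerivWithinAt hT ht ((sp.hasDerivWithinAt ht s).mul dA)
    have e2 : deriv (fun s => p t s * cis (-∫ x in (0 : ℝ)..t, c x)) = fun s =>
        deriv (p t) s * cis (-∫ x in (0 : ℝ)..t, c x) := funext fun s =>
      ((sp.hasDerivAt ht s).mul_const _).deriv
    have e3 : deriv (deriv (fun s => p t s * cis (-∫ x in (0 : ℝ)..t, c x))) s =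
        deriv (deriv (p t)) s * cis (-∫ x in (0 : ℝ)..t, c x) := by
      rw [e2]
      exact (((sp.deriv hT).hasDerivAt ht s).mul_const _).deriv
    rw [e1, e3, norm_mul, norm_cis, mul_one]
    push_cast
    linear_combination cis (-∫ x in (0 : ℝ)..t, c x) * H t ht s -
      p t s * cis (-∫ x in (0 : ℝ)..t, c x) * c t * Complex.I_mul_I

end

end G2Flow

namespace G2Flow

/-! ### From the focusing nonlinear Schrödinger equation to binormal motions -/

section

variable {T : Set ℝ} {F : ℝ → ℝ → E7 →L[ℝ] E7} {f : ℝ → ℝ → ℂ} {u : ℝ → ℝ → E7}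

/-- The torus element `(1, -1)` is an involution of `G₂`, equal to `1` on `Im ℍ` and to `-1` on its
orthogonal complement. -/
theorem inImH_of_rotMap {x : E7} (h : rotMap (cis 0) (cis Real.pi) x = x) : InImH x := by
  have e := fun i : Fin 7 => congrArg (fun v : E7 => v i) h
  simp only [rotMap_apply] at e
  have e3 := e 3
  have e4 := e 4
  have e5 := e 5
  have e6 := e 6
  simp [cis] at e3 e4 e5 e6
  exact ⟨by linarith, by linarith, by linarith, by linarith⟩

/-- The logarithmic time derivative of a frame belonging to a solution of the focusing nonlinear
Schrödinger equation. -/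
def nlsTime (f : ℝ → ℂ) (s : ℝ) : G2Coord :=
  (-Complex.I * deriv f s, 0, 0, -2 * ‖f s‖ ^ 2, ‖f s‖ ^ 2, 0, 0, 0)

/-- The system divides by `φ₂` and is of no use here. With `φ₂ = φ₃ = 0`, however, the structure
equation for these local torus components reduces to the focusing equation itself. -/
theorem IsNLSSolution.exists_isFrame (hT : TimeInterval T) (h : IsNLSSolution T f) :
    ∃ F, F 0 0 = 1 ∧
      IsFrame T F (fun t s => flowCoord (f t s) 0 0) (fun t s => nlsTime (f t) s) := by
  have hf := h.smooth
  have z : SmoothOn T (fun _ _ => (0 : ℂ)) := contDiffOn_const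
  have m := hf.norm_sq
  refine exists_isFrame_of_zero_curvature hT (hf.flowCoord z z)
    (ContDiffOn.prodMk (contDiffOn_const.mul (hf.deriv hT)) (contDiffOn_const.prodMk
      (contDiffOn_const.prodMk ((contDiffOn_const.mul m).prodMk (m.prodMk contDiffOn_const)))))
    fun t ht s => ?_
  have z0 : timeDeriv T (fun _ _ => (0 : ℂ)) t s = 0 := by simp [timeDeriv]
  have dm : HasDerivAt (fun s => ‖f t s‖ ^ 2)
      (2 * ((f t s).re * (deriv (f t) s).re + (f t s).im * (deriv (f t) s).im)) s := by
    refine (hf.hasDerivAt ht s).norm_sq.congr_deriv ?_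
    rw [Complex.inner]
    simp
    ring
  have d : deriv (fun s => nlsTime (f t) s) s = _ :=
    ((((hf.deriv hT).hasDerivAt ht s).const_mul (-Complex.I)).prodMk
      ((hasDerivAt_const s (0 : ℂ)).prodMk ((hasDerivAt_const s (0 : ℂ)).prodMk
        ((dm.const_mul (-2)).prodMk (dm.prodMk (hasDerivAt_const s (0 : ℂ × ℂ × ℂ))))))).deriv
  have q := h.eq t ht s
  rw [hf.timeDeriv_flowCoord hT z z ht s, z0]
  refine (congrArg _ d).trans ?_
  rw [nlsTime, g2Bracket_flowCoord]
  simp only [flowCoord, map_zero, neg_zero, mul_zero, zero_mul, sub_zero, add_zero, Prod.mk_sub_mk,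
    Prod.mk.injEq, Complex.zero_im, sub_self, zero_sub, and_true, true_and, Prod.mk_zero_zero]
  refine ⟨?_, ?_⟩
  · push_cast
    linear_combination -Complex.I * q + timeDeriv T f t s * Complex.I_sq
  · simp only [Prod.neg_mk, Prod.mk.injEq, neg_zero, true_and, and_true]
    constructor <;> simp <;> ring

/-- A symmetry argument. The involution fixing `Im ℍ` commutes with both logarithmic derivatives, so
multiplying `F` by it on the right gives a frame with the same derivatives. By uniqueness this
equals `g F` with `g` constant, and the value at the origin shows that `g` is the involution.
Applied to `e₀`, which the involution fixes, this says that `F e₀` is fixed too. -/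
theorem IsFrame.inImH (hT : TimeInterval T) (h0 : F 0 0 = 1)
    (h : IsFrame T F (fun t s => flowCoord (f t s) 0 0) (fun t s => nlsTime (f t) s)) {t : ℝ}
    (ht : t ∈ T) (s : ℝ) : InImH (F t s (stdVec 0)) := by
  have hR := h.rotate hT (θ := fun _ _ => 0) (φ := fun _ _ => Real.pi) contDiffOn_const
    contDiffOn_const
  obtain ⟨g, -, hg⟩ := h.exists_isG2Map hT hR
    (fun t _ s => by simp [flowCoord, rotCoord, cis_zero])
    (fun t _ s => by simp [nlsTime, rotCoord, cis_zero, timeDeriv])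
  have e0 := hg 0 hT.zero_mem 0
  rw [h0, one_mul, mul_one] at e0
  refine inImH_of_rotMap ?_
  rw [e0, ← clm_mul_apply, ← hg t ht s, clm_mul_apply, rotMap_stdVec_zero]

theorem IsSchrodingerFlow.exists_isBinormalMotion_inImH (hT : TimeInterval T)
    (h : IsSchrodingerFlow T u) (hi : ∀ t ∈ T, ∀ s, InImH (u t s)) :
    ∃ γ, IsBinormalMotion T γ ∧ (∀ t ∈ T, ∀ s, InImH (γ t s)) ∧ ∀ t ∈ T, deriv (γ t) = u t := by
  obtain ⟨hγ, hd⟩ := h.isBinormalMotion hT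
  refine ⟨_, hγ, fun t ht s => inImH_add (inImH_integral
    ((h.smooth.contDiff_slice ht).continuous.intervalIntegrable _ _) fun x _ => hi t ht x)
    (inImH_integral ?_ fun τ hτ => ?_), hd⟩
  · refine ContinuousOn.intervalIntegrable (ContinuousOn.mono ?_ (hT.uIcc_subset ht))
    exact ((h.smooth.cross (h.smooth.deriv hT)).slice 0).continuousOn
  · have := hT.uIcc_subset ht hτ
    exact inImH_cross (hi τ this 0) (inImH_deriv (hi τ this) 0)

/-- Every nowhere vanishing solution of the focusing nonlinear Schrödinger equation comes from a
binormal motion in `Im ℍ`. -/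
theorem IsNLSSolution.exists_isBinormalMotion (hT : TimeInterval T) (h : IsNLSSolution T f) :
    ∃ γ : ℝ → ℝ → E7, IsBinormalMotion T γ ∧ (∀ t ∈ T, ∀ s, InImH (γ t s)) ∧
      (∀ t ∈ T, ∀ s, k1 (deriv (γ t)) s ≠ 0) ∧
      ∃ A : ℝ → ℝ, ContDiffOn ℝ ∞ A T ∧
        ∀ t ∈ T, ∀ s, f t s = psi1 (fun τ => deriv (γ τ)) A t s := by
  obtain ⟨F, h0, hF⟩ := h.exists_isFrame hT
  have hfl : IsFlowFrame T F f (fun _ _ => 0) (fun _ _ => 0) (fun t s => nlsTime (f t) s) :=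
    ⟨hF, h.smooth, contDiffOn_const, contDiffOn_const, fun t _ s => ⟨rfl, by simp [nlsTime], rfl⟩⟩
  obtain ⟨γ, hγ, hi, hd⟩ := (hfl.isSchrodingerFlow hT).exists_isBinormalMotion_inImH hT
    fun t ht s => hF.inImH hT h0 ht s
  obtain ⟨θ, sθ, eθ⟩ := h.smooth.exists_arg hT h.ne
  have n1 : SmoothOn T (fun t s => -θ t s) := ContDiffOn.neg sθ
  have n2 : SmoothOn T (fun _ _ => (0 : ℝ)) := contDiffOn_const
  have hR := (hF.rotate hT n1 n2).congr
    (κ' := fun t s => frenetCoord (2 * ‖f t s‖) (deriv (θ t) s) 0 0 0) fun t ht s => by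
      have x1 : f t s * cis (-θ t s) = ((2 * ‖f t s‖ / 2 : ℝ) : ℂ) := by
        rw [mul_div_cancel_left₀ _ (two_ne_zero : (2 : ℝ) ≠ 0)]
        conv_lhs => rw [eθ t ht s]
        rw [mul_assoc, cis_mul_cis_neg, mul_one]
      have d1 : deriv (fun s => -θ t s) s = -deriv (θ t) s := (sθ.hasDerivAt ht s).neg.deriv
      simp [frenetCoord, rotCoord, flowCoord, x1, d1]
  have e0 : ∀ t s, (F t s * rotMap (cis (-θ t s)) (cis 0)) (stdVec 0) = F t s (stdVec 0) :=
    fun t s => by rw [clm_mul_apply, rotMap_stdVec_zero]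
  have m1 : ∀ t ∈ T, ∀ s, 0 < 2 * ‖f t s‖ := fun t ht s =>
    mul_pos two_pos (norm_pos_iff.2 (h.ne t ht s))
  have rk : ∀ t ∈ T, ∀ s, k1 (deriv (γ t)) s = 2 * ‖f t s‖ := fun t ht s => by
    have := k1_eq_of_frenet (hR.isG2Map t ht) (hR.space t ht) (m1 t ht) s
    rw [hd t ht]
    simpa only [e0] using this
  have r1 : ∀ t ∈ T, ∀ s, rho1 (deriv (γ t)) s = deriv (θ t) s := fun t ht s => by
    have := rho1_eq_of_frenet (hR.isG2Map t ht) (hR.space t ht) (m1 t ht) s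
    rw [hd t ht]
    simpa only [e0] using this
  refine ⟨γ, hγ, hi, fun t ht s => ?_, fun t => θ t 0, sθ.slice 0, fun t ht s => ?_⟩
  · rw [rk t ht s]
    exact (m1 t ht s).ne'
  · have p1 : phase1 (fun t => deriv (γ t)) (fun t => θ t 0) t s = θ t s := by
      simp only [phase1, r1 t ht]
      rw [integral_deriv_eq sθ hT ht, sub_add_cancel]
    rw [psi1_eq, p1, rk t ht s, mul_div_cancel_left₀ _ (two_ne_zero : (2 : ℝ) ≠ 0)]
    exact eθ t ht s

theorem rhs1_eq_of_eq_zero (f₁ f₂ : ℝ → ℂ) (h : ∀ s, f₂ s = 0) (s : ℝ) :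
    rhs1 f₁ f₂ s = deriv (deriv f₁) s + 2 * (‖f₁ s‖ : ℂ) ^ 2 * f₁ s := by
  simp only [rhs1, h, norm_zero]
  simp
  ring

end

end G2Flow

end

/-! ### The correspondence between flows and nonlinear Schrödinger systems -/

theorem mainTheorem1 (T : Set ℝ) (hT : T.OrdConnected) (hT' : T.Nontrivial) (h0 : (0 : ℝ) ∈ T) :
    -- the Schrödinger flow has the form `u_t = u × u_ss`
    (∀ u : ℝ → ℝ → G2Flow.E7, G2Flow.IsSchrodingerFlow T u ↔
      G2Flow.SmoothOn T u ∧ (∀ t ∈ T, ∀ s, ‖u t s‖ = 1) ∧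
        ∀ t ∈ T, ∀ s,
          G2Flow.timeDeriv T u t s = G2Flow.cross (u t s) (deriv (deriv (u t)) s)) ∧
    -- the Schrödinger flows are the unit tangent fields of the binormal motions
    (∀ u : ℝ → ℝ → G2Flow.E7, G2Flow.IsSchrodingerFlow T u ↔
      ∃ γ : ℝ → ℝ → G2Flow.E7, G2Flow.IsBinormalMotion T γ ∧
        ∀ t ∈ T, ∀ s, deriv (γ t) s = u t s) ∧
    -- from a Schrödinger flow to a solution of the system
    (∀ u : ℝ → ℝ → G2Flow.E7, G2Flow.IsSchrodingerFlow T u →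
      (∀ t ∈ T, ∀ s, G2Flow.k1 (u t) s ≠ 0) → (∀ t ∈ T, ∀ s, G2Flow.kappa2 (u t) s ≠ 0) →
      ∃ A B : ℝ → ℝ, ContDiffOn ℝ ∞ A T ∧ ContDiffOn ℝ ∞ B T ∧ A 0 = 0 ∧ B 0 = 0 ∧
        G2Flow.IsNLSTSolution T (G2Flow.psi1 u A) (G2Flow.psi2 u A B) (G2Flow.psi3 u A B)) ∧
    -- from a solution of the system to a Schrödinger flow, unique up to `G₂`
    (∀ f₁ f₂ f₃ : ℝ → ℝ → ℂ, G2Flow.IsNLSTSolution T f₁ f₂ f₃ →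
      (∃ u : ℝ → ℝ → G2Flow.E7, G2Flow.IsSchrodingerFlow T u ∧
        (∀ t ∈ T, ∀ s, G2Flow.k1 (u t) s ≠ 0) ∧ (∀ t ∈ T, ∀ s, G2Flow.kappa2 (u t) s ≠ 0) ∧
        G2Flow.HasTransform T u f₁ f₂ f₃) ∧
      (∀ u v : ℝ → ℝ → G2Flow.E7,
        G2Flow.IsSchrodingerFlow T u → G2Flow.IsSchrodingerFlow T v →
        G2Flow.HasTransform T u f₁ f₂ f₃ → G2Flow.HasTransform T v f₁ f₂ f₃ →
        ∃ g : G2Flow.E7 ≃ₗᵢ[ℝ] G2Flow.E7, G2Flow.IsG2 g ∧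
          ∀ t ∈ T, ∀ s, v t s = g (u t s))) ∧
    -- for `φ₂ = 0` the first equation of the system is the focusing NLS
    (∀ f₁ f₂ : ℝ → ℂ, (∀ s, f₂ s = 0) → ∀ s,
      G2Flow.rhs1 f₁ f₂ s = deriv (deriv f₁) s + 2 * (‖f₁ s‖ : ℂ) ^ 2 * f₁ s) ∧
    -- flows with `κ₂ = 0`, that is `φ₂ = 0`, give solutions of the focusing NLS
    (∀ u : ℝ → ℝ → G2Flow.E7, G2Flow.IsSchrodingerFlow T u →
      (∀ t ∈ T, ∀ s, G2Flow.k1 (u t) s ≠ 0) → (∀ t ∈ T, ∀ s, G2Flow.kappa2 (u t) s = 0) →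
      ∃ A : ℝ → ℝ, ContDiffOn ℝ ∞ A T ∧ A 0 = 0 ∧ G2Flow.IsNLSSolution T (G2Flow.psi1 u A)) ∧
    -- binormal motions in `Im ℍ = ℝ³` have `κ₂ = 0`
    (∀ γ : ℝ → ℝ → G2Flow.E7, G2Flow.IsBinormalMotion T γ →
      (∀ t ∈ T, ∀ s, G2Flow.InImH (γ t s)) → (∀ t ∈ T, ∀ s, G2Flow.k1 (deriv (γ t)) s ≠ 0) →
      ∀ t ∈ T, ∀ s, G2Flow.kappa2 (deriv (γ t)) s = 0) ∧
    -- every nowhere vanishing solution of the focusing NLS comes from a binormal motion in `Im ℍ`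
    (∀ f : ℝ → ℝ → ℂ, G2Flow.IsNLSSolution T f →
      ∃ γ : ℝ → ℝ → G2Flow.E7, G2Flow.IsBinormalMotion T γ ∧
        (∀ t ∈ T, ∀ s, G2Flow.InImH (γ t s)) ∧
        (∀ t ∈ T, ∀ s, G2Flow.k1 (deriv (γ t)) s ≠ 0) ∧
        ∃ A : ℝ → ℝ, ContDiffOn ℝ ∞ A T ∧
          ∀ t ∈ T, ∀ s, f t s = G2Flow.psi1 (fun τ => deriv (γ τ)) A t s) := by
  have hT : G2Flow.TimeInterval T := ⟨hT, hT', h0⟩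
  refine ⟨fun u => G2Flow.isSchrodingerFlow_iff_cross, fun u => ⟨fun h => ?_, ?_⟩,
    fun u h hk hκ => h.exists_isNLSTSolution hT hk hκ,
    fun f₁ f₂ f₃ h => ⟨h.exists_flow hT, fun u v hu hv hfu hfv =>
      hfu.exists_isG2 hT hu hv hfv h.ne₁ h.ne₂⟩,
    G2Flow.rhs1_eq_of_eq_zero, fun u h hk hκ => h.exists_isNLSSolution hT hk hκ,
    fun γ h hi hk t ht s => ?_, fun f h => h.exists_isBinormalMotion hT⟩
  · exact ⟨_, (h.isBinormalMotion hT).1, fun t ht s => congrFun ((h.isBinormalMotion hT).2 t ht) s⟩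
  · rintro ⟨γ, hγ, e⟩
    exact hγ.isSchrodingerFlow hT e
  · exact G2Flow.kappa2_eq_zero_of_inImH ((h.smooth.deriv hT).contDiff_slice ht)
      (G2Flow.inImH_deriv (hi t ht)) (h.unit_speed t ht) (hk t ht) s
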